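/- Let $G$ be a compact connected Lie group with Lie algebra $\mathfrak g$ and let $K\subset G$ be a closed connected subgroup such that $(G,K)$ is a symmetric pair of compact type: there is a smooth automorphism $\sigma$ of $G$ with $\sigma\circ\sigma=\mathrm{id}$ such that $(G^\sigma)_0\subset K\subset G^\sigma$, and the Killing form $\langle\cdot,\cdot\rangle$ of $\mathfrak g$ is negative definite (i.e. $\mathfrak g$ is compact and semisimple). Write $\sigma$ also for the induced automorphism of $\mathfrak g$, and for $X\in\mathfrak g$ let $X^{\mathfrak k}=\frac12(X+\sigma X)$ and $X^{\mathfrak p}=\frac12(X-\sigma X)$ be its components with respect to the decomposition $\mathfrak g=\mathfrak k\oplus\mathfrak p$ into the $\pm1$-eigenspaces of $\sigma$. Let $T_K\subset T_G$ be maximal tori of $K$ and of $G$ respectively, with Lie algebras $\mathfrak t_{\mathfrak k}\subset\mathfrak t_{\mathfrak g}$, and let $\Delta_{\mathfrak g}\subset\mathfrak t_{\mathfrak g}^*$ be the set of roots of $\mathfrak g$, i.e. of all nonzero $\alpha\in\mathfrak t_{\mathfrak g}^*$ for which there is a nonzero $X\in\mathfrak g^{\mathbb C}$ with $[W,X]=i\alpha(W)X$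 for all $W\in\mathfrak t_{\mathfrak g}$. Then $\sigma$ maps $\mathfrak t_{\mathfrak g}$ to itself, for every $\alpha\in\mathfrak t_{\mathfrak g}^*$ there is a unique $H_\alpha\in\mathfrak t_{\mathfrak g}$ with $\alpha(W)=\langle W,H_\alpha\rangle$ for all $W\in\mathfrak t_{\mathfrak g}$, and the following hold, where $|X|^2=\langle X,X\rangle$. (a) For every $\alpha\in\Delta_{\mathfrak g}$ with $\alpha\circ\sigma\ne\alpha$, either (1) $\langle H_\alpha,H_{\alpha\circ\sigma}\rangle=0$ and $|H_\alpha^{\mathfrak p}|^2=|H_\alpha^{\mathfrak k}|^2$, or (2) $2\,\frac{\langle H_\alpha,H_{\alpha\circ\sigma}\rangle}{|H_\alpha|^2}=-1$, $|H_\alpha^{\mathfrak p}|^2=3|H_\alpha^{\mathfrak k}|^2$ and $\alpha+\alpha\circ\sigma\in\Delta_{\mathfrak g}$. (b) The set of restrictions $\Delta_{\mathfrak g}|_{\mathfrak t_{\mathfrak k}}=\{\alpha|_{\mathfrak t_{\mathfrak k}}\mid\alpha\in\Delta_{\mathfrak g}\}$ is a (crystallographic, not necessarily reduced) root system in $\mathfrak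 t_{\mathfrak k}^*$: it is finite, does not contain $0$, spans $\mathfrak t_{\mathfrak k}^*$, is preserved by the reflections that are orthogonal with respect to the Killing form, and has integral Cartan numbers; the coroot of $\alpha|_{\mathfrak t_{\mathfrak k}}$ is $2H_\alpha^{\mathfrak k}/|H_\alpha^{\mathfrak k}|^2\in\mathfrak t_{\mathfrak k}$. (c) This root system need not be reduced: there are $(G,K)$, $T_K\subset T_G$ as above and an element $\varphi\in\Delta_{\mathfrak g}|_{\mathfrak t_{\mathfrak k}}$ such that also $2\varphi\in\Delta_{\mathfrak g}|_{\mathfrak t_{\mathfrak k}}$. -/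

import Mathlib

open scoped Manifold ContDiff TensorProduct

universe u v

/-- A smooth real Lie group has the regularity that Mathlib asks for its Lie algebra. -/
instance instLEInftyMinSmoothnessReal : ENat.LEInfty (minSmoothness ℝ 3) :=
  ⟨by
    rw [minSmoothness_of_isRCLikeNormedField]
    exact ENat.LEInfty.out⟩

/-- A finite-dimensional real normed space is complete. -/
instance instCompleteSpaceOfFiniteDimensionalReal (E : Type u) [NormedAddCommGroup E]
    [NormedSpace ℝ E] [FiniteDimensional ℝ E] : CompleteSpace E :=
  FiniteDimensional.complete ℝ E

namespace SymPair

section LieGroups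

variable {E : Type u} [NormedAddCommGroup E] [NormedSpace ℝ E]
  {G : Type v} [TopologicalSpace G] [ChartedSpace E G] [Group G] [LieGroup 𝓘(ℝ, E) ∞ G]

/-- `X` in the Lie algebra of `G` is the velocity at time `0` of the curve `γ`, which starts at the
identity. -/
def IsVelocity (γ : ℝ → G) (X : GroupLieAlgebra 𝓘(ℝ, E) G) : Prop :=
  γ 0 = 1 ∧ HasMFDerivAt 𝓘(ℝ, ℝ) 𝓘(ℝ, E) γ 0
    (ContinuousLinearMap.toSpanSingleton ℝ (X : E) : ℝ →L[ℝ] E)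

theorem isVelocity_one : IsVelocity (fun _ : ℝ => (1 : G)) (0 : GroupLieAlgebra 𝓘(ℝ, E) G) := by
  refine ⟨rfl, ?_⟩
  have h := hasMFDerivAt_const (I := 𝓘(ℝ, ℝ)) (I' := 𝓘(ℝ, E)) (1 : G) (0 : ℝ)
  refine h.congr_mfderiv ?_
  apply ContinuousLinearMap.ext
  intro t
  exact (smul_zero (M := ℝ) (A := E) t).symm

theorem IsVelocity.smul {γ : ℝ → G} {X : GroupLieAlgebra 𝓘(ℝ, E) G} (h : IsVelocity γ X) (c : ℝ) :
    IsVelocity (fun t => γ (c * t)) (c • X) := by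
  refine ⟨by simpa using h.1, ?_⟩
  have h1 : HasMFDerivAt 𝓘(ℝ, ℝ) 𝓘(ℝ, ℝ) (fun t : ℝ => c * t) 0
      (ContinuousLinearMap.toSpanSingleton ℝ c : ℝ →L[ℝ] ℝ) := by
    have h0 : HasFDerivAt (fun t : ℝ => c * t)
        (ContinuousLinearMap.toSpanSingleton ℝ c : ℝ →L[ℝ] ℝ) 0 := by
      have := (hasDerivAt_id (0 : ℝ)).const_mul c
      simpa using this.hasFDerivAt
    exact h0.hasMFDerivAt
  have h2 : ∀ s : ℝ, s = 0 → HasMFDerivAt 𝓘(ℝ, ℝ) 𝓘(ℝ, E) γ s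
      (ContinuousLinearMap.toSpanSingleton ℝ (X : E) : ℝ →L[ℝ] E) := by
    rintro s rfl
    exact h.2
  have h3 := (h2 (c * 0) (mul_zero c)).comp (0 : ℝ) h1
  refine h3.congr_mfderiv ?_
  apply ContinuousLinearMap.ext
  intro t
  exact mul_smul (α := ℝ) (β := E) t c X

theorem hasMFDerivAt_mul_one (p : G × G) (hp : p = (1, 1)) :
    HasMFDerivAt (𝓘(ℝ, E).prod 𝓘(ℝ, E)) 𝓘(ℝ, E) (fun q : G × G => q.1 * q.2) p
      (ContinuousLinearMap.fst ℝ E E + ContinuousLinearMap.snd ℝ E E : E × E →L[ℝ] E) := by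
  subst hp
  have hd : MDifferentiableAt (𝓘(ℝ, E).prod 𝓘(ℝ, E)) 𝓘(ℝ, E) (fun q : G × G => q.1 * q.2)
      (1, 1) := (contMDiff_mul 𝓘(ℝ, E) ∞).mdifferentiableAt (by simp)
  refine hd.hasMFDerivAt.congr_mfderiv ?_
  apply ContinuousLinearMap.ext
  intro w
  have h := mfderiv_prod_eq_add_apply (v := w) hd
  refine h.trans ?_
  have e1 : (fun z : G => z * (1 : G)) = id := by ext z; simp
  have e2 : (fun z : G => (1 : G) * z) = id := by ext z; simp
  have d1 : mfderiv 𝓘(ℝ, E) 𝓘(ℝ, E) (fun z : G => z * (1 : G)) 1 =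
      (ContinuousLinearMap.id ℝ E : E →L[ℝ] E) := by
    refine HasMFDerivAt.mfderiv ?_
    rw [e1]
    exact hasMFDerivAt_id (1 : G)
  have d2 : mfderiv 𝓘(ℝ, E) 𝓘(ℝ, E) (fun z : G => (1 : G) * z) 1 =
      (ContinuousLinearMap.id ℝ E : E →L[ℝ] E) := by
    refine HasMFDerivAt.mfderiv ?_
    rw [e2]
    exact hasMFDerivAt_id (1 : G)
  exact congrArg₂ (fun (a b : E) => a + b) (congrArg (fun f : E →L[ℝ] E => f (w : E × E).1) d1)
    (congrArg (fun f : E →L[ℝ] E => f (w : E × E).2) d2)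

theorem IsVelocity.mul {γ δ : ℝ → G} {X Y : GroupLieAlgebra 𝓘(ℝ, E) G}
    (hγ : IsVelocity γ X) (hδ : IsVelocity δ Y) :
    IsVelocity (fun t => γ t * δ t) (X + Y) := by
  refine ⟨by simp [hγ.1, hδ.1], ?_⟩
  have h1 := hasMFDerivAt_mul_one (E := E) (γ 0, δ 0) (by simp [hγ.1, hδ.1])
  have h2 := h1.comp (0 : ℝ) (hγ.2.prodMk hδ.2)
  refine h2.congr_mfderiv ?_
  apply ContinuousLinearMap.ext
  intro t
  exact (smul_add (M := ℝ) (A := E) t X Y).symm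

/-- The tangent space at the identity of a subgroup `H` of `G`: all velocities at the identity of
curves in `G` that run in `H`. For a closed subgroup `H` this is its Lie algebra, as a subspace of
the Lie algebra of `G`. -/
def lieAlg (H : Subgroup G) : Submodule ℝ (GroupLieAlgebra 𝓘(ℝ, E) G) where
  carrier := {X | ∃ γ : ℝ → G, (∀ t, γ t ∈ H) ∧ IsVelocity γ X}
  zero_mem' := ⟨fun _ => 1, fun _ => H.one_mem, isVelocity_one⟩
  add_mem' := by
    rintro X Y ⟨γ, hγ, hX⟩ ⟨δ, hδ, hY⟩
    exact ⟨fun t => γ t * δ t, fun t => H.mul_mem (hγ t) (hδ t), hX.mul hY⟩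
  smul_mem' := by
    rintro c X ⟨γ, hγ, hX⟩
    exact ⟨fun t => γ (c * t), fun t => hγ (c * t), hX.smul c⟩

theorem lieAlg_mono {H H' : Subgroup G} (h : H ≤ H') :
    lieAlg (E := E) H ≤ lieAlg (E := E) H' := by
  rintro X ⟨γ, hγ, hX⟩
  exact ⟨γ, fun t => h (hγ t), hX⟩

/-- A torus in `G`: a compact connected abelian subgroup. -/
structure IsTorus (T : Subgroup G) : Prop where
  isCompact : IsCompact (T : Set G)
  isConnected : IsConnected (T : Set G)
  mul_comm : ∀ a ∈ T, ∀ b ∈ T, a * b = b * a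

/-- `T` is a maximal torus of the subgroup `H`. -/
def IsMaximalTorus (H T : Subgroup G) : Prop :=
  Maximal (fun T' : Subgroup G => IsTorus T' ∧ T' ≤ H) T

variable [FiniteDimensional ℝ E]

/-- The root system of the Lie algebra of `G` with respect to `t`: the nonzero linear forms `α` on
`t` such that `{X ∈ 𝔤 ⊗ ℂ | [W, X] = i α(W) X for all W ∈ t}` is nonzero. -/
def roots (t : Submodule ℝ (GroupLieAlgebra 𝓘(ℝ, E) G)) : Set (Module.Dual ℝ t) :=
  {α | α ≠ 0 ∧ ∃ X : ℂ ⊗[ℝ] GroupLieAlgebra 𝓘(ℝ, E) G, X ≠ 0 ∧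
    ∀ W : t, ⁅(1 : ℂ) ⊗ₜ[ℝ] (W : GroupLieAlgebra 𝓘(ℝ, E) G), X⁆ =
      (Complex.I * ((α W : ℝ) : ℂ)) • X}

variable (E G)

/-- A symmetric pair `(G, K)` of compact type with `K` connected, given with its involution `σ`:
`K` is a closed connected subgroup that lies between the fixed point group of `σ` and its identity
component, and the Killing form of the Lie algebra of `G` is negative definite, i.e. the Lie algebra
is compact and semisimple. -/
structure CompactTypePair where
  /-- the involution -/
  σ : G →* G
  contMDiff_σ : ContMDiff 𝓘(ℝ, E) 𝓘(ℝ, E) ∞ σ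
  σ_σ : ∀ g, σ (σ g) = g
  /-- the symmetric subgroup -/
  K : Subgroup G
  isClosed_K : IsClosed (K : Set G)
  isConnected_K : IsConnected (K : Set G)
  σ_eq_of_mem : ∀ g ∈ K, σ g = g
  component_subset : connectedComponentIn {g : G | σ g = g} 1 ⊆ (K : Set G)
  killing_neg : ∀ X : GroupLieAlgebra 𝓘(ℝ, E) G, X ≠ 0 →
    killingForm ℝ (GroupLieAlgebra 𝓘(ℝ, E) G) X X < 0

/-- A choice of maximal tori `TK` of `K` and `TG` of `G` with `TK` contained in `TG`. -/
structure MaximalTori (S : CompactTypePair E G) where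
  TK : Subgroup G
  TG : Subgroup G
  isMaximalTorus_TK : IsMaximalTorus S.K TK
  isMaximalTorus_TG : IsMaximalTorus ⊤ TG
  le : TK ≤ TG

variable {E G}

namespace CompactTypePair

variable (S : CompactTypePair E G)

/-- The differential of `σ` at the identity, acting on the Lie algebra of `G`; the tangent spaces
at `1` and at `σ 1 = 1` are the same. -/
noncomputable def dσ : GroupLieAlgebra 𝓘(ℝ, E) G →ₗ[ℝ] GroupLieAlgebra 𝓘(ℝ, E) G :=
  (show GroupLieAlgebra 𝓘(ℝ, E) G →L[ℝ] GroupLieAlgebra 𝓘(ℝ, E) G from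
    mfderiv 𝓘(ℝ, E) 𝓘(ℝ, E) S.σ (1 : G)).toLinearMap

/-- The component of `X` in the `1`-eigenspace `𝔨` of the differential of `σ`. -/
noncomputable def kPart (X : GroupLieAlgebra 𝓘(ℝ, E) G) : GroupLieAlgebra 𝓘(ℝ, E) G :=
  (2⁻¹ : ℝ) • (X + S.dσ X)

/-- The component of `X` in the `-1`-eigenspace `𝔭` of the differential of `σ`. -/
noncomputable def pPart (X : GroupLieAlgebra 𝓘(ℝ, E) G) : GroupLieAlgebra 𝓘(ℝ, E) G :=
  (2⁻¹ : ℝ) • (X - S.dσ X)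

end CompactTypePair

namespace MaximalTori

variable {S : CompactTypePair E G} (T : MaximalTori E G S)

/-- The Lie algebra of `TG`. -/
def tg : Submodule ℝ (GroupLieAlgebra 𝓘(ℝ, E) G) := lieAlg T.TG

/-- The Lie algebra of `TK`. -/
def tk : Submodule ℝ (GroupLieAlgebra 𝓘(ℝ, E) G) := lieAlg T.TK

theorem tk_le_tg : T.tk ≤ T.tg := lieAlg_mono T.le

/-- Restriction of linear forms from the Lie algebra of `TG` to the Lie algebra of `TK`. -/
noncomputable def restrict (α : Module.Dual ℝ T.tg) : Module.Dual ℝ T.tk :=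
  α.comp (Submodule.inclusion T.tk_le_tg)

/-- The set of all restrictions to the Lie algebra of `TK` of roots with respect to `TG`. -/
noncomputable def restrictedRoots : Set (Module.Dual ℝ T.tk) := T.restrict '' roots T.tg

end MaximalTori

end LieGroups

end SymPair

/-! The proof separates a statement about Lie algebras from the Lie theory that leads to it.

Algebraic core. Let `θ` be the differential of `σ`. It preserves the negative definite Killing form,
`t_g` is abelian and equal to its own centralizer, and `t_k` contains every element of `𝔨` that
commutes with it. Then `t_g` is the whole centralizer of `t_k`
(`IsRestrictedPair.mem_tg_of_forall`). Hence `θ` preserves `t_g` and permutes the roots, and no root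
vanishes on `t_k`, so that `H_α^𝔨 ≠ 0`. If `α ∘ θ ≠ α`, then `H_α^𝔭 ≠ 0` as well, and the Cartan
number of `α ∘ θ` and `α` is `-1`, `0` or `1`. The value `1` would make `α ∘ θ - α` a root that
vanishes on `t_k`. The values `0` and `-1` are the two cases of (a), with `|H_α^𝔨|²` equal to
`|H_α|²/2` or `|H_α|²/4`. For (b), the reflection in `α|t_k` lifts to an element of the Weyl group
of `𝔤`: the reflection in `α`, the product of the commuting reflections in `α` and `α ∘ θ`, or the
reflection in the root `α + α ∘ θ`, according to whether `α ∘ θ = α`, case (1) or case (2) holds.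
This gives invariance and integrality. The facts on ordinary roots come from the complexification,
which is a Killing Lie algebra with Cartan subalgebra `t_g ⊗ ℂ`.

From groups to algebras. It has to be shown that maximal tori have self-centralizing Lie algebras.
Since the centre of `𝔤` is trivial, `Ad` is injective near `1` to first order, and it is bounded on
the compact group. Comparing powers through `Ad` yields that `γ(t)` is the limit of powers of
elements approaching `1` in the direction of `X` (`IsOneParameter.tendsto_pow`). Uniqueness of
one-parameter subgroups and the limiting directions of closed subgroups follow. An element commuting
with the Lie algebra of a torus is then fixed by `Ad` of the torus, and its one-parameter subgroup
can be adjoined to the torus without losing commutativity.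

Part (c) uses `SU(3)` with complex conjugation followed by reversal of rows and columns. The
reversal makes the diagonal matrices with entries `exp(is), 1, exp(-is)` fixed, so that both maximal
tori are diagonal. On the smaller one the root `e₀ - e₂` is twice `e₀ - e₁`. Working in the identity
component of `SU(3)` makes connectedness immediate. -/

set_option linter.unusedSectionVars false

namespace SymPair

open Filter Topology Set

/-! ### The group in a chart at the identity; velocities and the adjoint representation. -/

section Chart

variable {E : Type u} [NormedAddCommGroup E] [NormedSpace ℝ E]
  {G : Type v} [TopologicalSpace G] [ChartedSpace E G] [Group G]

/-- The chart of `G` at the identity, normalized to vanish there. -/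
noncomputable def lg (g : G) : E :=
  extChartAt 𝓘(ℝ, E) (1 : G) g - extChartAt 𝓘(ℝ, E) (1 : G) 1

/-- The inverse of the normalized chart at the identity. -/
noncomputable def ex (x : E) : G :=
  (extChartAt 𝓘(ℝ, E) (1 : G)).symm (x + extChartAt 𝓘(ℝ, E) (1 : G) 1)

@[simp] theorem lg_one : lg (E := E) (1 : G) = 0 := sub_self _

@[simp] theorem ex_zero : ex (G := G) (0 : E) = 1 := by
  rw [ex, zero_add]; exact extChartAt_to_inv (I := 𝓘(ℝ, E)) (1 : G)

theorem tendsto_add_base :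
    Tendsto (fun x : E => x + extChartAt 𝓘(ℝ, E) (1 : G) 1) (𝓝 0)
      (𝓝 (extChartAt 𝓘(ℝ, E) (1 : G) 1)) := by
  have h : ContinuousAt (fun x : E => x + extChartAt 𝓘(ℝ, E) (1 : G) 1) 0 := by fun_prop
  simpa [ContinuousAt] using h

theorem eventually_ex_lg : ∀ᶠ g in 𝓝 (1 : G), ex (lg (E := E) g) = g := by
  filter_upwards [extChartAt_source_mem_nhds (I := 𝓘(ℝ, E)) (1 : G)] with g hg
  rw [ex, lg, sub_add_cancel]
  exact (extChartAt 𝓘(ℝ, E) (1 : G)).left_inv hg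

theorem eventually_mem_target :
    ∀ᶠ x in 𝓝 (0 : E), x + extChartAt 𝓘(ℝ, E) (1 : G) 1 ∈ (extChartAt 𝓘(ℝ, E) (1 : G)).target :=
  tendsto_add_base.eventually (extChartAt_target_mem_nhds (I := 𝓘(ℝ, E)) (1 : G))

theorem eventually_lg_ex : ∀ᶠ x in 𝓝 (0 : E), lg (ex (G := G) x) = x := by
  filter_upwards [eventually_mem_target (G := G)] with x hx
  rw [lg, ex, (extChartAt 𝓘(ℝ, E) (1 : G)).right_inv hx, add_sub_cancel_right]

variable [LieGroup 𝓘(ℝ, E) ∞ G]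

theorem isManifold_infty : IsManifold 𝓘(ℝ, E) ∞ G :=
  ContMDiffMul.toIsManifold (I := 𝓘(ℝ, E)) (n := ∞) (G := G)

theorem isTopologicalGroup_of_lieGroup (E : Type u) [NormedAddCommGroup E] [NormedSpace ℝ E]
    (G : Type v) [TopologicalSpace G] [ChartedSpace E G] [Group G] [LieGroup 𝓘(ℝ, E) ∞ G] :
    IsTopologicalGroup G :=
  topologicalGroup_of_lieGroup 𝓘(ℝ, E) ∞

theorem eventually_contMDiffAt_lg :
    ∀ᶠ g in 𝓝 (1 : G), ContMDiffAt 𝓘(ℝ, E) 𝓘(ℝ, E) ∞ (lg (E := E) (G := G)) g := by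
  have := isManifold_infty (E := E) (G := G)
  filter_upwards [extChartAt_source_mem_nhds (I := 𝓘(ℝ, E)) (1 : G)] with g hg
  have h := contMDiffAt_extChartAt' (I := 𝓘(ℝ, E)) (n := ∞) (x := (1 : G)) (x' := g)
    (by simpa using hg)
  exact ((contDiff_id.sub contDiff_const : ContDiff ℝ ∞
    fun v : E => v - extChartAt 𝓘(ℝ, E) (1 : G) 1).contMDiff.contMDiffAt).comp g h

theorem contMDiffAt_lg : ContMDiffAt 𝓘(ℝ, E) 𝓘(ℝ, E) ∞ (lg (E := E) (G := G)) 1 :=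
  eventually_contMDiffAt_lg.self_of_nhds

theorem eventually_contMDiffAt_ex :
    ∀ᶠ x in 𝓝 (0 : E), ContMDiffAt 𝓘(ℝ, E) 𝓘(ℝ, E) ∞ (ex (E := E) (G := G)) x := by
  have := isManifold_infty (E := E) (G := G)
  filter_upwards [eventually_mem_target (G := G)] with x hx
  have h := (contMDiffOn_extChartAt_symm (I := 𝓘(ℝ, E)) (n := ∞) (1 : G)).contMDiffAt
    ((isOpen_extChartAt_target (I := 𝓘(ℝ, E)) (1 : G)).mem_nhds hx)
  exact h.comp x ((contDiff_id.add contDiff_const : ContDiff ℝ ∞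
    fun v : E => v + extChartAt 𝓘(ℝ, E) (1 : G) 1).contMDiff.contMDiffAt)

theorem contMDiffAt_ex : ContMDiffAt 𝓘(ℝ, E) 𝓘(ℝ, E) ∞ (ex (E := E) (G := G)) 0 :=
  eventually_contMDiffAt_ex.self_of_nhds

theorem continuousAt_lg : ContinuousAt (lg (E := E) (G := G)) 1 := contMDiffAt_lg.continuousAt

theorem continuousAt_ex : ContinuousAt (ex (E := E) (G := G)) 0 := contMDiffAt_ex.continuousAt

theorem tendsto_lg : Tendsto (lg (E := E) (G := G)) (𝓝 1) (𝓝 0) := by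
  simpa [ContinuousAt] using continuousAt_lg (E := E) (G := G)

theorem tendsto_ex : Tendsto (ex (E := E) (G := G)) (𝓝 0) (𝓝 1) := by
  simpa [ContinuousAt] using continuousAt_ex (E := E) (G := G)

/-- The group multiplication in the normalized chart. -/
noncomputable def mulC (G : Type v) [TopologicalSpace G] [ChartedSpace E G] [Group G]
    (p : E × E) : E := lg (ex (G := G) p.1 * ex p.2)

/-- Conjugation in the normalized chart. -/
noncomputable def conjC (G : Type v) [TopologicalSpace G] [ChartedSpace E G] [Group G]
    (p : E × E) : E := lg (ex (G := G) p.1 * ex p.2 * (ex p.1)⁻¹)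

theorem contMDiffAt_ex_fst :
    ContMDiffAt 𝓘(ℝ, E × E) 𝓘(ℝ, E) ∞ (fun p : E × E => ex (G := G) p.1) (0, 0) :=
  ContMDiffAt.comp (I' := 𝓘(ℝ, E)) (0, 0) (g := ex (G := G)) (f := fun p : E × E => p.1)
    contMDiffAt_ex contDiff_fst.contMDiff.contMDiffAt

theorem contMDiffAt_ex_snd :
    ContMDiffAt 𝓘(ℝ, E × E) 𝓘(ℝ, E) ∞ (fun p : E × E => ex (G := G) p.2) (0, 0) :=
  ContMDiffAt.comp (I' := 𝓘(ℝ, E)) (0, 0) (g := ex (G := G)) (f := fun p : E × E => p.2)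
    contMDiffAt_ex contDiff_snd.contMDiff.contMDiffAt

theorem contDiffAt_mulC : ContDiffAt ℝ ∞ (mulC (E := E) G) (0, 0) := by
  rw [← contMDiffAt_iff_contDiffAt]
  have h := (contMDiffAt_ex_fst (E := E) (G := G)).mul contMDiffAt_ex_snd
  refine ContMDiffAt.comp (I' := 𝓘(ℝ, E)) (0, 0) (g := lg (G := G)) ?_ h
  simpa using contMDiffAt_lg

theorem contDiffAt_conjC : ContDiffAt ℝ ∞ (conjC (E := E) G) (0, 0) := by
  rw [← contMDiffAt_iff_contDiffAt]
  have h := ((contMDiffAt_ex_fst (E := E) (G := G)).mul contMDiffAt_ex_snd).mul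
    contMDiffAt_ex_fst.inv
  refine ContMDiffAt.comp (I' := 𝓘(ℝ, E)) (0, 0) (g := lg (G := G)) ?_ h
  simpa using contMDiffAt_lg

theorem mulC_zero_right : ∀ᶠ x in 𝓝 (0 : E), mulC G (x, 0) = x := by
  filter_upwards [eventually_lg_ex (G := G)] with x hx
  simpa [mulC] using hx

theorem mulC_zero_left : ∀ᶠ x in 𝓝 (0 : E), mulC G (0, x) = x := by
  filter_upwards [eventually_lg_ex (G := G)] with x hx
  simpa [mulC] using hx

theorem conjC_zero_right (x : E) : conjC G (x, 0) = 0 := by simp [conjC]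

/-- This is `(x y x⁻¹) x = x y`. It determines the derivatives of conjugation from those of
multiplication without differentiating the inverse. -/
theorem mulC_conjC : ∀ᶠ p in 𝓝 ((0, 0) : E × E), mulC G (conjC G p, p.1) = mulC G p := by
  have := isTopologicalGroup_of_lieGroup E G
  have h : Tendsto (fun p : E × E => ex (G := G) p.1 * ex p.2 * (ex p.1)⁻¹) (𝓝 (0, 0)) (𝓝 1) := by
    have h1 := (contMDiffAt_ex_fst (E := E) (G := G)).continuousAt
    have h2 := (contMDiffAt_ex_snd (E := E) (G := G)).continuousAt
    have h3 := ((h1.mul h2).mul h1.inv).tendsto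
    simp only [Pi.mul_apply, Pi.inv_apply, ex_zero, inv_one, mul_one] at h3
    exact h3
  filter_upwards [h.eventually (eventually_ex_lg (E := E))] with p hp
  simp only [mulC, conjC, hp]
  simp

/-- `X` is the velocity at time `0` of the curve `γ`, which starts at the identity, in the normalized
chart. -/
def HasVelocity (γ : ℝ → G) (X : E) : Prop :=
  γ 0 = 1 ∧ ContinuousAt γ 0 ∧ HasDerivAt (fun t => lg (E := E) (γ t)) X 0

/-- Replaces the manifold derivative by an ordinary one in a fixed vector space, so that uniqueness
of derivatives can serve as the main tool for identities in the Lie algebra. -/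
theorem isVelocity_iff {γ : ℝ → G} {X : E} :
    IsVelocity (E := E) γ X ↔ HasVelocity γ X := by
  unfold IsVelocity HasVelocity
  refine and_congr_right fun h0 => ?_
  unfold HasMFDerivAt
  refine and_congr_right fun _ => ?_
  have h1 : writtenInExtChartAt 𝓘(ℝ, ℝ) 𝓘(ℝ, E) 0 γ =
      fun t => extChartAt 𝓘(ℝ, E) (1 : G) (γ t) := by
    ext t
    have : (chartAt ℝ (0 : ℝ)).symm t = t := rfl
    simp [writtenInExtChartAt, h0, this]
  have h2 : HasFDerivWithinAt (fun t => extChartAt 𝓘(ℝ, E) (1 : G) (γ t))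
      (ContinuousLinearMap.toSpanSingleton ℝ X) univ (0 : ℝ) ↔
      HasDerivAt (fun t => lg (E := E) (γ t)) X 0 := by
    rw [hasFDerivWithinAt_univ, hasDerivAt_iff_hasFDerivAt]
    exact (hasFDerivAt_sub_const_iff _).symm
  rw [← h2, ← h1]
  have h3 : range (𝓘(ℝ, ℝ)) = (univ : Set ℝ) := range_id
  exact iff_of_eq (congrArg (fun s => HasFDerivWithinAt (𝕜 := ℝ) (E := ℝ) (F := E)
    (writtenInExtChartAt 𝓘(ℝ, ℝ) 𝓘(ℝ, E) 0 γ)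
    (ContinuousLinearMap.toSpanSingleton ℝ X) s (0 : ℝ)) h3)

theorem HasVelocity.unique {γ : ℝ → G} {X Y : E}
    (h : HasVelocity γ X) (h' : HasVelocity γ Y) : X = Y :=
  h.2.2.unique h'.2.2

theorem HasVelocity.tendsto {γ : ℝ → G} {X : E} (h : HasVelocity γ X) : Tendsto γ (𝓝 0) (𝓝 1) := by
  simpa [ContinuousAt, h.1] using h.2.1

theorem hasVelocity_ex (X : E) : HasVelocity (fun t : ℝ => ex (G := G) (t • X)) X := by
  have hc : Tendsto (fun t : ℝ => t • X) (𝓝 0) (𝓝 0) := by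
    have : Continuous fun t : ℝ => t • X := by fun_prop
    simpa using this.tendsto 0
  refine ⟨by simp, ?_, ?_⟩
  · simpa [ContinuousAt, Function.comp_def] using tendsto_ex.comp hc
  · have h1 : HasDerivAt (fun t : ℝ => t • X) X 0 := by
      simpa using (hasDerivAt_id (0 : ℝ)).smul_const X
    exact h1.congr_of_eventuallyEq (hc.eventually eventually_lg_ex)

theorem contDiffAt_map {f : G → G} (hf : ContMDiff 𝓘(ℝ, E) 𝓘(ℝ, E) ∞ f) (hf1 : f 1 = 1) :
    ContDiffAt ℝ ∞ (fun x : E => lg (E := E) (f (ex x))) 0 := by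
  rw [← contMDiffAt_iff_contDiffAt]
  refine ContMDiffAt.comp (I' := 𝓘(ℝ, E)) (0 : E) (g := lg (G := G)) ?_
    (hf.contMDiffAt.comp (0 : E) contMDiffAt_ex)
  simpa [hf1] using contMDiffAt_lg

theorem HasVelocity.map {f : G → G} (hf : ContMDiff 𝓘(ℝ, E) 𝓘(ℝ, E) ∞ f) (hf1 : f 1 = 1)
    {γ : ℝ → G} {X : E} (h : HasVelocity γ X) :
    HasVelocity (fun t => f (γ t)) (fderiv ℝ (fun x : E => lg (E := E) (f (ex x))) 0 X) := by
  refine ⟨by simp [h.1, hf1], hf.continuous.continuousAt.comp h.2.1, ?_⟩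
  have h1 : HasFDerivAt (fun x : E => lg (E := E) (f (ex x)))
      (fderiv ℝ (fun x : E => lg (E := E) (f (ex x))) 0) (lg (γ 0)) := by
    rw [h.1, lg_one]
    exact ((contDiffAt_map hf hf1).differentiableAt (by simp)).hasFDerivAt
  refine (h1.comp_hasDerivAt (0 : ℝ) h.2.2).congr_of_eventuallyEq ?_
  filter_upwards [h.tendsto.eventually (eventually_ex_lg (E := E))] with t ht
  simp [ht]

/-- The adjoint representation. -/
noncomputable def Ad (E : Type u) [NormedAddCommGroup E] [NormedSpace ℝ E]
    {G : Type v} [TopologicalSpace G] [ChartedSpace E G] [Group G] (g : G) : E →L[ℝ] E :=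
  fderiv ℝ (fun x : E => lg (E := E) (g * ex x * g⁻¹)) 0

theorem contMDiff_conj (g : G) : ContMDiff 𝓘(ℝ, E) 𝓘(ℝ, E) ∞ (fun x : G => g * x * g⁻¹) :=
  (contMDiff_const.mul contMDiff_id).mul contMDiff_const

theorem HasVelocity.conj (g : G) {γ : ℝ → G} {X : E} (h : HasVelocity γ X) :
    HasVelocity (fun t => g * γ t * g⁻¹) (Ad E g X) :=
  h.map (contMDiff_conj g) (by simp)

theorem Ad_one : Ad E (1 : G) = ContinuousLinearMap.id ℝ E := by
  ext X
  have h := (hasVelocity_ex (G := G) X).conj 1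
  simp only [one_mul, inv_one, mul_one] at h
  exact h.unique (hasVelocity_ex X)

/-- Both sides, applied to `X`, are velocities of the same conjugated curve. -/
theorem Ad_mul (g h : G) : Ad E (g * h) = (Ad E g).comp (Ad E h) := by
  ext X
  have h1 := (hasVelocity_ex (G := G) X).conj (g * h)
  have h2 := ((hasVelocity_ex (G := G) X).conj h).conj g
  simp only [mul_inv_rev, ← mul_assoc] at h1 h2
  exact h1.unique h2

end Chart

/-! ### Second-order calculus of a local group law. -/

section LocalGroupCalculus

variable {E : Type u} [NormedAddCommGroup E] [NormedSpace ℝ E] {M C : E × E → E}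

theorem eventually_differentiableAt {F : Type*} [NormedAddCommGroup F]
    [NormedSpace ℝ F] {f : F → E} {x : F} (h : ContDiffAt ℝ ∞ f x) :
    ∀ᶠ y in 𝓝 x, DifferentiableAt ℝ f y := by
  have h1 : ContDiffAt ℝ 1 f x := h.of_le (by simp)
  filter_upwards [h1.eventually (by simp)] with y hy using hy.differentiableAt (by simp)

theorem contDiffAt_fderiv_right (hM : ContDiffAt ℝ ∞ M (0, 0)) :
    ContDiffAt ℝ ∞ (fun x => fderiv ℝ (fun y => M (x, y)) 0) 0 :=
  ContDiffAt.fderiv (f := fun x y => M (x, y)) (g := fun _ => (0 : E)) (n := ∞) hM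
    contDiffAt_const (by simp)

theorem fderiv_right_eq {p : E × E} (h : DifferentiableAt ℝ M p) (Y : E) :
    fderiv ℝ (fun y => M (p.1, y)) p.2 Y = fderiv ℝ M p (0, Y) := by
  have h1 : HasFDerivAt (fun y : E => (p.1, y)) (ContinuousLinearMap.inr ℝ E E) p.2 :=
    hasFDerivAt_prodMk_right p.1 p.2
  have h2 : HasFDerivAt (fun y => M (p.1, y)) _ p.2 := HasFDerivAt.comp p.2 h.hasFDerivAt h1
  rw [h2.fderiv]
  simp

theorem fderiv_left_eq {p : E × E} (h : DifferentiableAt ℝ M p) (Y : E) :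
    fderiv ℝ (fun x => M (x, p.2)) p.1 Y = fderiv ℝ M p (Y, 0) := by
  have h1 : HasFDerivAt (fun x : E => (x, p.2)) (ContinuousLinearMap.inl ℝ E E) p.1 :=
    hasFDerivAt_prodMk_left p.1 p.2
  have h2 : HasFDerivAt (fun x => M (x, p.2)) _ p.1 := HasFDerivAt.comp p.1 h.hasFDerivAt h1
  rw [h2.fderiv]
  simp

theorem tendsto_prodMk_zero : Tendsto (fun x : E => (x, (0 : E))) (𝓝 0) (𝓝 (0, 0)) := by
  have : Continuous fun x : E => (x, (0 : E)) := by fun_prop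
  exact this.tendsto 0

theorem tendsto_zero_prodMk : Tendsto (fun x : E => ((0 : E), x)) (𝓝 0) (𝓝 (0, 0)) := by
  have : Continuous fun x : E => ((0 : E), x) := by fun_prop
  exact this.tendsto 0

theorem fderiv_fderiv_right (hM : ContDiffAt ℝ ∞ M (0, 0)) (X Y : E) :
    fderiv ℝ (fun x => fderiv ℝ (fun y => M (x, y)) 0) 0 X Y =
      fderiv ℝ (fderiv ℝ M) (0, 0) (X, 0) (0, Y) := by
  have hd : DifferentiableAt ℝ (fderiv ℝ M) (0, 0) :=
    (hM.fderiv_right (m := ∞) (by simp)).differentiableAt (by simp)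
  have h0 := ((contDiffAt_fderiv_right hM).differentiableAt (by simp)).hasFDerivAt.clm_apply
    (hasFDerivAt_const Y (0 : E))
  have h1 : HasFDerivAt (fun x : E => fderiv ℝ M (x, 0)) _ (0 : E) :=
    HasFDerivAt.comp (0 : E) hd.hasFDerivAt (hasFDerivAt_prodMk_left (0 : E) (0 : E))
  have h2 := h1.clm_apply (hasFDerivAt_const ((0 : E), Y) (0 : E))
  have h3 : (fun x => fderiv ℝ (fun y => M (x, y)) 0 Y) =ᶠ[𝓝 0]
      fun x => fderiv ℝ M (x, 0) (0, Y) := by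
    filter_upwards [tendsto_prodMk_zero.eventually (eventually_differentiableAt hM)] with x hx
    exact fderiv_right_eq hx Y
  have h4 := DFunLike.congr_fun (h0.unique (h2.congr_of_eventuallyEq h3)) X
  simpa using h4

/-- Interchanging the two variables. -/
theorem contDiffAt_swap (hM : ContDiffAt ℝ ∞ M (0, 0)) :
    ContDiffAt ℝ ∞ (fun p : E × E => M (p.2, p.1)) (0, 0) :=
  ContDiffAt.comp (0, 0) (g := M) (f := fun p : E × E => (p.2, p.1)) hM
    (by fun_prop)

/-- Symmetry of the second derivative of `M`: both sides are the same mixed partial derivative at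
the origin, taken in opposite orders. -/
theorem fderiv_fderiv_swap (hM : ContDiffAt ℝ ∞ M (0, 0)) (X Y : E) :
    fderiv ℝ (fun y => fderiv ℝ (fun x => M (x, y)) 0) 0 X Y =
      fderiv ℝ (fun x => fderiv ℝ (fun y => M (x, y)) 0) 0 Y X := by
  have hd : DifferentiableAt ℝ (fderiv ℝ M) (0, 0) :=
    (hM.fderiv_right (m := ∞) (by simp)).differentiableAt (by simp)
  have hs := contDiffAt_fderiv_right (contDiffAt_swap hM)
  have h0 := (hs.differentiableAt (by simp)).hasFDerivAt.clm_apply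
    (hasFDerivAt_const Y (0 : E))
  have h1 : HasFDerivAt (fun x : E => fderiv ℝ M (0, x)) _ (0 : E) :=
    HasFDerivAt.comp (0 : E) hd.hasFDerivAt (hasFDerivAt_prodMk_right (0 : E) (0 : E))
  have h2 := h1.clm_apply (hasFDerivAt_const (Y, (0 : E)) (0 : E))
  have h3 : (fun y => fderiv ℝ (fun x => M (x, y)) 0 Y) =ᶠ[𝓝 0]
      fun y => fderiv ℝ M (0, y) (Y, 0) := by
    filter_upwards [tendsto_zero_prodMk.eventually (eventually_differentiableAt hM)] with x hx
    exact fderiv_left_eq hx Y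
  have h4 := DFunLike.congr_fun (h0.unique (h2.congr_of_eventuallyEq h3)) X
  have h5 : IsSymmSndFDerivAt ℝ M (0, 0) := hM.isSymmSndFDerivAt
    (by rw [minSmoothness_of_isRCLikeNormedField]; exact ENat.LEInfty.out)
  rw [fderiv_fderiv_right hM, ← h5.eq (0, X) (Y, 0)]
  simpa using h4

theorem fderiv_right_zero (h : ∀ᶠ x in 𝓝 (0 : E), M (0, x) = x) :
    fderiv ℝ (fun y => M (0, y)) 0 = ContinuousLinearMap.id ℝ E :=
  ((hasFDerivAt_id (0 : E)).congr_of_eventuallyEq h).fderiv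

theorem fderiv_left_zero (h : ∀ᶠ x in 𝓝 (0 : E), M (x, 0) = x) :
    fderiv ℝ (fun x => M (x, 0)) 0 = ContinuousLinearMap.id ℝ E :=
  ((hasFDerivAt_id (0 : E)).congr_of_eventuallyEq h).fderiv

/-- The derivative of conjugation in a local group is the commutator of the second-order part of
the multiplication. -/
theorem fderiv_fderiv_conj (hM : ContDiffAt ℝ ∞ M (0, 0)) (hC : ContDiffAt ℝ ∞ C (0, 0))
    (hM0 : ∀ᶠ x in 𝓝 (0 : E), M (x, 0) = x) (h0M : ∀ᶠ x in 𝓝 (0 : E), M (0, x) = x)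
    (hC0 : ∀ x, C (x, 0) = 0) (h : ∀ᶠ p in 𝓝 ((0, 0) : E × E), M (C p, p.1) = M p) (X Y : E) :
    fderiv ℝ (fun x => fderiv ℝ (fun y => C (x, y)) 0) 0 X Y =
      fderiv ℝ (fun x => fderiv ℝ (fun y => M (x, y)) 0) 0 X Y -
      fderiv ℝ (fun x => fderiv ℝ (fun y => M (x, y)) 0) 0 Y X := by
  set L : E → E →L[ℝ] E := fun x => fderiv ℝ (fun y => M (x, y)) 0 with hL
  set R : E → E →L[ℝ] E := fun y => fderiv ℝ (fun x => M (x, y)) 0 with hR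
  set A : E → E →L[ℝ] E := fun x => fderiv ℝ (fun y => C (x, y)) 0 with hA
  have dL : HasFDerivAt L (fderiv ℝ L 0) 0 := ((contDiffAt_fderiv_right hM).differentiableAt (by simp)).hasFDerivAt
  have dA : HasFDerivAt A (fderiv ℝ A 0) 0 := ((contDiffAt_fderiv_right hC).differentiableAt (by simp)).hasFDerivAt
  have dR : HasFDerivAt R (fderiv ℝ R 0) 0 := ((contDiffAt_fderiv_right (contDiffAt_swap hM)).differentiableAt
    (by simp)).hasFDerivAt
  -- The relation `M (C (x, y), x) = M (x, y)` is differentiated in `y` at `0`.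
  have hev : ∀ᶠ x in 𝓝 (0 : E), ∀ Z, R x (A x Z) = L x Z := by
    rw [nhds_prod_eq] at h
    filter_upwards [h.curry, tendsto_prodMk_zero.eventually (eventually_differentiableAt hC),
      tendsto_zero_prodMk.eventually (eventually_differentiableAt hM)] with x hx hx1 hx2 Z
    have a1 : DifferentiableAt ℝ (fun y => C (x, y)) 0 :=
      DifferentiableAt.comp (0 : E) (g := C) hx1 (by fun_prop)
    have a2 : DifferentiableAt ℝ (fun z => M (z, x)) (C (x, 0)) := by
      rw [hC0]
      exact DifferentiableAt.comp (0 : E) (g := M) hx2 (by fun_prop)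
    have a3 := a2.hasFDerivAt.comp (0 : E) a1.hasFDerivAt
    have a4 : (fun y => M (x, y)) =ᶠ[𝓝 0] (fun z => M (z, x)) ∘ fun y => C (x, y) := by
      filter_upwards [hx] with y hy using hy.symm
    have a5 := (a3.congr_of_eventuallyEq a4).fderiv
    rw [hC0] at a5
    rw [hL]
    simp only [a5]
    rfl
  -- Next `R x (A x Y) = L x Y` is differentiated at `x = 0`, where all three maps are the identity.
  -- This gives `R'(X) Y + A'(X) Y = L'(X) Y`, and `R'(X) Y = L'(Y) X` by symmetry.
  have h1 := dR.clm_apply (dA.clm_apply (hasFDerivAt_const Y (0 : E)))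
  have h2 := (dL.clm_apply (hasFDerivAt_const Y (0 : E)))
  have h3 := DFunLike.congr_fun ((h2.congr_of_eventuallyEq (hev.mono fun x hx => hx Y)).unique h1) X
  have hR0 : R 0 = ContinuousLinearMap.id ℝ E := fderiv_left_zero hM0
  have hL0 : L 0 = ContinuousLinearMap.id ℝ E := fderiv_right_zero h0M
  have hA0 : A 0 Y = Y := by
    have := hev.self_of_nhds Y
    rwa [hR0, hL0] at this
  have h4 := fderiv_fderiv_swap hM X Y
  simp only [ContinuousLinearMap.comp_zero, zero_add, ContinuousLinearMap.comp_apply, hR0,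
    _root_.add_apply, ContinuousLinearMap.flip_apply, hA0,
    ContinuousLinearMap.id_apply] at h3
  rw [h3, ← h4]
  simp [hR]

end LocalGroupCalculus

/-! ### The Lie bracket as the derivative of the adjoint representation. -/

section Bracket

variable {E : Type u} [NormedAddCommGroup E] [NormedSpace ℝ E]
  {G : Type v} [TopologicalSpace G] [ChartedSpace E G] [Group G] [LieGroup 𝓘(ℝ, E) ∞ G]

/-- The pull-back of a left-invariant vector field to the chart at the identity. -/
theorem mpullbackWithin_mulInvariantVectorField (X : E) {x : E}
    (hx : x ∈ (extChartAt 𝓘(ℝ, E) (1 : G)).target) :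
    (VectorField.mpullbackWithin 𝓘(ℝ, E) 𝓘(ℝ, E) (extChartAt 𝓘(ℝ, E) (1 : G)).symm
      (mulInvariantVectorField (I := 𝓘(ℝ, E)) (G := G) X) (range 𝓘(ℝ, E)) x : E) =
    fderiv ℝ (fun y => mulC G (x - extChartAt 𝓘(ℝ, E) (1 : G) 1, y)) 0 X := by
  have := isManifold_infty (E := E) (G := G)
  have hI : (mfderivWithin 𝓘(ℝ, E) 𝓘(ℝ, E) (extChartAt 𝓘(ℝ, E) (1 : G)).symm
      (range 𝓘(ℝ, E)) x).inverse = mfderiv 𝓘(ℝ, E) 𝓘(ℝ, E) (extChartAt 𝓘(ℝ, E) (1 : G))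
        ((extChartAt 𝓘(ℝ, E) (1 : G)).symm x) :=
    ContinuousLinearMap.inverse_eq
      (mfderivWithin_extChartAt_symm_comp_mfderiv_extChartAt hx)
      (mfderiv_extChartAt_comp_mfderivWithin_extChartAt_symm hx)
  rw [VectorField.mpullbackWithin_apply, hI]
  have hr : range (𝓘(ℝ, E)) = (univ : Set E) := range_id
  set φ := extChartAt 𝓘(ℝ, E) (1 : G) with hφ
  set g : G := φ.symm x with hg
  have hgs : g ∈ φ.source := φ.map_target hx
  have hd : MDifferentiableAt 𝓘(ℝ, E) 𝓘(ℝ, E) φ (g * 1) := by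
    rw [mul_one]
    exact mdifferentiableAt_extChartAt (by simpa [hφ] using hgs)
  have hL : MDifferentiableAt 𝓘(ℝ, E) 𝓘(ℝ, E) (fun z : G => g * z) 1 :=
    (contMDiff_mul_left (I := 𝓘(ℝ, E)) (n := ∞)).mdifferentiableAt (by simp)
  have hcomp : MDifferentiableAt 𝓘(ℝ, E) 𝓘(ℝ, E) (φ ∘ fun z : G => g * z) 1 :=
    hd.comp (1 : G) hL
  have h1 : mfderiv 𝓘(ℝ, E) 𝓘(ℝ, E) (φ ∘ fun z : G => g * z) 1 = _ :=
    mfderiv_comp (1 : G) hd hL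
  -- The points `g * 1` and `g` index different tangent spaces, so the base point is exchanged by
  -- substitution after both derivatives are read as maps of `E`.
  have h2 : ∀ g' : G, g' = g → (mfderiv 𝓘(ℝ, E) 𝓘(ℝ, E) φ g' : E →L[ℝ] E) =
      (mfderiv 𝓘(ℝ, E) 𝓘(ℝ, E) φ g : E →L[ℝ] E) := by
    rintro _ rfl
    rfl
  have h3 : (mfderiv 𝓘(ℝ, E) 𝓘(ℝ, E) (φ ∘ fun z : G => g * z) 1 : E →L[ℝ] E) =
      (mfderiv 𝓘(ℝ, E) 𝓘(ℝ, E) φ g : E →L[ℝ] E).comp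
        (mfderiv 𝓘(ℝ, E) 𝓘(ℝ, E) (fun z : G => g * z) 1 : E →L[ℝ] E) := by
    rw [← h2 (g * 1) (mul_one g)]
    exact h1
  have h4 : (mfderiv 𝓘(ℝ, E) 𝓘(ℝ, E) (φ ∘ fun z : G => g * z) 1 : E →L[ℝ] E) =
      fderiv ℝ (fun y => φ (g * φ.symm y)) (φ 1) := by
    rw [hcomp.mfderiv]
    have h : fderivWithin ℝ (fun y : E => φ (g * φ.symm y)) univ (φ 1) =
        fderiv ℝ (fun y => φ (g * φ.symm y)) (φ 1) := by rw [fderivWithin_univ]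
    refine Eq.trans ?_ h
    exact congrArg (fun s => fderivWithin ℝ (fun y : E => φ (g * φ.symm y)) s (φ 1)) hr
  have h5 : fderiv ℝ (fun y => mulC G (x - φ 1, y)) 0 =
      fderiv ℝ (fun y => φ (g * φ.symm y)) (φ 1) := by
    have : (fun y => mulC G (x - φ 1, y)) =
        fun y => (fun y => φ (g * φ.symm y)) (y + φ 1) - φ 1 := by
      ext y
      simp only [mulC, lg, ex, ← hφ, sub_add_cancel, ← hg]
    rw [this, fderiv_sub_const, fderiv_comp_add_right (f := fun y => φ (g * φ.symm y)), zero_add]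
  exact DFunLike.congr_fun (h3.symm.trans (h4.trans h5.symm)) X

/-- The Lie bracket of the Lie algebra of `G` on the model space. -/
noncomputable def bracketE (E : Type u) [NormedAddCommGroup E] [NormedSpace ℝ E]
    (G : Type v) [TopologicalSpace G] [ChartedSpace E G] [Group G] (X Y : E) : E :=
  Bracket.bracket (L := GroupLieAlgebra 𝓘(ℝ, E) G) (M := GroupLieAlgebra 𝓘(ℝ, E) G) X Y

/-- In the chart the left-invariant field of `X` is `x ↦ L x X`, with `L x` the derivative of the
multiplication in its second argument and `L 0 = id`. The commutator of two such fields at the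
origin is `L'(X) Y - L'(Y) X`. -/
theorem bracketE_eq (X Y : E) :
    bracketE E G X Y = fderiv ℝ (fun x => fderiv ℝ (fun y => mulC G (x, y)) 0) 0 X Y -
      fderiv ℝ (fun x => fderiv ℝ (fun y => mulC G (x, y)) 0) 0 Y X := by
  have := isManifold_infty (E := E) (G := G)
  have hr : range (𝓘(ℝ, E)) = (univ : Set E) := range_id
  set φ := extChartAt 𝓘(ℝ, E) (1 : G) with hφ
  set L : E → E →L[ℝ] E := fun x => fderiv ℝ (fun y => mulC G (x, y)) 0 with hL
  have dL : HasFDerivAt L (fderiv ℝ L 0) 0 :=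
    ((contDiffAt_fderiv_right contDiffAt_mulC).differentiableAt (by simp)).hasFDerivAt
  have hL0 : L 0 = ContinuousLinearMap.id ℝ E := fderiv_right_zero mulC_zero_left
  have hI : (mfderiv 𝓘(ℝ, E) 𝓘(ℝ, E) φ 1 : E →L[ℝ] E) = ContinuousLinearMap.id ℝ E := by
    have hd : MDifferentiableAt 𝓘(ℝ, E) 𝓘(ℝ, E) φ 1 :=
      mdifferentiableAt_extChartAt (by simp)
    rw [hd.mfderiv]
    have h1 : fderiv ℝ (fun x => φ (φ.symm x)) (φ 1) = ContinuousLinearMap.id ℝ E := by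
      refine ((hasFDerivAt_id (φ 1)).congr_of_eventuallyEq ?_).fderiv
      filter_upwards [extChartAt_target_mem_nhds (I := 𝓘(ℝ, E)) (1 : G)] with y hy
      exact φ.right_inv hy
    have h : fderivWithin ℝ (fun y : E => φ (φ.symm y)) univ (φ 1) =
        fderiv ℝ (fun y => φ (φ.symm y)) (φ 1) := by rw [fderivWithin_univ]
    refine Eq.trans ?_ (h.trans h1)
    exact congrArg (fun s => fderivWithin ℝ (fun y : E => φ (φ.symm y)) s (φ 1)) hr
  let V : E → E → E := fun X x => VectorField.mpullbackWithin 𝓘(ℝ, E) 𝓘(ℝ, E) φ.symm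
    (mulInvariantVectorField (I := 𝓘(ℝ, E)) (G := G) X) (range 𝓘(ℝ, E)) x
  have hV : ∀ X : E, ∀ᶠ x in 𝓝 (φ 1), V X x =
      L (x - φ 1) X := by
    intro X
    filter_upwards [extChartAt_target_mem_nhds (I := 𝓘(ℝ, E)) (1 : G)] with x hx
    exact mpullbackWithin_mulInvariantVectorField X hx
  have hD : ∀ X : E, HasFDerivAt (V X)
      ((fderiv ℝ L 0).flip X) (φ 1) := by
    intro X
    have h1 : HasFDerivAt (fun x : E => x - φ 1) (ContinuousLinearMap.id ℝ E) (φ 1) :=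
      (hasFDerivAt_id (φ 1)).sub_const (φ 1)
    have h2 : HasFDerivAt L (fderiv ℝ L 0) (φ 1 - φ 1) := by rwa [sub_self]
    have h4 : HasFDerivAt (fun x : E => L (x - φ 1)) _ (φ 1) :=
      HasFDerivAt.comp (φ 1) (g := L) (f := fun x : E => x - φ 1) h2 h1
    have h3 := h4.clm_apply (hasFDerivAt_const X (φ 1))
    refine (h3.congr_of_eventuallyEq (hV X)).congr_fderiv ?_
    ext Y
    simp
  have hval : ∀ X : E, V X (φ 1) = X := by
    intro X
    rw [(hV X).self_of_nhds, sub_self, hL0]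
    rfl
  have hset : (φ.symm ⁻¹' univ ∩ range 𝓘(ℝ, E) : Set E) = univ := by simp
  -- The definition of the bracket transports the result back by the inverse derivative of the
  -- chart. Naming that derivative `A` allows it to be replaced by the identity.
  have key : ∀ A : E →L[ℝ] E, A = mfderiv 𝓘(ℝ, E) 𝓘(ℝ, E) φ 1 → bracketE E G X Y = A.inverse
      (VectorField.lieBracketWithin ℝ (V X) (V Y) (φ.symm ⁻¹' univ ∩ range 𝓘(ℝ, E)) (φ 1)) := by
    rintro _ rfl
    rfl
  refine (key _ hI.symm).trans ?_
  rw [ContinuousLinearMap.inverse_id]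
  refine Eq.trans (congrArg (fun s => VectorField.lieBracketWithin ℝ (V X) (V Y) s (φ 1)) hset) ?_
  have h6 : ∀ V W : E → E, HasFDerivAt V ((fderiv ℝ L 0).flip X) (φ 1) →
      HasFDerivAt W ((fderiv ℝ L 0).flip Y) (φ 1) → V (φ 1) = X → W (φ 1) = Y →
      VectorField.lieBracketWithin ℝ V W univ (φ 1) = fderiv ℝ L 0 X Y - fderiv ℝ L 0 Y X := by
    intro V W hV hW hX hY
    rw [VectorField.lieBracketWithin, fderivWithin_univ, fderivWithin_univ, hV.fderiv,
      hW.fderiv, hX, hY]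
    rfl
  exact h6 _ _ (hD X) (hD Y) (hval X) (hval Y)

/-- The derivative of the adjoint representation in the chart is the Lie bracket. -/
theorem fderiv_Ad (X Y : E) :
    fderiv ℝ (fun x : E => Ad E (ex (G := G) x)) 0 X Y = bracketE E G X Y := by
  rw [bracketE_eq]
  exact fderiv_fderiv_conj contDiffAt_mulC contDiffAt_conjC mulC_zero_right mulC_zero_left
    conjC_zero_right mulC_conjC X Y

theorem hasFDerivAt_Ad : HasFDerivAt (fun x : E => Ad E (ex (G := G) x))
    (fderiv ℝ (fun x : E => Ad E (ex (G := G) x)) 0) 0 :=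
  ((contDiffAt_fderiv_right contDiffAt_conjC).differentiableAt (by simp)).hasFDerivAt

theorem HasVelocity.hasDerivAt_Ad {γ : ℝ → G} {X : E} (h : HasVelocity γ X) :
    HasDerivAt (fun t => Ad E (γ t)) (fderiv ℝ (fun x : E => Ad E (ex (G := G) x)) 0 X) 0 := by
  have h1 : HasFDerivAt (fun x : E => Ad E (ex (G := G) x))
      (fderiv ℝ (fun x : E => Ad E (ex (G := G) x)) 0) (lg (γ 0)) := by
    rw [h.1, lg_one]
    exact hasFDerivAt_Ad
  refine (h1.comp_hasDerivAt (0 : ℝ) h.2.2).congr_of_eventuallyEq ?_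
  filter_upwards [h.tendsto.eventually (eventually_ex_lg (E := E))] with t ht
  simp [ht]

theorem HasVelocity.hasDerivAt_Ad_apply {γ : ℝ → G} {X : E} (h : HasVelocity γ X) (Y : E) :
    HasDerivAt (fun t => Ad E (γ t) Y) (bracketE E G X Y) 0 := by
  have h1 := h.hasDerivAt_Ad.clm_apply (hasDerivAt_const (0 : ℝ) Y)
  simpa [fderiv_Ad] using h1

theorem continuousAt_Ad_one : ContinuousAt (Ad E : G → E →L[ℝ] E) 1 := by
  have h := (hasFDerivAt_Ad (E := E) (G := G)).continuousAt
  have h1 : ContinuousAt (fun g : G => Ad E (ex (lg (E := E) g))) 1 :=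
    ContinuousAt.comp (g := fun x : E => Ad E (ex (G := G) x)) (by simpa using h) continuousAt_lg
  exact h1.congr ((eventually_ex_lg (E := E)).mono fun g hg => by simp only [hg])

/-- Continuity at the identity spreads by `Ad x = Ad g ∘ Ad (g⁻¹ x)`. -/
theorem continuous_Ad : Continuous (Ad E : G → E →L[ℝ] E) := by
  have := isTopologicalGroup_of_lieGroup E G
  refine continuous_iff_continuousAt.2 fun g => ?_
  have h1 : ContinuousAt (fun x : G => (Ad E g).comp (Ad E (g⁻¹ * x))) g := by
    refine continuousAt_const.clm_comp ?_
    refine ContinuousAt.comp (g := Ad E) (f := fun x => g⁻¹ * x) ?_ (by fun_prop)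
    simpa using continuousAt_Ad_one
  refine h1.congr (Eventually.of_forall fun x => ?_)
  simp only
  rw [← Ad_mul, mul_inv_cancel_left]

end Bracket

/-! ### One-parameter subgroups and estimates through the adjoint representation. -/

section OneParameter

variable {E : Type u} [NormedAddCommGroup E] [NormedSpace ℝ E]
  {G : Type v} [TopologicalSpace G] [ChartedSpace E G] [Group G] [LieGroup 𝓘(ℝ, E) ∞ G]

/-- `γ` is the one-parameter subgroup of `G` with velocity `X`. -/
structure IsOneParameter (γ : ℝ → G) (X : E) : Prop where
  map_add : ∀ s t, γ (s + t) = γ s * γ t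
  hasVelocity : HasVelocity γ X

theorem IsOneParameter.map_zero {γ : ℝ → G} {X : E} (h : IsOneParameter γ X) : γ 0 = 1 :=
  h.hasVelocity.1

theorem IsOneParameter.map_neg {γ : ℝ → G} {X : E} (h : IsOneParameter γ X) (t : ℝ) :
    γ (-t) = (γ t)⁻¹ := by
  rw [eq_inv_iff_mul_eq_one, ← h.map_add, neg_add_cancel, h.map_zero]

theorem IsOneParameter.map_nsmul {γ : ℝ → G} {X : E} (h : IsOneParameter γ X) (n : ℕ) (t : ℝ) :
    γ (n * t) = γ t ^ n := by
  induction n with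
  | zero => simp [h.map_zero]
  | succ n ih => rw [pow_succ, ← ih, ← h.map_add]; congr 1; push_cast; ring

theorem IsOneParameter.continuous {γ : ℝ → G} {X : E} (h : IsOneParameter γ X) :
    Continuous γ := by
  have := isTopologicalGroup_of_lieGroup E G
  refine continuous_iff_continuousAt.2 fun s => ?_
  have h1 : ContinuousAt (fun t => γ s * γ (t - s)) s := by
    refine continuousAt_const.mul ?_
    refine ContinuousAt.comp (g := γ) (f := fun t => t - s) ?_ (by fun_prop)
    simpa using h.hasVelocity.2.1
  refine h1.congr (Eventually.of_forall fun t => ?_)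
  simp only
  rw [← h.map_add, add_sub_cancel]

theorem IsOneParameter.hasDerivAt_Ad {γ : ℝ → G} {X : E} (h : IsOneParameter γ X) (Y : E) (t : ℝ) :
    HasDerivAt (fun t => Ad E (γ t) Y) (Ad E (γ t) (bracketE E G X Y)) t := by
  have h1 : HasDerivAt (fun s => Ad E (γ s) Y) (bracketE E G X Y) (t - t) := by
    rw [sub_self]; exact h.hasVelocity.hasDerivAt_Ad_apply Y
  have h2 : HasDerivAt (fun s => Ad E (γ (s - t)) Y) (bracketE E G X Y) t :=
    HasDerivAt.comp_sub_const t t h1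
  refine ((Ad E (γ t)).hasFDerivAt.comp_hasDerivAt t h2).congr_of_eventuallyEq
    (Eventually.of_forall fun s => ?_)
  have h3 : γ s = γ t * γ (s - t) := by rw [← h.map_add, add_sub_cancel]
  simp only [Function.comp_apply]
  rw [h3, Ad_mul]
  rfl

/-- The derivative of `Ad (γ t) Y` is `Ad (γ t) [X, Y]` at every time, so it vanishes identically.
-/
theorem IsOneParameter.Ad_eq_self {γ : ℝ → G} {X Y : E} (h : IsOneParameter γ X)
    (hXY : bracketE E G X Y = 0) (t : ℝ) : Ad E (γ t) Y = Y := by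
  have h1 : ∀ t, HasDerivAt (fun t => Ad E (γ t) Y) 0 t := by
    intro t
    have := h.hasDerivAt_Ad Y t
    rwa [hXY, _root_.map_zero] at this
  have h2 := is_const_of_deriv_eq_zero (fun t => (h1 t).differentiableAt) (fun t => (h1 t).deriv)
    t 0
  rw [h2, h.map_zero, Ad_one]
  rfl

theorem IsOneParameter.map {f : G →* G} (hf : ContMDiff 𝓘(ℝ, E) 𝓘(ℝ, E) ∞ f)
    {γ : ℝ → G} {X : E} (h : IsOneParameter γ X) :
    IsOneParameter (fun t => f (γ t)) (fderiv ℝ (fun x : E => lg (E := E) (f (ex x))) 0 X) :=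
  ⟨fun s t => by simp only [h.map_add, _root_.map_mul], h.hasVelocity.map hf f.map_one⟩

theorem IsOneParameter.conj (g : G) {γ : ℝ → G} {X : E} (h : IsOneParameter γ X) :
    IsOneParameter (fun t => g * γ t * g⁻¹) (Ad E g X) :=
  ⟨fun s t => by simp only [h.map_add]; group, h.hasVelocity.conj g⟩

theorem isMIntegralCurve_left_mul (X : E) (g : G) {γ : ℝ → G} {s : Set ℝ}
    (h : IsMIntegralCurveOn γ (mulInvariantVectorField (I := 𝓘(ℝ, E)) (G := G) X) s) :
    IsMIntegralCurveOn (fun t => g * γ t)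
      (mulInvariantVectorField (I := 𝓘(ℝ, E)) (G := G) X) s := by
  intro t ht
  have hL : ∀ a b : G, MDifferentiableAt 𝓘(ℝ, E) 𝓘(ℝ, E) (fun z : G => a * z) b := fun a b =>
    (contMDiff_mul_left (I := 𝓘(ℝ, E)) (n := ∞)).mdifferentiableAt (by simp)
  have h1 := (hL g (γ t)).hasMFDerivAt.comp_hasMFDerivWithinAt t (h t ht)
  refine h1.congr_mfderiv ?_
  have h2 : ∀ b : G, b = γ t * 1 → ∀ f : G → G, f = (fun z => g * (γ t * z)) →
      (mfderiv 𝓘(ℝ, E) 𝓘(ℝ, E) f 1 : E →L[ℝ] E) =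
      (mfderiv 𝓘(ℝ, E) 𝓘(ℝ, E) (fun z : G => g * z) b : E →L[ℝ] E).comp
      (mfderiv 𝓘(ℝ, E) 𝓘(ℝ, E) (fun z : G => γ t * z) 1 : E →L[ℝ] E) := by
    rintro b rfl f rfl
    exact mfderiv_comp (1 : G) (hL g (γ t * 1)) (hL (γ t) 1)
  have h3 := h2 (γ t) (mul_one _).symm (fun z => g * γ t * z) (by simp [mul_assoc])
  apply ContinuousLinearMap.ext
  intro (r : ℝ)
  refine (ContinuousLinearMap.map_smul (mfderiv 𝓘(ℝ, E) 𝓘(ℝ, E) (fun z : G => g * z) (γ t) :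
    E →L[ℝ] E) r (mulInvariantVectorField (I := 𝓘(ℝ, E)) (G := G) X (γ t) : E)).trans ?_
  exact congrArg (fun Y : E => r • Y) (DFunLike.congr_fun h3 X).symm

/-- A local integral curve of the left-invariant field through `1` has left translates through every
point with the same lifetime, so the field is complete. The homomorphism property holds because `γ
(s + ·)` and `γ s * γ ·` are integral curves with the same initial value. -/
theorem exists_isOneParameter [CompleteSpace E] [T2Space G] (X : E) :
    ∃ γ : ℝ → G, IsOneParameter γ X := by
  have hM := isManifold_infty (E := E) (G := G)
  have hM1 : IsManifold 𝓘(ℝ, E) 1 G := IsManifold.of_le (n := ∞) (by simp)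
  set V := mulInvariantVectorField (I := 𝓘(ℝ, E)) (G := G) X with hV
  have : LieGroup 𝓘(ℝ, E) (minSmoothness ℝ 3) G := inferInstance
  have hv : ContMDiff 𝓘(ℝ, E) 𝓘(ℝ, E).tangent 1 (fun g : G => (⟨g, V g⟩ : TangentBundle 𝓘(ℝ, E) G)) :=
    (contMDiff_mulInvariantVectorField (I := 𝓘(ℝ, E)) (G := G) X).of_le (by
      rw [minSmoothness_of_isRCLikeNormedField]; norm_num)
  obtain ⟨γ₀, h0, h1⟩ := exists_isMIntegralCurveAt_of_contMDiffAt_boundaryless 0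
    (hv.contMDiffAt (x := (1 : G)))
  rw [isMIntegralCurveAt_iff'] at h1
  obtain ⟨ε, hε, h1⟩ := h1
  obtain ⟨γ, hγ0, hγ⟩ := exists_isMIntegralCurve_of_isMIntegralCurveOn hv hε (fun x =>
    ⟨fun t => x * γ₀ t, by simp [h0], by
      simpa [Real.ball_eq_Ioo] using isMIntegralCurve_left_mul X x h1⟩) 1
  have hu : ∀ g : G, IsMIntegralCurve (fun t => g * γ t) V := by
    intro g
    have h := isMIntegralCurve_left_mul X g (hγ.isMIntegralCurveOn univ)
    exact fun t => (h t (mem_univ t)).hasMFDerivAt univ_mem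
  refine ⟨γ, fun s t => ?_, ?_⟩
  · have := isMIntegralCurve_Ioo_eq_of_contMDiff_boundaryless (t₀ := 0) hv (hγ.comp_add s) (hu (γ s))
      (by simp [hγ0])
    rw [add_comm]
    exact congrFun this t
  · rw [← isVelocity_iff]
    refine ⟨hγ0, (hγ 0).congr_mfderiv ?_⟩
    have h1 : ∀ b : G, b = 1 → (V b : E) = X := by
      rintro b rfl
      have h2 : (mfderiv 𝓘(ℝ, E) 𝓘(ℝ, E) (fun z : G => 1 * z) 1 : E →L[ℝ] E) =
          ContinuousLinearMap.id ℝ E := by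
        refine HasMFDerivAt.mfderiv ?_
        rw [show (fun z : G => 1 * z) = id by ext z; simp]
        exact hasMFDerivAt_id (1 : G)
      exact DFunLike.congr_fun h2 X
    apply ContinuousLinearMap.ext
    intro (r : ℝ)
    exact congrArg (fun Y : E => r • Y) (h1 (γ 0) hγ0)

theorem tendsto_smul_Ad_sub_one {ι : Type*} {l : Filter ι} {h : ι → G} {s : ι → ℝ} {X : E}
    (hh : Tendsto h l (𝓝 1))
    (hX : Tendsto (fun n => (s n)⁻¹ • lg (E := E) (h n)) l (𝓝 X)) :
    Tendsto (fun n => (s n)⁻¹ • (Ad E (h n) - 1)) l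
      (𝓝 (fderiv ℝ (fun x : E => Ad E (ex (G := G) x)) 0 X)) := by
  have h2 := (hasFDerivAt_Ad (E := E) (G := G)).hasFDerivWithinAt (s := univ) |>.lim
    (l := l) (c := fun n => (s n)⁻¹) (d := fun n => lg (E := E) (h n)) (v := X)
    (tendsto_lg.comp hh) (by simp) hX
  refine h2.congr' ?_
  filter_upwards [hh.eventually (eventually_ex_lg (E := E))] with n hn
  rw [zero_add, hn, ex_zero, Ad_one]
  rfl

/-- Telescoping: `a ^ k - b ^ k` is a sum of `k` terms `a ^ i * (a - b) * b ^ j`, and all powers are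
bounded by `c`. The extra factor `b ^ m` keeps the induction going. -/
theorem norm_pow_sub_pow_le {A : Type*} [NormedRing A] {a b : A} {c : ℝ}
    (ha : ∀ k : ℕ, ‖a ^ k‖ ≤ c) (hb : ∀ k : ℕ, ‖b ^ k‖ ≤ c) (k m : ℕ) :
    ‖(a ^ k - b ^ k) * b ^ m‖ ≤ k * (c * ‖a - b‖ * c) := by
  have hc : 0 ≤ c := (norm_nonneg _).trans (ha 0)
  induction k generalizing m with
  | zero => simp
  | succ k ih =>
    have h1 : (a ^ (k + 1) - b ^ (k + 1)) * b ^ m =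
        a ^ k * (a - b) * b ^ m + (a ^ k - b ^ k) * b ^ (m + 1) := by
      rw [pow_succ, pow_succ, pow_succ']; noncomm_ring
    have h2 : ‖a ^ k * (a - b) * b ^ m‖ ≤ c * ‖a - b‖ * c := by
      refine (norm_mul_le _ _).trans ?_
      refine mul_le_mul ((norm_mul_le _ _).trans ?_) (hb m) (norm_nonneg _) (by positivity)
      gcongr
      exact ha k
    rw [h1]
    refine (norm_add_le _ _).trans ?_
    have := ih (m + 1)
    push_cast
    linarith

/-- The adjoint representation as a homomorphism. -/
noncomputable def AdHom (E : Type u) [NormedAddCommGroup E] [NormedSpace ℝ E]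
    (G : Type v) [TopologicalSpace G] [ChartedSpace E G] [Group G] [LieGroup 𝓘(ℝ, E) ∞ G] :
    G →* (E →L[ℝ] E) where
  toFun := Ad E
  map_one' := Ad_one
  map_mul' := Ad_mul

theorem Ad_pow (g : G) (k : ℕ) : Ad E (g ^ k) = Ad E g ^ k := map_pow (AdHom E G) g k

theorem Ad_mul' (g h : G) : Ad E (g * h) = Ad E g * Ad E h := map_mul (AdHom E G) g h

theorem exists_norm_Ad_le [CompactSpace G] : ∃ c : ℝ, ∀ g : G, ‖Ad E g‖ ≤ c := by
  obtain ⟨c, hc⟩ := isCompact_univ.exists_bound_of_continuousOn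
    (continuous_Ad (E := E) (G := G)).continuousOn
  exact ⟨c, fun g => hc g (mem_univ g)⟩

/-- If the centre of the Lie algebra is trivial, the adjoint representation separates the points
near the identity from the identity. -/
theorem exists_norm_lg_le [FiniteDimensional ℝ E]
    (hinj : ∀ X : E, (∀ Y, bracketE E G X Y = 0) → X = 0) :
    ∃ c > 0, ∀ᶠ g in 𝓝 (1 : G), c * ‖lg (E := E) g‖ ≤ ‖Ad E g - 1‖ := by
  set D := fderiv ℝ (fun x : E => Ad E (ex (G := G) x)) 0 with hD
  have hker : LinearMap.ker (D : E →ₗ[ℝ] E →L[ℝ] E) = ⊥ := by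
    rw [LinearMap.ker_eq_bot']
    intro X hX
    refine hinj X fun Y => ?_
    rw [← fderiv_Ad]
    exact DFunLike.congr_fun hX Y
  obtain ⟨K, hK0, hK⟩ := LinearMap.exists_antilipschitzWith (D : E →ₗ[ℝ] E →L[ℝ] E) hker
  have hK0' : (0 : ℝ) < K := by exact_mod_cast hK0
  have hb : ∀ X : E, (K : ℝ)⁻¹ * ‖X‖ ≤ ‖D X‖ := by
    intro X
    have h1 := hK.le_mul_dist X 0
    simp only [dist_zero_right, map_zero] at h1
    rw [inv_mul_le_iff₀ hK0']
    exact h1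
  -- The differential of `Ad` is bounded below by `K⁻¹`, since its kernel is the centre. Half of
  -- this bound absorbs the remainder of the first-order expansion.
  refine ⟨(K : ℝ)⁻¹ / 2, by positivity, ?_⟩
  have h1 := (hasFDerivAt_Ad (E := E) (G := G)).isLittleO.def (show (0 : ℝ) < (K : ℝ)⁻¹ / 2 by positivity)
  filter_upwards [(tendsto_lg (E := E) (G := G)).eventually h1, eventually_ex_lg (E := E)] with g hg hg1
  simp only [sub_zero, hg1, ex_zero, Ad_one] at hg
  have h2 := hb (lg g)
  have h3 : ‖D (lg g)‖ ≤ ‖Ad E g - 1‖ + ‖Ad E g - ContinuousLinearMap.id ℝ E - D (lg g)‖ := by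
    have := norm_sub_le (Ad E g - 1) (Ad E g - ContinuousLinearMap.id ℝ E - D (lg g))
    refine le_trans (le_of_eq ?_) this
    congr 1
    have : (1 : E →L[ℝ] E) = ContinuousLinearMap.id ℝ E := rfl
    rw [this]; abel
  rw [← hD] at hg
  linarith

/-- The expression is `1` at `u = w = 1` for every `x`. Compactness of `G` makes the neighbourhood
uniform in `x`. -/
theorem exists_nhds_mul_conj_subset [CompactSpace G] {N : Set G} (hN : N ∈ 𝓝 (1 : G)) (E : Type u)
    [NormedAddCommGroup E] [NormedSpace ℝ E] [ChartedSpace E G] [LieGroup 𝓘(ℝ, E) ∞ G] :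
    ∃ W ∈ 𝓝 (1 : G), ∀ u ∈ W, ∀ w ∈ W, ∀ x : G, u * (x * w * x⁻¹) ∈ N := by
  have := isTopologicalGroup_of_lieGroup E G
  have h := isCompact_univ.eventually_forall_of_forall_eventually (X := G × G) (Y := G)
    (x₀ := ((1 : G), (1 : G))) (K := univ)
    (P := fun p x => p.1 * (x * p.2 * x⁻¹) ∈ N) (fun x _ => by
      have hc : Continuous fun z : (G × G) × G => z.1.1 * (z.2 * z.1.2 * z.2⁻¹) := by fun_prop
      have := hc.tendsto ((1, 1), x)
      simp only [mul_one, mul_inv_cancel] at this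
      exact this hN)
  rw [nhds_prod_eq] at h
  obtain ⟨W, hW, hW'⟩ := Filter.mem_prod_self_iff.1 h
  exact ⟨W, hW, fun u hu w hw x => hW' (mk_mem_prod hu hw) x (mem_univ x)⟩

end OneParameter

/-! ### One-parameter subgroups as limits of powers. -/

section Limit

variable {E : Type u} [NormedAddCommGroup E] [NormedSpace ℝ E] [FiniteDimensional ℝ E]
  {G : Type v} [TopologicalSpace G] [ChartedSpace E G] [Group G] [LieGroup 𝓘(ℝ, E) ∞ G]
  [CompactSpace G]

/-- Telescoping keeps `Ad (h ^ j * (k ^ j)⁻¹)` near `1` for all `j ≤ m`, but `Ad` controls an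
element only once it is known to be near `1`. Hence an induction on `j`: with `q = h ^ j * (k ^
j)⁻¹`, the next quotient is `(h * k⁻¹) * (k * q * k⁻¹)`. If `q` lies in the smaller neighbourhood
`W`, this lies in `N` and in the domain of the lower bound for `Ad`, which puts it back into `W`. -/
theorem eventually_pow_mul_inv_pow_mem
    (hinj : ∀ X : E, (∀ Y, bracketE E G X Y = 0) → X = 0)
    {ι : Type*} {l : Filter ι} {h k : ι → G} {m : ι → ℕ}
    (hh : Tendsto h l (𝓝 1)) (hk : Tendsto k l (𝓝 1))
    (hm : Tendsto (fun n => m n * ‖Ad E (h n) - Ad E (k n)‖) l (𝓝 0))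
    {N : Set G} (hN : N ∈ 𝓝 (1 : G)) :
    ∀ᶠ n in l, h n ^ m n * (k n ^ m n)⁻¹ ∈ N := by
  have := isTopologicalGroup_of_lieGroup E G
  obtain ⟨c, hc, hcN⟩ := exists_norm_lg_le (G := G) hinj
  obtain ⟨b, hb⟩ := exists_norm_Ad_le (E := E) (G := G)
  have hb0 : 0 ≤ b := (norm_nonneg _).trans (hb 1)
  obtain ⟨W, hW, hWN⟩ := exists_nhds_mul_conj_subset (N := N ∩ {g | c * ‖lg (E := E) g‖ ≤
    ‖Ad E g - 1‖} ∩ {g | ex (lg (E := E) g) = g})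
    (inter_mem (inter_mem hN hcN) eventually_ex_lg) E
  obtain ⟨r, hr, hrW⟩ := Metric.eventually_nhds_iff.1 (tendsto_ex.eventually (eventually_mem_set.2 hW) :
    ∀ᶠ x in 𝓝 (0 : E), ex (G := G) x ∈ W)
  have hquot : Tendsto (fun n => h n * (k n)⁻¹) l (𝓝 1) := by
    simpa using hh.mul hk.inv
  have hm' : Tendsto (fun n => m n * (b * ‖Ad E (h n) - Ad E (k n)‖ * b) * b) l (𝓝 0) := by
    have := (hm.const_mul (b * b * b))
    rw [mul_zero] at this
    exact this.congr fun n => by ring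
  filter_upwards [hquot.eventually (eventually_mem_set.2 hW),
    hm'.eventually (gt_mem_nhds (show 0 < c * r by positivity))] with n hn1 hn2
  have hAd : ∀ j ≤ m n, ‖Ad E (h n ^ j * (k n ^ j)⁻¹) - 1‖ < c * r := by
    intro j hj
    refine lt_of_le_of_lt ?_ hn2
    have h1 : Ad E (h n ^ j * (k n ^ j)⁻¹) - 1 =
        (Ad E (h n) ^ j - Ad E (k n) ^ j) * Ad E ((k n ^ j)⁻¹) := by
      rw [sub_mul, ← Ad_pow, ← Ad_pow, ← Ad_mul', ← Ad_mul', mul_inv_cancel, Ad_one]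
      rfl
    rw [h1]
    refine (norm_mul_le _ _).trans ?_
    refine mul_le_mul ?_ (hb _) (norm_nonneg _) (by positivity)
    have h2 := norm_pow_sub_pow_le (a := Ad E (h n)) (b := Ad E (k n)) (c := b)
      (fun i => by rw [← Ad_pow]; exact hb _) (fun i => by rw [← Ad_pow]; exact hb _) j 0
    rw [pow_zero, mul_one] at h2
    refine h2.trans ?_
    gcongr
  have hind : ∀ j ≤ m n, h n ^ j * (k n ^ j)⁻¹ ∈ N ∩ {g | c * ‖lg (E := E) g‖ ≤
      ‖Ad E g - 1‖} ∩ {g | ex (lg (E := E) g) = g} := by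
    intro j
    induction j with
    | zero =>
      intro _
      have h1 := hWN 1 (mem_of_mem_nhds hW) 1 (mem_of_mem_nhds hW) 1
      simpa using h1
    | succ j ih =>
      intro hj
      obtain ⟨⟨-, h2⟩, h3⟩ := ih (by omega)
      have h4 : ‖lg (E := E) (h n ^ j * (k n ^ j)⁻¹)‖ < r := by
        have := h2.trans_lt (hAd j (by omega))
        exact lt_of_mul_lt_mul_left this hc.le
      have h5 : h n ^ j * (k n ^ j)⁻¹ ∈ W := by
        rw [← (show ex (lg (E := E) (h n ^ j * (k n ^ j)⁻¹)) = _ from h3)]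
        exact hrW (by simpa using h4)
      have h6 := hWN _ hn1 _ h5 (k n)
      convert h6 using 1
      rw [pow_succ' (h n), pow_succ' (k n)]
      group
  exact (hind (m n) le_rfl).1.1

theorem HasVelocity.tendsto_inv_smul {γ : ℝ → G} {X : E} (h : HasVelocity γ X) {ι : Type*}
    {l : Filter ι} {s : ι → ℝ} (hs0 : ∀ᶠ n in l, s n ≠ 0) (hs : Tendsto s l (𝓝 0)) :
    Tendsto (fun n => (s n)⁻¹ • lg (E := E) (γ (s n))) l (𝓝 X) := by
  have h1 := (hasDerivAt_iff_tendsto_slope.1 h.2.2).comp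
    (tendsto_nhdsWithin_iff.2 ⟨hs, hs0⟩)
  refine h1.congr fun n => ?_
  simp [slope, h.1]

/-- The one-parameter subgroup with velocity `X` is the limit of powers of elements that converge
to the identity in the direction of `X`. -/
theorem IsOneParameter.tendsto_pow
    (hinj : ∀ X : E, (∀ Y, bracketE E G X Y = 0) → X = 0)
    {γ : ℝ → G} {X : E} (hγ : IsOneParameter γ X) {ι : Type*} {l : Filter ι} {h : ι → G}
    {s : ι → ℝ} (hs0 : ∀ᶠ n in l, 0 < s n) (hs : Tendsto s l (𝓝 0)) (hh : Tendsto h l (𝓝 1))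
    (hX : Tendsto (fun n => (s n)⁻¹ • lg (E := E) (h n)) l (𝓝 X)) {t : ℝ} (ht : 0 ≤ t) :
    Tendsto (fun n => h n ^ ⌊t / s n⌋₊) l (𝓝 (γ t)) := by
  have := isTopologicalGroup_of_lieGroup E G
  have hk : Tendsto (fun n => γ (s n)) l (𝓝 1) := hγ.hasVelocity.tendsto.comp hs
  have hs0' : ∀ᶠ n in l, s n ≠ 0 := hs0.mono fun n hn => hn.ne'
  have h1 := tendsto_smul_Ad_sub_one hh hX
  have h2 := tendsto_smul_Ad_sub_one hk (hγ.hasVelocity.tendsto_inv_smul hs0' hs)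
  have h3 := ((h1.sub h2).norm).const_mul t
  rw [sub_self, norm_zero, mul_zero] at h3
  -- The two difference quotients of `Ad` have the same limit, so `Ad (h n)` and `Ad (γ (s n))`
  -- differ by `o(s n)`. At most `t / s n` factors are multiplied.
  have hm : Tendsto (fun n => (⌊t / s n⌋₊ : ℝ) * ‖Ad E (h n) - Ad E (γ (s n))‖) l (𝓝 0) := by
    refine squeeze_zero' (Eventually.of_forall fun n => by positivity) ?_ h3
    filter_upwards [hs0] with n hn
    have h4 : (⌊t / s n⌋₊ : ℝ) ≤ t / s n := Nat.floor_le (by positivity)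
    have h5 : (s n)⁻¹ • (Ad E (h n) - 1) - (s n)⁻¹ • (Ad E (γ (s n)) - 1) =
        (s n)⁻¹ • (Ad E (h n) - Ad E (γ (s n))) := by
      rw [← smul_sub]; congr 1; abel
    rw [h5, norm_smul, Real.norm_of_nonneg (by positivity), ← mul_assoc, ← div_eq_mul_inv]
    gcongr
  have h6 : Tendsto (fun n => h n ^ ⌊t / s n⌋₊ * (γ (s n) ^ ⌊t / s n⌋₊)⁻¹) l (𝓝 1) :=
    fun N hN => eventually_pow_mul_inv_pow_mem hinj hh hk hm hN
  have h7 : Tendsto (fun n => (⌊t / s n⌋₊ : ℝ) * s n) l (𝓝 t) := by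
    have h8 : Tendsto (fun n => (s n)⁻¹) l atTop :=
      tendsto_inv_nhdsGT_zero.comp (tendsto_nhdsWithin_iff.2 ⟨hs, hs0⟩)
    refine ((tendsto_nat_floor_mul_div_atTop (R := ℝ) ht).comp h8).congr fun n => ?_
    simp [div_eq_mul_inv]
  have h9 := h6.mul ((hγ.continuous.tendsto t).comp h7)
  rw [one_mul] at h9
  refine h9.congr fun n => ?_
  simp only [Function.comp_apply]
  rw [hγ.map_nsmul, inv_mul_cancel_right]

/-- Powers of `δ (1 / (n + 1))` converge to `γ t` and to `δ t`, because only the common velocity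
matters for the limit. Negative times follow by inversion. -/
theorem IsOneParameter.unique [T2Space G]
    (hinj : ∀ X : E, (∀ Y, bracketE E G X Y = 0) → X = 0)
    {γ δ : ℝ → G} {X : E} (hγ : IsOneParameter γ X) (hδ : IsOneParameter δ X) : γ = δ := by
  have h0 : ∀ t, 0 ≤ t → γ t = δ t := by
    intro t ht
    have hs : Tendsto (fun n : ℕ => ((n : ℝ) + 1)⁻¹) atTop (𝓝 0) := by
      simpa using tendsto_one_div_add_atTop_nhds_zero_nat (𝕜 := ℝ)
    have hs0 : ∀ᶠ n : ℕ in atTop, 0 < ((n : ℝ) + 1)⁻¹ :=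
      Eventually.of_forall fun n => by positivity
    have h1 := hδ.hasVelocity.tendsto_inv_smul (hs0.mono fun n hn => hn.ne') hs
    have h2 := hδ.hasVelocity.tendsto.comp hs
    exact tendsto_nhds_unique (hγ.tendsto_pow hinj hs0 hs h2 h1 ht)
      (hδ.tendsto_pow hinj hs0 hs h2 h1 ht)
  ext t
  rcases le_total 0 t with ht | ht
  · exact h0 t ht
  · have h1 := h0 (-t) (by linarith)
    rw [hγ.map_neg, hδ.map_neg] at h1
    exact inv_injective h1

/-- The one-parameter subgroup in the limiting direction of a sequence in a closed subgroup lies in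
that subgroup. -/
theorem IsOneParameter.mem_of_isClosed
    (hinj : ∀ X : E, (∀ Y, bracketE E G X Y = 0) → X = 0)
    {γ : ℝ → G} {X : E} (hγ : IsOneParameter γ X) {ι : Type*} {l : Filter ι} [l.NeBot] {h : ι → G}
    {s : ι → ℝ} (hs0 : ∀ᶠ n in l, 0 < s n) (hs : Tendsto s l (𝓝 0)) (hh : Tendsto h l (𝓝 1))
    (hX : Tendsto (fun n => (s n)⁻¹ • lg (E := E) (h n)) l (𝓝 X)) {H : Subgroup G}
    (hH : IsClosed (H : Set G)) (hhH : ∀ n, h n ∈ H) (t : ℝ) : γ t ∈ H := by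
  have h0 : ∀ t, 0 ≤ t → γ t ∈ H := fun t ht =>
    hH.mem_of_tendsto (hγ.tendsto_pow hinj hs0 hs hh hX ht)
      (Eventually.of_forall fun n => H.pow_mem (hhH n) _)
  rcases le_total 0 t with ht | ht
  · exact h0 t ht
  · have h1 := h0 (-t) (by linarith)
    rw [hγ.map_neg] at h1
    exact (H.inv_mem_iff).1 h1

end Limit

/-! ### Closed subgroups, the action of a torus, and maximality. -/

section Tori

variable {E : Type u} [NormedAddCommGroup E] [NormedSpace ℝ E]
  {G : Type v} [TopologicalSpace G] [ChartedSpace E G] [Group G] [LieGroup 𝓘(ℝ, E) ∞ G]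

theorem hasFDerivAt_mulC : HasFDerivAt (mulC (E := E) G)
    (ContinuousLinearMap.fst ℝ E E + ContinuousLinearMap.snd ℝ E E) (0, 0) := by
  have hd : DifferentiableAt ℝ (mulC (E := E) G) (0, 0) :=
    contDiffAt_mulC.differentiableAt (by simp)
  have h1 := fun Y : E => fderiv_right_eq (p := ((0 : E), (0 : E))) hd Y
  have h2 := fun Y : E => fderiv_left_eq (p := ((0 : E), (0 : E))) hd Y
  simp only [fderiv_right_zero mulC_zero_left, fderiv_left_zero mulC_zero_right,
    ContinuousLinearMap.id_apply] at h1 h2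
  convert hd.hasFDerivAt using 1
  ext v
  · simpa using h2 v
  · simpa using h1 v

theorem mem_lieAlg_iff {H : Subgroup G} {X : E} :
    X ∈ lieAlg (E := E) H ↔ ∃ γ : ℝ → G, (∀ t, γ t ∈ H) ∧ HasVelocity γ X :=
  exists_congr fun _ => and_congr_right fun _ => isVelocity_iff

theorem IsOneParameter.mem_lieAlg {γ : ℝ → G} {X : E} (hγ : IsOneParameter γ X) {H : Subgroup G}
    (h : ∀ t, γ t ∈ H) : X ∈ lieAlg (E := E) H :=
  mem_lieAlg_iff.2 ⟨γ, h, hγ.hasVelocity⟩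

/-- The elements of `T` whose adjoint action fixes `X`. -/
def fixingSubgroup (T : Subgroup G) (X : E) : Subgroup G where
  carrier := {a | a ∈ T ∧ Ad E a X = X}
  one_mem' := ⟨T.one_mem, by rw [Ad_one]; rfl⟩
  mul_mem' := by
    rintro a b ⟨ha, ha'⟩ ⟨hb, hb'⟩
    refine ⟨T.mul_mem ha hb, ?_⟩
    rw [Ad_mul, ContinuousLinearMap.comp_apply, hb', ha']
  inv_mem' := by
    rintro a ⟨ha, ha'⟩
    refine ⟨T.inv_mem ha, ?_⟩
    conv_lhs => rw [← ha']
    rw [← ContinuousLinearMap.comp_apply, ← Ad_mul, inv_mul_cancel, Ad_one]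
    rfl

theorem isClosed_fixingSubgroup {T : Subgroup G} (hT : IsClosed (T : Set G)) (X : E) :
    IsClosed (fixingSubgroup T X : Set G) :=
  hT.inter (isClosed_eq ((continuous_Ad (E := E) (G := G)).clm_apply continuous_const)
    continuous_const)

variable [FiniteDimensional ℝ E] [CompactSpace G] [T2Space G]

/-- In each coset of a closed subgroup close to the identity there is an element that is closest
to the identity. -/
theorem exists_minimal_norm_lg {H : Subgroup G} (hH : IsClosed (H : Set G)) {K : Set G}
    (hK : IsCompact K) (hKc : ContinuousOn (lg (E := E)) K) {a : G} (ha : a ∈ K) :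
    ∃ b ∈ K, a⁻¹ * b ∈ H ∧ ‖lg (E := E) b‖ ≤ ‖lg (E := E) a‖ ∧
      ∀ y ∈ H, b * y ∈ K → ‖lg (E := E) b‖ ≤ ‖lg (E := E) (b * y)‖ := by
  have := isTopologicalGroup_of_lieGroup E G
  have hcl : IsClosed {b : G | a⁻¹ * b ∈ H} := hH.preimage (by fun_prop : Continuous (a⁻¹ * ·))
  obtain ⟨b, ⟨hbK, hbH⟩, hb⟩ := (hK.inter_right hcl).exists_isMinOn
    ⟨a, ha, by simp [H.one_mem]⟩ ((hKc.mono inter_subset_left).norm)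
  refine ⟨b, hbK, hbH, hb ⟨ha, by simp [H.one_mem]⟩, fun y hy hby => hb ⟨hby, ?_⟩⟩
  have := H.mul_mem hbH hy
  simpa [mul_assoc] using this

/-- A local form of the closed subgroup theorem. Otherwise elements of `T` outside the fixing
subgroup `H` approach `1`; each is replaced by the element `b` of its coset of `H` closest to `1`. A
limiting direction `Y` of these `b` is tangent to `T`, so `[Y, X] = 0` and the one-parameter
subgroup `γ` of `Y` lies in `H`. Then `b * γ (-‖lg b‖)` is in the same coset and is closer to `1`, a
contradiction. -/
theorem eventually_mem_fixingSubgroup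
    (hinj : ∀ X : E, (∀ Y, bracketE E G X Y = 0) → X = 0) {T : Subgroup G}
    (hT : IsClosed (T : Set G)) {X : E} (hX : ∀ Y ∈ lieAlg (E := E) T, bracketE E G Y X = 0) :
    ∀ᶠ a in 𝓝 (1 : G), a ∈ T → a ∈ fixingSubgroup T X := by
  have := isTopologicalGroup_of_lieGroup E G
  set H := fixingSubgroup T X with hHdef
  have hH : IsClosed (H : Set G) := isClosed_fixingSubgroup hT X
  have hHT : ∀ a ∈ H, a ∈ T := fun a ha => ha.1
  obtain ⟨K, hK1, hKsub, hKc⟩ := local_compact_nhds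
    (inter_mem (eventually_ex_lg (E := E) (G := G)) (eventually_contMDiffAt_lg (E := E) (G := G)))
  have hKlg : ContinuousOn (lg (E := E)) K := fun g hg =>
    (hKsub hg).2.continuousAt.continuousWithinAt
  have hKex : ∀ g ∈ K, ex (lg (E := E) g) = g := fun g hg => (hKsub hg).1
  by_contra hcon
  rw [not_eventually, frequently_iff_neBot] at hcon
  -- An ultrafilter makes the normalized directions converge by compactness of the unit sphere, with
  -- no choice of subsequences.
  obtain ⟨U, hU⟩ := Ultrafilter.exists_le (𝓝 (1 : G) ⊓ 𝓟 {a | ¬(a ∈ T → a ∈ H)})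
  have hU1 : (U : Filter G) ≤ 𝓝 1 := hU.trans inf_le_left
  have hU2 : ∀ᶠ a in (U : Filter G), a ∈ T ∧ a ∉ H := by
    have : ∀ᶠ a in (U : Filter G), a ∈ {a | ¬(a ∈ T → a ∈ H)} :=
      hU (mem_inf_of_right (mem_principal_self _))
    filter_upwards [this] with a ha
    exact Classical.not_imp.1 ha
  have hUK : ∀ᶠ a in (U : Filter G), a ∈ K := hU1 hK1
  have hex : ∀ a : G, ∃ b : G, a ∈ K → b ∈ K ∧ a⁻¹ * b ∈ H ∧ ‖lg (E := E) b‖ ≤ ‖lg (E := E) a‖ ∧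
      ∀ y ∈ H, b * y ∈ K → ‖lg (E := E) b‖ ≤ ‖lg (E := E) (b * y)‖ := by
    intro a
    by_cases ha : a ∈ K
    · obtain ⟨b, hb⟩ := exists_minimal_norm_lg hH hKc hKlg ha
      exact ⟨b, fun _ => hb⟩
    · exact ⟨1, fun h => absurd h ha⟩
  choose b hb using hex
  have hb0 : Tendsto (fun a => lg (E := E) (b a)) U (𝓝 0) := by
    rw [tendsto_zero_iff_norm_tendsto_zero]
    have h1 : Tendsto (fun a => ‖lg (E := E) a‖) (U : Filter G) (𝓝 0) := by
      simpa using ((tendsto_lg (E := E) (G := G)).mono_left hU1).norm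
    refine squeeze_zero' (Eventually.of_forall fun a => norm_nonneg _) ?_ h1
    filter_upwards [hUK] with a ha using (hb a ha).2.2.1
  have hb1 : Tendsto b U (𝓝 1) := by
    refine (tendsto_ex.comp hb0).congr' ?_
    filter_upwards [hUK] with a ha using hKex _ (hb a ha).1
  have hbT : ∀ᶠ a in (U : Filter G), b a ∈ T ∧ b a ∉ H := by
    filter_upwards [hUK, hU2] with a ha ha2
    have h1 := (hb a ha).2.1
    refine ⟨?_, fun h => ha2.2 ?_⟩
    · have := T.mul_mem ha2.1 (hHT _ h1)
      simpa using this
    · have := H.mul_mem h (H.inv_mem h1)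
      simpa using this
  have hs0 : ∀ᶠ a in (U : Filter G), 0 < ‖lg (E := E) (b a)‖ := by
    filter_upwards [hUK, hbT] with a ha ha2
    rw [norm_pos_iff]
    intro h
    apply ha2.2
    rw [← hKex _ (hb a ha).1, h, ex_zero]
    exact H.one_mem
  have hs : Tendsto (fun a => ‖lg (E := E) (b a)‖) U (𝓝 0) := by simpa using hb0.norm
  obtain ⟨Y, hY1, hY⟩ := (isCompact_sphere (0 : E) 1).ultrafilter_le_nhds
    (U.map fun a => ‖lg (E := E) (b a)‖⁻¹ • lg (E := E) (b a)) (by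
      rw [Ultrafilter.coe_map, le_principal_iff, mem_map]
      filter_upwards [hs0] with a ha
      simp [norm_smul, ha.ne'])
  have hY' : Tendsto (fun a => ‖lg (E := E) (b a)‖⁻¹ • lg (E := E) (b a)) U (𝓝 Y) := hY
  obtain ⟨γ, hγ⟩ := exists_isOneParameter (G := G) Y
  -- The representatives lie in `T` only eventually; elsewhere they are replaced by `1`.
  have hbT' : ∃ b' : G → G, (∀ a, b' a ∈ T) ∧ b =ᶠ[U] b' := by
    classical
    refine ⟨fun a => if b a ∈ T then b a else 1, fun a => ?_, ?_⟩
    · dsimp only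
      split_ifs with h
      exacts [h, T.one_mem]
    · filter_upwards [hbT] with a ha
      simp [ha.1]
  obtain ⟨b', hb'T, hbb'⟩ := hbT'
  have hγT : ∀ t, γ t ∈ T := hγ.mem_of_isClosed hinj hs0 hs (hb1.congr' hbb')
    (hY'.congr' (hbb'.mono fun a ha => by simp only [ha])) hT hb'T
  have hγH : ∀ t, γ t ∈ H := fun t =>
    ⟨hγT t, hγ.Ad_eq_self (hX Y (hγ.mem_lieAlg hγT)) t⟩
  have hsn : Tendsto (fun a => -‖lg (E := E) (b a)‖) U (𝓝 0) := by simpa using hs.neg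
  have hc := hγ.hasVelocity.tendsto_inv_smul (hs0.mono fun a ha => neg_ne_zero.2 ha.ne') hsn
  have hc' : Tendsto (fun a => ‖lg (E := E) (b a)‖⁻¹ • lg (E := E) (γ (-‖lg (E := E) (b a)‖)))
      U (𝓝 (-Y)) := by
    refine hc.neg.congr fun a => ?_
    rw [inv_neg, neg_smul, neg_neg]
  have hγ1 : Tendsto (fun a => γ (-‖lg (E := E) (b a)‖)) U (𝓝 1) :=
    hγ.hasVelocity.tendsto.comp hsn
  -- To first order multiplication is addition, so the coordinate of `b * γ (-‖lg b‖)`, divided by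
  -- `‖lg b‖`, tends to `Y + (-Y) = 0`.
  have hlim := (hasFDerivAt_mulC (E := E) (G := G)).hasFDerivWithinAt (s := univ) |>.lim
    (l := U) (c := fun a => ‖lg (E := E) (b a)‖⁻¹)
    (d := fun a => (lg (E := E) (b a), lg (E := E) (γ (-‖lg (E := E) (b a)‖)))) (v := (Y, -Y))
    (hb0.prodMk_nhds ((tendsto_lg (E := E)).comp hγ1)) (by simp)
    (hY'.prodMk_nhds hc')
  have hlim' := hlim.norm
  have hprod : Tendsto (fun a => b a * γ (-‖lg (E := E) (b a)‖)) U (𝓝 1) := by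
    simpa using hb1.mul hγ1
  simp only [_root_.add_apply, ContinuousLinearMap.coe_fst', ContinuousLinearMap.coe_snd',
    add_neg_cancel, norm_zero] at hlim'
  have hfin : ∀ᶠ a in (U : Filter G), False := by
    filter_upwards [hlim'.eventually (gt_mem_nhds one_pos), hs0, hUK, hprod hK1,
      hγ1.eventually (eventually_ex_lg (E := E))] with a h1 h2 h3 h4 h5
    have h6 := (hb a h3).2.2.2 _ (hγH _) h4
    have h7 : mulC (E := E) G (lg (b a), lg (γ (-‖lg (E := E) (b a)‖))) =
        lg (b a * γ (-‖lg (E := E) (b a)‖)) := by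
      simp only [mulC]
      rw [hKex _ (hb a h3).1, h5]
    have h8 : mulC (E := E) G (0, 0) = 0 := by simp [mulC]
    rw [show ((0 : E), (0 : E)) = 0 from rfl, zero_add, h7, show (0 : E × E) = (0, 0) from rfl, h8,
      sub_zero, norm_smul, norm_inv, norm_norm, inv_mul_lt_iff₀ h2, mul_one] at h1
    exact absurd h6 (not_le.2 h1)
  exact U.neBot.ne (Filter.eventually_false_iff_eq_bot.1 hfin)

/-- If `X` commutes with the Lie algebra of a closed connected subgroup, it is fixed by its adjoint
action. -/
theorem Ad_eq_self_of_mem (hinj : ∀ X : E, (∀ Y, bracketE E G X Y = 0) → X = 0) {T : Subgroup G}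
    (hT : IsClosed (T : Set G)) (hTc : IsConnected (T : Set G)) {X : E}
    (hX : ∀ Y ∈ lieAlg (E := E) T, bracketE E G Y X = 0) {a : G} (ha : a ∈ T) : Ad E a X = X := by
  have := isTopologicalGroup_of_lieGroup E G
  set H := fixingSubgroup T X with hHdef
  have hH : IsClosed (H : Set G) := isClosed_fixingSubgroup hT X
  -- Translating the local result shows that `H` is relatively open in `T`. It is also closed, and
  -- `T` is connected.
  have h1 : ∀ g ∈ H, g ∈ interior {x : G | x ∈ T → x ∈ H} := by
    intro g hg
    rw [mem_interior_iff_mem_nhds]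
    have h2 : Tendsto (fun x => g⁻¹ * x) (𝓝 g) (𝓝 1) := by
      have : Continuous fun x : G => g⁻¹ * x := by fun_prop
      simpa using this.tendsto g
    filter_upwards [h2.eventually (eventually_mem_fixingSubgroup hinj hT hX)] with x hx hxT
    have h3 := H.mul_mem hg (hx (T.mul_mem (T.inv_mem hg.1) hxT))
    simpa using h3
  have h2 := isPreconnected_iff_subset_of_disjoint.1 hTc.isPreconnected
    (interior {x : G | x ∈ T → x ∈ H}) (H : Set G)ᶜ isOpen_interior hH.isOpen_compl
    (fun x _ => by
      by_cases hx : x ∈ H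
      exacts [Or.inl (h1 x hx), Or.inr hx])
    (by
      ext x
      simp only [mem_inter_iff, mem_empty_iff_false, iff_false, not_and]
      exact fun hxT hx hx' => hx' (interior_subset hx hxT))
  rcases h2 with h2 | h2
  · exact (interior_subset (h2 ha) ha).2
  · exact absurd H.one_mem (h2 T.one_mem)

/-- A one-parameter subgroup of `H` whose velocity commutes with the Lie algebra of a maximal torus
of `H` lies in the torus. -/
theorem IsMaximalTorus.oneParameter_mem
    (hinj : ∀ X : E, (∀ Y, bracketE E G X Y = 0) → X = 0) {H T : Subgroup G}
    (hH : IsClosed (H : Set G)) (hT : IsMaximalTorus H T) {X : E}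
    (hX : ∀ Y ∈ lieAlg (E := E) T, bracketE E G Y X = 0) {γ : ℝ → G} (hγ : IsOneParameter γ X)
    (hγH : ∀ t, γ t ∈ H) (t : ℝ) : γ t ∈ T := by
  have := isTopologicalGroup_of_lieGroup E G
  obtain ⟨⟨hTt, hTH⟩, hmax⟩ := hT
  -- The conjugate of `γ` by `a` has velocity `Ad a X = X`, so it equals `γ` by uniqueness.
  have hcomm : ∀ a ∈ T, ∀ t, a * γ t = γ t * a := by
    intro a ha t
    have h1 := hγ.conj a
    rw [Ad_eq_self_of_mem hinj hTt.isCompact.isClosed hTt.isConnected hX ha] at h1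
    have h2 := congrFun (h1.unique hinj hγ) t
    exact mul_inv_eq_iff_eq_mul.1 h2
  have hcc : ∀ a ∈ T, ∀ s, ∀ b ∈ T, ∀ t, a * γ s * (b * γ t) = a * b * γ (s + t) := by
    intro a _ s b hb t
    rw [hγ.map_add, mul_assoc a, ← mul_assoc (γ s), ← hcomm b hb s]
    group
  -- The product of `T` and the image of `γ` is connected and abelian. Its closure is a torus in `H`
  -- that contains `T`, hence equals `T` by maximality.
  let S : Subgroup G :=
    { carrier := {g | ∃ a ∈ T, ∃ s, g = a * γ s}
      one_mem' := ⟨1, T.one_mem, 0, by simp [hγ.map_zero]⟩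
      mul_mem' := by
        rintro _ _ ⟨a, ha, s, rfl⟩ ⟨b, hb, t, rfl⟩
        exact ⟨a * b, T.mul_mem ha hb, s + t, hcc a ha s b hb t⟩
      inv_mem' := by
        rintro _ ⟨a, ha, s, rfl⟩
        refine ⟨a⁻¹, T.inv_mem ha, -s, ?_⟩
        rw [mul_inv_rev, ← hγ.map_neg, hcomm _ (T.inv_mem ha)] }
  have hSc : IsConnected (S : Set G) := by
    have h1 : (S : Set G) = (fun p : G × ℝ => p.1 * γ p.2) '' ((T : Set G) ×ˢ univ) := by
      ext g
      constructor
      · rintro ⟨a, ha, s, rfl⟩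
        exact ⟨(a, s), ⟨ha, mem_univ _⟩, rfl⟩
      · rintro ⟨⟨a, s⟩, ⟨ha, -⟩, rfl⟩
        exact ⟨a, ha, s, rfl⟩
    rw [h1]
    have hc := hγ.continuous
    exact (hTt.isConnected.prod isConnected_univ).image _ (by fun_prop)
  have hScomm : ∀ x y : S, x * y = y * x := by
    rintro ⟨_, a, ha, s, rfl⟩ ⟨_, b, hb, t, rfl⟩
    apply Subtype.ext
    change a * γ s * (b * γ t) = b * γ t * (a * γ s)
    rw [hcc a ha s b hb t, hcc b hb t a ha s, hTt.mul_comm a ha b hb, add_comm]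
  have hS : IsTorus S.topologicalClosure ∧ S.topologicalClosure ≤ H := by
    refine ⟨⟨S.isClosed_topologicalClosure.isCompact, hSc.closure, fun a ha b hb => ?_⟩, ?_⟩
    · have h1 := (S.commGroupTopologicalClosure hScomm).mul_comm ⟨a, ha⟩ ⟨b, hb⟩
      exact congrArg Subtype.val h1
    · refine S.topologicalClosure_minimal ?_ hH
      rintro _ ⟨a, ha, s, rfl⟩
      exact H.mul_mem (hTH ha) (hγH s)
  exact hmax hS (fun a ha => S.le_topologicalClosure ⟨a, ha, 0, by simp [hγ.map_zero]⟩)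
    (S.le_topologicalClosure ⟨1, T.one_mem, t, by simp⟩)

end Tori

/-! ### The infinitesimal data of a symmetric pair and its maximal tori. -/

section Infinitesimal

variable {E : Type u} [NormedAddCommGroup E] [NormedSpace ℝ E] [FiniteDimensional ℝ E]
  {G : Type v} [TopologicalSpace G] [ChartedSpace E G] [Group G] [LieGroup 𝓘(ℝ, E) ∞ G]

namespace CompactTypePair

variable (S : CompactTypePair E G)

theorem isVelocity_σ {γ : ℝ → G} {X : GroupLieAlgebra 𝓘(ℝ, E) G} (h : IsVelocity γ X) :
    IsVelocity (fun t => S.σ (γ t)) (S.dσ X) := by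
  refine ⟨by simp [h.1], ?_⟩
  have h1 : ∀ g : G, g = 1 → HasMFDerivAt 𝓘(ℝ, E) 𝓘(ℝ, E) S.σ g
      (mfderiv 𝓘(ℝ, E) 𝓘(ℝ, E) S.σ (1 : G) : E →L[ℝ] E) := by
    rintro _ rfl
    exact (S.contMDiff_σ.mdifferentiableAt (by simp)).hasMFDerivAt
  refine ((h1 (γ 0) h.1).comp (0 : ℝ) h.2).congr_mfderiv ?_
  apply ContinuousLinearMap.ext
  intro (r : ℝ)
  exact ContinuousLinearMap.map_smul (mfderiv 𝓘(ℝ, E) 𝓘(ℝ, E) S.σ (1 : G) : E →L[ℝ] E) r (X : E)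

theorem dσ_eq (X : E) : S.dσ X = fderiv ℝ (fun x : E => lg (E := E) (S.σ (ex x))) 0 X := by
  have h := hasVelocity_ex (E := E) (G := G) X
  exact (isVelocity_iff.1 (S.isVelocity_σ (isVelocity_iff.2 h))).unique
    (h.map S.contMDiff_σ S.σ.map_one)

theorem dσ_dσ (X : GroupLieAlgebra 𝓘(ℝ, E) G) : S.dσ (S.dσ X) = X := by
  have h := isVelocity_iff.2 (hasVelocity_ex (E := E) (G := G) X)
  have h1 := S.isVelocity_σ (S.isVelocity_σ (X := X) h)
  simp only [S.σ_σ] at h1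
  exact (isVelocity_iff.1 h1).unique (isVelocity_iff.1 h)

/-- Since `σ` is a homomorphism, its differential intertwines `Ad g` with `Ad (σ g)`.
Differentiating this along a curve with velocity `X` gives the claim. -/
theorem dσ_lie (X Y : GroupLieAlgebra 𝓘(ℝ, E) G) : S.dσ ⁅X, Y⁆ = ⁅S.dσ X, S.dσ Y⁆ := by
  have hX := hasVelocity_ex (E := E) (G := G) X
  have hσX := isVelocity_iff.1 (S.isVelocity_σ (X := X) (isVelocity_iff.2 hX))
  set D : E →L[ℝ] E := fderiv ℝ (fun x : E => lg (E := E) (S.σ (ex x))) 0 with hD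
  have hAd : ∀ g : G, ∀ Z : E, D (Ad E g Z) = Ad E (S.σ g) (D Z) := by
    intro g Z
    have hZ := hasVelocity_ex (E := E) (G := G) Z
    have h1 := (hZ.conj g).map S.contMDiff_σ S.σ.map_one
    have h2 := (hZ.map S.contMDiff_σ S.σ.map_one).conj (S.σ g)
    simp only [map_mul, map_inv] at h1
    exact h1.unique h2
  have h1 := D.hasFDerivAt.comp_hasDerivAt (0 : ℝ) (HasVelocity.hasDerivAt_Ad_apply (E := E) hX Y)
  have h2 := hσX.hasDerivAt_Ad_apply (D Y)
  have h3 : D (bracketE E G X Y) = bracketE E G (S.dσ X) (D Y) :=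
    h1.unique (h2.congr_of_eventuallyEq (Eventually.of_forall fun t => hAd _ _))
  exact (S.dσ_eq _).trans (h3.trans (congrArg (bracketE E G (S.dσ X)) (S.dσ_eq Y).symm))

theorem eq_zero_of_forall_lie_eq_zero (S : CompactTypePair E G) {X : GroupLieAlgebra 𝓘(ℝ, E) G}
    (h : ∀ Y : GroupLieAlgebra 𝓘(ℝ, E) G, ⁅X, Y⁆ = 0) : X = 0 := by
  by_contra hX
  have h1 := S.killing_neg X hX
  have h2 : LieAlgebra.ad ℝ (GroupLieAlgebra 𝓘(ℝ, E) G) X = 0 := by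
    ext Y
    exact h Y
  rw [killingForm_apply_apply, h2] at h1
  simp at h1

theorem bracketE_injective (S : CompactTypePair E G) (X : E) (h : ∀ Y : E, bracketE E G X Y = 0) : X = 0 :=
  S.eq_zero_of_forall_lie_eq_zero (X := X) h

variable [CompactSpace G] [T2Space G]

/-- The curve `σ ∘ γ` has the same velocity, so it is `γ`. The image of `γ` is thus a connected set
of fixed points through `1`. -/
theorem oneParameter_mem_K (S : CompactTypePair E G) {γ : ℝ → G} {X : E} (hγ : IsOneParameter γ X) (hX : S.dσ X = X) (t : ℝ) :
    γ t ∈ S.K := by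
  have h1 := hγ.map S.contMDiff_σ
  rw [← S.dσ_eq, hX] at h1
  have h2 : ∀ t, S.σ (γ t) = γ t := congrFun (h1.unique S.bracketE_injective hγ)
  apply S.component_subset
  have h3 : IsPreconnected (range γ) := isPreconnected_range hγ.continuous
  refine h3.subset_connectedComponentIn ⟨0, hγ.map_zero⟩ ?_ (mem_range_self t)
  rintro _ ⟨s, rfl⟩
  exact h2 s

end CompactTypePair

namespace MaximalTori

variable {S : CompactTypePair E G} (T : MaximalTori E G S)

theorem dσ_of_mem_tk {X : GroupLieAlgebra 𝓘(ℝ, E) G} (hX : X ∈ T.tk) : S.dσ X = X := by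
  obtain ⟨γ, hγ, hγX⟩ := hX
  have h1 := S.isVelocity_σ hγX
  have h2 : (fun t => S.σ (γ t)) = γ :=
    funext fun t => S.σ_eq_of_mem _ (T.isMaximalTorus_TK.prop.2 (hγ t))
  rw [h2] at h1
  exact (isVelocity_iff.1 h1).unique (isVelocity_iff.1 hγX)

theorem lie_eq_zero_of_mem_tg {X Y : GroupLieAlgebra 𝓘(ℝ, E) G} (hX : X ∈ T.tg) (hY : Y ∈ T.tg) :
    ⁅X, Y⁆ = 0 := by
  obtain ⟨γ, hγ, hγX⟩ := (mem_lieAlg_iff (E := E)).1 hX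
  obtain ⟨δ, hδ, hδY⟩ := (mem_lieAlg_iff (E := E)).1 hY
  have hcomm := T.isMaximalTorus_TG.prop.1.mul_comm
  have h1 : ∀ t, Ad E (γ t) (Y : E) = (Y : E) := by
    intro t
    have h2 := hδY.conj (γ t)
    have h3 : (fun s => γ t * δ s * (γ t)⁻¹) = δ := by
      funext s
      rw [hcomm _ (hγ t) _ (hδ s), mul_inv_cancel_right]
    rw [h3] at h2
    exact h2.unique hδY
  have h2 := HasVelocity.hasDerivAt_Ad_apply (E := E) hγX Y
  simp only [h1] at h2
  exact h2.unique (hasDerivAt_const (0 : ℝ) _)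

variable [CompactSpace G] [T2Space G]

theorem mem_tg {X : GroupLieAlgebra 𝓘(ℝ, E) G} (h : ∀ Y ∈ T.tg, ⁅Y, X⁆ = 0) : X ∈ T.tg := by
  obtain ⟨γ, hγ⟩ := exists_isOneParameter (E := E) (G := G) X
  exact hγ.mem_lieAlg (T.isMaximalTorus_TG.oneParameter_mem S.bracketE_injective
    isClosed_univ h hγ fun t => Subgroup.mem_top _)

theorem mem_tk {X : GroupLieAlgebra 𝓘(ℝ, E) G} (hX : S.dσ X = X) (h : ∀ Y ∈ T.tk, ⁅Y, X⁆ = 0) :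
    X ∈ T.tk := by
  obtain ⟨γ, hγ⟩ := exists_isOneParameter (E := E) (G := G) X
  exact hγ.mem_lieAlg (T.isMaximalTorus_TK.oneParameter_mem S.bracketE_injective
    S.isClosed_K h hγ (S.oneParameter_mem_K hγ hX))

end MaximalTori

end Infinitesimal

/-! ### The complexification of a compact semisimple Lie algebra. -/

section Complexification

variable {𝔤 : Type*}

theorem exists_eq_tmul_add_tmul [AddCommGroup 𝔤] [Module ℝ 𝔤] (z : ℂ ⊗[ℝ] 𝔤) :
    ∃ x y : 𝔤, z = (1 : ℂ) ⊗ₜ[ℝ] x + Complex.I ⊗ₜ[ℝ] y := by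
  induction z using TensorProduct.induction_on with
  | zero => exact ⟨0, 0, by simp⟩
  | tmul c x =>
    refine ⟨c.re • x, c.im • x, ?_⟩
    rw [← TensorProduct.smul_tmul, ← TensorProduct.smul_tmul, ← TensorProduct.add_tmul]
    congr 1
    apply Complex.ext <;> simp
  | add z w hz hw =>
    obtain ⟨x, y, rfl⟩ := hz
    obtain ⟨x', y', rfl⟩ := hw
    exact ⟨x + x', y + y', by rw [TensorProduct.tmul_add, TensorProduct.tmul_add]; abel⟩

theorem tmul_add_tmul_eq_zero [AddCommGroup 𝔤] [Module ℝ 𝔤] {x y : 𝔤}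
    (h : (1 : ℂ) ⊗ₜ[ℝ] x + Complex.I ⊗ₜ[ℝ] y = 0) : x = 0 ∧ y = 0 := by
  have key : ∀ f : Module.Dual ℝ 𝔤, f x = 0 ∧ f y = 0 := by
    intro f
    have h1 := congrArg (TensorProduct.rid ℝ ℂ ∘ f.lTensor ℂ) h
    simp only [Function.comp_apply, map_add, LinearMap.lTensor_tmul, TensorProduct.rid_tmul,
      map_zero] at h1
    have h2 := congrArg Complex.re h1
    have h3 := congrArg Complex.im h1
    simp at h2 h3
    exact ⟨h2, h3⟩
  exact ⟨(Module.forall_dual_apply_eq_zero_iff ℝ x).1 fun f => (key f).1,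
    (Module.forall_dual_apply_eq_zero_iff ℝ y).1 fun f => (key f).2⟩

theorem tmul_add_tmul_inj [AddCommGroup 𝔤] [Module ℝ 𝔤] {x y x' y' : 𝔤}
    (h : (1 : ℂ) ⊗ₜ[ℝ] x + Complex.I ⊗ₜ[ℝ] y = (1 : ℂ) ⊗ₜ[ℝ] x' + Complex.I ⊗ₜ[ℝ] y') :
    x = x' ∧ y = y' := by
  have h1 : (1 : ℂ) ⊗ₜ[ℝ] (x - x') + Complex.I ⊗ₜ[ℝ] (y - y') = 0 := by
    rw [TensorProduct.tmul_sub, TensorProduct.tmul_sub]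
    rw [sub_add_sub_comm, h, sub_self]
  obtain ⟨h2, h3⟩ := tmul_add_tmul_eq_zero h1
  exact ⟨sub_eq_zero.1 h2, sub_eq_zero.1 h3⟩

variable [LieRing 𝔤] [LieAlgebra ℝ 𝔤] 

/-- The roots of a real Lie algebra with respect to a subspace `t`. -/
def rootsOf (t : Submodule ℝ 𝔤) : Set (Module.Dual ℝ t) :=
  {α | α ≠ 0 ∧ ∃ X : ℂ ⊗[ℝ] 𝔤, X ≠ 0 ∧
    ∀ W : t, ⁅(1 : ℂ) ⊗ₜ[ℝ] (W : 𝔤), X⁆ = (Complex.I * ((α W : ℝ) : ℂ)) • X}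

theorem lie_tmul_add_tmul (W x y : 𝔤) :
    ⁅(1 : ℂ) ⊗ₜ[ℝ] W, (1 : ℂ) ⊗ₜ[ℝ] x + Complex.I ⊗ₜ[ℝ] y⁆ =
      (1 : ℂ) ⊗ₜ[ℝ] ⁅W, x⁆ + Complex.I ⊗ₜ[ℝ] ⁅W, y⁆ := by
  have h := lie_add (L := ℂ ⊗[ℝ] 𝔤) (M := ℂ ⊗[ℝ] 𝔤) ((1 : ℂ) ⊗ₜ[ℝ] W) ((1 : ℂ) ⊗ₜ[ℝ] x) (Complex.I ⊗ₜ[ℝ] y)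
  refine h.trans ?_
  rw [LieAlgebra.ExtendScalars.bracket_tmul, LieAlgebra.ExtendScalars.bracket_tmul,
    one_mul, one_mul]

theorem killingForm_lie_self (W x : 𝔤) : killingForm ℝ 𝔤 ⁅W, x⁆ x = 0 := by
  have h := LieModule.traceForm_apply_lie_apply ℝ 𝔤 𝔤 W x x
  rw [lie_self, map_zero] at h
  exact h

theorem killingForm_lie_left (W x y : 𝔤) :
    killingForm ℝ 𝔤 ⁅W, x⁆ y = - killingForm ℝ 𝔤 x ⁅W, y⁆ := by
  have h := LieModule.traceForm_apply_lie_apply ℝ 𝔤 𝔤 x W y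
  rw [← lie_skew, map_neg, LinearMap.neg_apply]
  exact congrArg Neg.neg h

variable [Module.Finite ℝ 𝔤]

theorem killingForm_tmul (c d : ℂ) (x y : 𝔤) :
    killingForm ℂ (ℂ ⊗[ℝ] 𝔤) (c ⊗ₜ x) (d ⊗ₜ y) = c * d * (killingForm ℝ 𝔤 x y : ℂ) := by
  rw [killingForm, LieModule.traceForm_baseChange]
  refine (LinearMap.BilinForm.baseChange_tmul _ _ _ _ _).trans ?_
  rw [Complex.real_smul, mul_comm]

/-- The complexification of a compact semisimple Lie algebra has nondegenerate Killing form. -/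
theorem isKilling_complexification (hneg : ∀ X : 𝔤, X ≠ 0 → killingForm ℝ 𝔤 X X < 0) :
    LieAlgebra.IsKilling ℂ (ℂ ⊗[ℝ] 𝔤) := by
  refine ⟨?_⟩
  rw [eq_bot_iff]
  intro z hz
  rw [LieIdeal.mem_killingCompl] at hz
  obtain ⟨x, y, rfl⟩ := exists_eq_tmul_add_tmul z
  have key : ∀ w : 𝔤, killingForm ℝ 𝔤 w x = 0 ∧ killingForm ℝ 𝔤 w y = 0 := by
    intro w
    have h := hz ((1 : ℂ) ⊗ₜ w) (LieSubmodule.mem_top _)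
    rw [map_add, killingForm_tmul, killingForm_tmul] at h
    have h2 := congrArg Complex.re h
    have h3 := congrArg Complex.im h
    simp at h2 h3
    exact ⟨h2, h3⟩
  have hx : x = 0 := by
    by_contra h
    exact (hneg x h).ne (key x).1
  have hy : y = 0 := by
    by_contra h
    exact (hneg y h).ne (key y).2
  simp [hx, hy]

/-- The centralizer of `t` in the complexification. -/
def cartanOf (t : Submodule ℝ 𝔤) : LieSubalgebra ℂ (ℂ ⊗[ℝ] 𝔤) where
  carrier := {z | ∀ W ∈ t, ⁅(1 : ℂ) ⊗ₜ[ℝ] W, z⁆ = 0}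
  zero_mem' := fun W _ => lie_zero ((1 : ℂ) ⊗ₜ[ℝ] W)
  add_mem' := fun {a b} ha hb W hW =>
    (lie_add ((1 : ℂ) ⊗ₜ[ℝ] W) a b).trans (by rw [ha W hW, hb W hW, add_zero])
  smul_mem' := fun c a ha W hW =>
    (lie_smul c ((1 : ℂ) ⊗ₜ[ℝ] W) a).trans (by rw [ha W hW, smul_zero])
  lie_mem' := fun {a b} ha hb W hW =>
    (leibniz_lie ((1 : ℂ) ⊗ₜ[ℝ] W) a b).trans (by
      rw [ha W hW, hb W hW, zero_lie, zero_add]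
      exact lie_zero a)

theorem mem_cartanOf_iff {t : Submodule ℝ 𝔤} {x y : 𝔤} :
    (1 : ℂ) ⊗ₜ[ℝ] x + Complex.I ⊗ₜ[ℝ] y ∈ cartanOf t ↔
      (∀ W ∈ t, ⁅W, x⁆ = 0) ∧ ∀ W ∈ t, ⁅W, y⁆ = 0 := by
  constructor
  · intro h
    have key := fun W hW => tmul_add_tmul_eq_zero ((lie_tmul_add_tmul W x y).symm.trans (h W hW))
    exact ⟨fun W hW => (key W hW).1, fun W hW => (key W hW).2⟩
  · rintro ⟨hx, hy⟩ W hW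
    refine (lie_tmul_add_tmul W x y).trans ?_
    rw [hx W hW, hy W hW, TensorProduct.tmul_zero, TensorProduct.tmul_zero, add_zero]

variable {t : Submodule ℝ 𝔤}

/-- A self-centralizing abelian subspace. -/
structure IsMaximalAbelian (t : Submodule ℝ 𝔤) : Prop where
  lie_eq_zero : ∀ X ∈ t, ∀ Y ∈ t, ⁅X, Y⁆ = 0
  mem : ∀ X, (∀ Y ∈ t, ⁅Y, X⁆ = 0) → X ∈ t

theorem IsMaximalAbelian.tmul_mem (ht : IsMaximalAbelian t) {x y : 𝔤} (hx : x ∈ t) (hy : y ∈ t) :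
    (1 : ℂ) ⊗ₜ[ℝ] x + Complex.I ⊗ₜ[ℝ] y ∈ cartanOf t :=
  mem_cartanOf_iff.2 ⟨fun W hW => ht.lie_eq_zero W hW x hx, fun W hW => ht.lie_eq_zero W hW y hy⟩

theorem IsMaximalAbelian.exists_of_mem (ht : IsMaximalAbelian t) {z : ℂ ⊗[ℝ] 𝔤}
    (hz : z ∈ cartanOf t) :
    ∃ x ∈ t, ∃ y ∈ t, z = (1 : ℂ) ⊗ₜ[ℝ] x + Complex.I ⊗ₜ[ℝ] y := by
  obtain ⟨x, y, rfl⟩ := exists_eq_tmul_add_tmul z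
  obtain ⟨hx, hy⟩ := mem_cartanOf_iff.1 hz
  exact ⟨x, ht.mem x hx, y, ht.mem y hy, rfl⟩

theorem IsMaximalAbelian.lie_cartanOf (ht : IsMaximalAbelian t) {z w : ℂ ⊗[ℝ] 𝔤}
    (hz : z ∈ cartanOf t) (hw : w ∈ cartanOf t) : ⁅z, w⁆ = 0 := by
  obtain ⟨x, hx, y, hy, rfl⟩ := ht.exists_of_mem hz
  have h1 : ⁅Complex.I ⊗ₜ[ℝ] y, w⁆ = Complex.I • ⁅(1 : ℂ) ⊗ₜ[ℝ] y, w⁆ := by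
    have h := smul_lie Complex.I ((1 : ℂ) ⊗ₜ[ℝ] y) w
    rwa [TensorProduct.smul_tmul', smul_eq_mul, mul_one] at h
  rw [add_lie, h1, hw x hx, hw y hy, smul_zero, add_zero]

/-- `ad W` is skew for a definite form, so it has the same kernel as its square. -/
theorem lie_eq_zero_of_lie_lie (hneg : ∀ X : 𝔤, X ≠ 0 → killingForm ℝ 𝔤 X X < 0) {W x : 𝔤}
    (h : ⁅W, ⁅W, x⁆⁆ = 0) : ⁅W, x⁆ = 0 := by
  by_contra hne
  have h1 := killingForm_lie_left W x ⁅W, x⁆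
  rw [h, map_zero, neg_zero] at h1
  exact (hneg _ hne).ne h1

/-- The centralizer is abelian, hence nilpotent. An element `z` of its normalizer satisfies `[W, [W,
z]] = 0` for `W` in `t`, and skewness of `ad W` on real and imaginary parts gives `[W, z] = 0`. -/
theorem IsMaximalAbelian.isCartanSubalgebra (ht : IsMaximalAbelian t)
    (hneg : ∀ X : 𝔤, X ≠ 0 → killingForm ℝ 𝔤 X X < 0) : (cartanOf t).IsCartanSubalgebra := by
  have hab : IsLieAbelian (cartanOf t) :=
    ⟨fun z w => Subtype.ext (ht.lie_cartanOf z.2 w.2)⟩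
  refine ⟨inferInstance, le_antisymm (fun z hz => ?_) (LieSubalgebra.le_normalizer _)⟩
  obtain ⟨x, y, rfl⟩ := exists_eq_tmul_add_tmul z
  rw [LieSubalgebra.mem_normalizer_iff] at hz
  have key : ∀ W ∈ t, ⁅W, x⁆ = 0 ∧ ⁅W, y⁆ = 0 := by
    intro W hW
    have hW' : (1 : ℂ) ⊗ₜ[ℝ] W ∈ cartanOf t := by
      have := ht.tmul_mem hW t.zero_mem
      rwa [TensorProduct.tmul_zero, add_zero] at this
    have h1 := hz _ hW'
    rw [← lie_skew, neg_mem_iff, lie_tmul_add_tmul, mem_cartanOf_iff] at h1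
    exact ⟨lie_eq_zero_of_lie_lie hneg (h1.1 W hW), lie_eq_zero_of_lie_lie hneg (h1.2 W hW)⟩
  exact mem_cartanOf_iff.2 ⟨fun W hW => (key W hW).1, fun W hW => (key W hW).2⟩

/-- The element `1 ⊗ W` of the Cartan subalgebra. -/
noncomputable def IsMaximalAbelian.emb (ht : IsMaximalAbelian t) (W : t) : cartanOf t :=
  ⟨(1 : ℂ) ⊗ₜ[ℝ] (W : 𝔤), by
    have := ht.tmul_mem W.2 t.zero_mem
    rwa [TensorProduct.tmul_zero, add_zero] at this⟩

theorem IsMaximalAbelian.exists_eq_emb (ht : IsMaximalAbelian t) (h : cartanOf t) :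
    ∃ x y : t, h = ht.emb x + Complex.I • ht.emb y := by
  obtain ⟨x, hx, y, hy, hxy⟩ := ht.exists_of_mem h.2
  refine ⟨⟨x, hx⟩, ⟨y, hy⟩, Subtype.ext ?_⟩
  rw [hxy]
  change _ = (1 : ℂ) ⊗ₜ[ℝ] x + Complex.I • ((1 : ℂ) ⊗ₜ[ℝ] y)
  rw [TensorProduct.smul_tmul', smul_eq_mul, mul_one]

theorem IsMaximalAbelian.killingForm_emb (ht : IsMaximalAbelian t) (x y : t) :
    LieModule.traceForm ℂ (cartanOf t) (ℂ ⊗[ℝ] 𝔤) (ht.emb x) (ht.emb y) =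
      (killingForm ℝ 𝔤 (x : 𝔤) y : ℂ) := by
  have h := killingForm_tmul 1 1 (x : 𝔤) y
  rw [one_mul, one_mul] at h
  exact h

/-- The eigenvalues of `ad W` on the complexification are imaginary. -/
theorem eigenvalue_re_eq_zero (hneg : ∀ X : 𝔤, X ≠ 0 → killingForm ℝ 𝔤 X X < 0) {W : 𝔤}
    {X : ℂ ⊗[ℝ] 𝔤} (hX : X ≠ 0) {c : ℂ} (h : ⁅(1 : ℂ) ⊗ₜ[ℝ] W, X⁆ = c • X) : c.re = 0 := by
  obtain ⟨x, y, rfl⟩ := exists_eq_tmul_add_tmul X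
  have h1 : c • ((1 : ℂ) ⊗ₜ[ℝ] x + Complex.I ⊗ₜ[ℝ] y) =
      (1 : ℂ) ⊗ₜ[ℝ] (c.re • x - c.im • y) + Complex.I ⊗ₜ[ℝ] (c.im • x + c.re • y) := by
    rw [smul_add, TensorProduct.smul_tmul', TensorProduct.smul_tmul', TensorProduct.tmul_sub,
      TensorProduct.tmul_add, ← TensorProduct.smul_tmul, ← TensorProduct.smul_tmul,
      ← TensorProduct.smul_tmul, ← TensorProduct.smul_tmul]
    have h2 : (c • (1 : ℂ)) = c.re • (1 : ℂ) + c.im • Complex.I := by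
      apply Complex.ext <;> simp
    have h3 : c • Complex.I = c.re • Complex.I - c.im • (1 : ℂ) := by
      apply Complex.ext <;> simp
    rw [h2, h3, TensorProduct.add_tmul, TensorProduct.sub_tmul]
    abel
  rw [lie_tmul_add_tmul, h1] at h
  obtain ⟨hx, hy⟩ := tmul_add_tmul_inj h
  have h2 := killingForm_lie_self W x
  have h3 := killingForm_lie_self W y
  rw [hx] at h2
  rw [hy] at h3
  simp only [map_sub, map_add, map_smul, LinearMap.sub_apply, LinearMap.add_apply,
    LinearMap.smul_apply, smul_eq_mul] at h2 h3
  rw [LieModule.traceForm_comm ℝ 𝔤 𝔤 y x] at h2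
  -- Pairing `[W, x]` with `x` and `[W, y]` with `y` gives zero; in the sum the mixed terms with
  -- `c.im` cancel.
  have h4 : c.re * (killingForm ℝ 𝔤 x x + killingForm ℝ 𝔤 y y) = 0 := by linarith
  rcases mul_eq_zero.1 h4 with h5 | h5
  · exact h5
  · exfalso
    have hle : ∀ v : 𝔤, killingForm ℝ 𝔤 v v ≤ 0 := fun v => by
      by_cases hv : v = 0
      · simp [hv]
      · exact (hneg v hv).le
    have hx0 : x = 0 := by
      by_contra hv
      linarith [hneg x hv, hle y]
    have hy0 : y = 0 := by
      by_contra hv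
      linarith [hneg y hv, hle x]
    simp [hx0, hy0] at hX

end Complexification

/-! ### Real roots and their Cartan integers. -/

section RealRoots

variable {𝔤 : Type*} [LieRing 𝔤] [LieAlgebra ℝ 𝔤] [Module.Finite ℝ 𝔤] {t : Submodule ℝ 𝔤}

theorem exists_killing_representative
    (hneg : ∀ X : 𝔤, X ≠ 0 → killingForm ℝ 𝔤 X X < 0) (t : Submodule ℝ 𝔤) :
    ∃ H : Module.Dual ℝ t ≃ₗ[ℝ] t, ∀ α (W : t), α W = killingForm ℝ 𝔤 (W : 𝔤) (H α) := by
  let f : t →ₗ[ℝ] Module.Dual ℝ t :=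
    { toFun := fun X => (killingForm ℝ 𝔤 (X : 𝔤)).comp t.subtype
      map_add' := fun X Y => by ext; simp
      map_smul' := fun c X => by ext; simp }
  have hf : Function.Injective f := by
    rw [injective_iff_map_eq_zero]
    intro X hX
    by_contra h
    have h1 := hneg X fun h2 => h (Subtype.ext h2)
    have h2 : killingForm ℝ 𝔤 (X : 𝔤) X = 0 := LinearMap.congr_fun hX X
    exact h1.ne h2
  let e := LinearEquiv.ofInjectiveOfFinrankEq f hf Subspace.dual_finrank_eq.symm
  refine ⟨e.symm, fun α W => ?_⟩
  have h : f (e.symm α) = α := e.apply_symm_apply α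
  rw [LieModule.traceForm_comm]
  exact (LinearMap.congr_fun h W).symm

/-- A joint eigenvector of `t` is one of `t + i t`, which is the Cartan subalgebra. This and the
next lemma identify real roots `α` with nonzero weights `iα`. -/
theorem IsMaximalAbelian.exists_weight (ht : IsMaximalAbelian t)
    [LieRing.IsNilpotent (cartanOf t)]
    {α : Module.Dual ℝ t} (hα : α ∈ rootsOf t) :
    ∃ b : LieModule.Weight ℂ (cartanOf t) (ℂ ⊗[ℝ] 𝔤), b.IsNonZero ∧
      ∀ W, b (ht.emb W) = Complex.I * (α W : ℂ) := by
  obtain ⟨hα0, X, hX0, hX⟩ := hα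
  have hX' : ∀ W, ⁅ht.emb W, X⁆ = (Complex.I * (α W : ℂ)) • X := hX
  have h1 : ∀ h : cartanOf t, ∃ c : ℂ, ⁅h, X⁆ = c • X := by
    intro h
    obtain ⟨x, y, rfl⟩ := ht.exists_eq_emb h
    refine ⟨Complex.I * (α x : ℂ) + Complex.I * (Complex.I * (α y : ℂ)), ?_⟩
    rw [add_lie, smul_lie, hX', hX', smul_smul, ← add_smul]
  choose χ hχ using h1
  have hχ' : ∀ W, χ (ht.emb W) = Complex.I * (α W : ℂ) := fun W =>
    smul_left_injective ℂ hX0 ((hχ _).symm.trans (hX' W))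
  have hmem : X ∈ LieModule.genWeightSpace (ℂ ⊗[ℝ] 𝔤) χ := by
    rw [LieModule.mem_genWeightSpace]
    exact fun h => ⟨1, by simp [hχ h]⟩
  refine ⟨⟨χ, fun h => hX0 ?_⟩, fun h => hα0 ?_, hχ'⟩
  · rw [h] at hmem
    simpa using hmem
  · ext W
    have h2 : χ (ht.emb W) = 0 := congrFun h _
    rw [hχ'] at h2
    simpa using h2

theorem IsMaximalAbelian.exists_root (ht : IsMaximalAbelian t)
    (hneg : ∀ X : 𝔤, X ≠ 0 → killingForm ℝ 𝔤 X X < 0) [LieRing.IsNilpotent (cartanOf t)]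
    (b : LieModule.Weight ℂ (cartanOf t) (ℂ ⊗[ℝ] 𝔤)) (hb : b.IsNonZero) :
    ∃ α ∈ rootsOf t, ∀ W, b (ht.emb W) = Complex.I * (α W : ℂ) := by
  obtain ⟨X, hX0, hX⟩ := LieModule.exists_forall_lie_eq_smul ℂ (cartanOf t) (ℂ ⊗[ℝ] 𝔤) b
  let β : Module.Dual ℝ t :=
    { toFun := fun W => (b (ht.emb W)).im
      map_add' := fun W W' => by
        have h1 : ht.emb (W + W') = ht.emb W + ht.emb W' :=
          Subtype.ext (TensorProduct.tmul_add _ _ _)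
        rw [h1, ← Complex.add_im]
        exact congrArg Complex.im (map_add (b.toLinear ℂ (cartanOf t) (ℂ ⊗[ℝ] 𝔤)) _ _)
      map_smul' := fun c W => by
        have h1 : ht.emb (c • W) = (c : ℂ) • ht.emb W := by
          refine Subtype.ext ?_
          change (1 : ℂ) ⊗ₜ[ℝ] (c • (W : 𝔤)) = (c : ℂ) • ((1 : ℂ) ⊗ₜ[ℝ] (W : 𝔤))
          rw [← TensorProduct.smul_tmul, TensorProduct.smul_tmul']
          congr 1
        rw [h1]
        have h2 := map_smul (b.toLinear ℂ (cartanOf t) (ℂ ⊗[ℝ] 𝔤)) (c : ℂ) (ht.emb W)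
        have h3 := congrArg Complex.im h2
        rw [smul_eq_mul, Complex.im_ofReal_mul] at h3
        exact h3 }
  have hβ : ∀ W, b (ht.emb W) = Complex.I * (β W : ℂ) := by
    intro W
    have h1 := eigenvalue_re_eq_zero hneg hX0 (hX (ht.emb W))
    apply Complex.ext <;> simp [β, h1]
  refine ⟨β, ⟨fun h => hb ?_, X, hX0, fun W => ?_⟩, hβ⟩
  · funext h'
    obtain ⟨x, y, rfl⟩ := ht.exists_eq_emb h'
    have h2 := map_add (b.toLinear ℂ (cartanOf t) (ℂ ⊗[ℝ] 𝔤)) (ht.emb x) (Complex.I • ht.emb y)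
    rw [map_smul] at h2
    simp only [LieModule.Weight.toLinear_apply, hβ, h] at h2
    simpa using h2
  · rw [← hβ]
    exact hX (ht.emb W)

theorem IsMaximalAbelian.finite_rootsOf (ht : IsMaximalAbelian t)
    (hneg : ∀ X : 𝔤, X ≠ 0 → killingForm ℝ 𝔤 X X < 0) : (rootsOf t).Finite := by
  have := ht.isCartanSubalgebra hneg
  choose f hf0 hf using fun (α : rootsOf t) => ht.exists_weight α.2
  refine Set.finite_coe_iff.1 ?_
  refine Finite.of_injective f fun α β h => ?_
  ext W
  have h1 := hf α W
  rw [h, hf β W] at h1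
  have h2 := mul_left_cancel₀ Complex.I_ne_zero h1
  exact_mod_cast h2.symm

/-- In a Killing Lie algebra the weights have no common kernel in the Cartan subalgebra. -/
theorem IsMaximalAbelian.eq_zero_of_forall_root (ht : IsMaximalAbelian t)
    (hneg : ∀ X : 𝔤, X ≠ 0 → killingForm ℝ 𝔤 X X < 0) {W : t}
    (hW : ∀ α ∈ rootsOf t, α W = 0) : W = 0 := by
  have := ht.isCartanSubalgebra hneg
  have := isKilling_complexification hneg
  have h1 : ht.emb W ∈ ⨅ b : LieModule.Weight ℂ (cartanOf t) (ℂ ⊗[ℝ] 𝔤), b.ker := by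
    rw [Submodule.mem_iInf]
    intro b
    by_cases hb : b.IsZero
    · exact congrFun hb _
    · obtain ⟨α, hα, h2⟩ := ht.exists_root hneg b hb
      have h3 := h2 W
      rw [hW α hα, Complex.ofReal_zero, mul_zero] at h3
      exact h3
  rw [LieAlgebra.IsKilling.iInf_ker_weight_eq_bot] at h1
  have h2 : (1 : ℂ) ⊗ₜ[ℝ] (W : 𝔤) + Complex.I ⊗ₜ[ℝ] 0 = 0 := by
    have h3 := congrArg (Subtype.val) ((Submodule.mem_bot ℂ).1 h1)
    rw [TensorProduct.tmul_zero, add_zero]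
    exact h3
  exact Subtype.ext (tmul_add_tmul_eq_zero h2).1

theorem IsMaximalAbelian.exists_int (ht : IsMaximalAbelian t)
    (hneg : ∀ X : 𝔤, X ≠ 0 → killingForm ℝ 𝔤 X X < 0) {H : Module.Dual ℝ t → t}
    (hH : ∀ α (W : t), α W = killingForm ℝ 𝔤 (W : 𝔤) (H α)) {α β : Module.Dual ℝ t}
    (hα : α ∈ rootsOf t) (hβ : β ∈ rootsOf t) :
    ∃ n : ℤ, (n : ℝ) = 2 * β (H α) / α (H α) ∧ β - (n : ℝ) • α ∈ rootsOf t := by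
  have := ht.isCartanSubalgebra hneg
  have := isKilling_complexification hneg
  obtain ⟨a, ha0, ha⟩ := ht.exists_weight hα
  obtain ⟨b, hb0, hb⟩ := ht.exists_weight hβ
  -- The weight `iα` is represented by `i H_α`. The factor `i` enters twice in numerator and
  -- denominator of the Cartan number, so both signs change and the real quotient remains.
  have hta : (LieAlgebra.IsKilling.cartanEquivDual (cartanOf t)).symm
      (a.toLinear ℂ (cartanOf t) (ℂ ⊗[ℝ] 𝔤)) = Complex.I • ht.emb (H α) := by
    rw [LinearEquiv.symm_apply_eq]
    ext h
    obtain ⟨x, y, rfl⟩ := ht.exists_eq_emb h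
    have hx : ∀ x, LieModule.traceForm ℂ (cartanOf t) (ℂ ⊗[ℝ] 𝔤) (ht.emb (H α)) (ht.emb x) =
        (α x : ℂ) := by
      intro x
      rw [ht.killingForm_emb, LieModule.traceForm_comm, ← hH]
    rw [map_smul, LinearMap.smul_apply, map_add, map_add, map_smul, map_smul]
    have h1 : ∀ x, LieAlgebra.IsKilling.cartanEquivDual (cartanOf t) (ht.emb (H α)) (ht.emb x) =
        (α x : ℂ) := hx
    rw [h1, h1, LieModule.Weight.toLinear_apply, LieModule.Weight.toLinear_apply, ha, ha]
    simp only [smul_eq_mul]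
    ring
  have hbt : ∀ (c : LieModule.Weight ℂ (cartanOf t) (ℂ ⊗[ℝ] 𝔤)) (γ : Module.Dual ℝ t),
      (∀ W, c (ht.emb W) = Complex.I * (γ W : ℂ)) →
      c (Complex.I • ht.emb (H α)) = - (γ (H α) : ℂ) := by
    intro c γ hc
    have h1 := map_smul (c.toLinear ℂ (cartanOf t) (ℂ ⊗[ℝ] 𝔤)) Complex.I (ht.emb (H α))
    simp only [LieModule.Weight.toLinear_apply, hc, smul_eq_mul] at h1
    rw [h1, ← mul_assoc, Complex.I_mul_I, neg_one_mul]
  have hval : b (LieAlgebra.IsKilling.coroot a) = ((2 * β (H α) / α (H α) : ℝ) : ℂ) := by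
    have h1 := map_smul (b.toLinear ℂ (cartanOf t) (ℂ ⊗[ℝ] 𝔤))
      (2 * (a (Complex.I • ht.emb (H α)))⁻¹) (Complex.I • ht.emb (H α))
    have h2 : LieAlgebra.IsKilling.coroot a =
        (2 * (a (Complex.I • ht.emb (H α)))⁻¹) • (Complex.I • ht.emb (H α)) := by
      rw [LieAlgebra.IsKilling.coroot, hta, mul_smul, two_smul, two_smul]
    rw [← h2] at h1
    refine h1.trans ?_
    rw [LieModule.Weight.toLinear_apply, hbt a α ha, hbt b β hb, smul_eq_mul]
    push_cast
    rw [inv_neg]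
    ring
  obtain ⟨n, hn⟩ : ∃ n : ℤ, b (LieAlgebra.IsKilling.coroot a) = (n : ℂ) :=
    ⟨_, LieAlgebra.IsKilling.apply_coroot_eq_cast a b⟩
  obtain ⟨γ, hγ, hγ'⟩ := ht.exists_root hneg (LieAlgebra.IsKilling.reflectRoot a b)
    (LieAlgebra.IsKilling.reflectRoot_isNonZero a b hb0)
  refine ⟨n, by rw [hn] at hval; exact_mod_cast hval, ?_⟩
  convert hγ using 1
  ext W
  have h1 : b (ht.emb W) - b (LieAlgebra.IsKilling.coroot a) * a (ht.emb W) =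
      Complex.I * (γ W : ℂ) := hγ' W
  rw [ha, hb, hn] at h1
  have h2 : Complex.I * ((β W - n * α W : ℝ) : ℂ) = Complex.I * (γ W : ℂ) := by
    rw [← h1]
    push_cast
    ring
  have h3 := mul_left_cancel₀ Complex.I_ne_zero h2
  exact_mod_cast h3

end RealRoots

/-! ### Restricted roots of an involution. -/

section Restricted

variable {𝔤 : Type*} [LieRing 𝔤] [LieAlgebra ℝ 𝔤] [Module.Finite ℝ 𝔤]

/-- An involution `θ` of a compact semisimple Lie algebra, with a maximal abelian subspace `tk` of
its fixed space that is contained in a maximal abelian subspace `tg`. -/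
structure IsRestrictedPair (θ : 𝔤 →ₗ[ℝ] 𝔤) (tk tg : Submodule ℝ 𝔤) : Prop where
  neg : ∀ X : 𝔤, X ≠ 0 → killingForm ℝ 𝔤 X X < 0
  map_map : ∀ X, θ (θ X) = X
  map_lie : ∀ X Y, θ ⁅X, Y⁆ = ⁅θ X, θ Y⁆
  le : tk ≤ tg
  fixed : ∀ X ∈ tk, θ X = X
  isMaximalAbelian : IsMaximalAbelian tg
  mem_tk : ∀ X, θ X = X → (∀ Y ∈ tk, ⁅Y, X⁆ = 0) → X ∈ tk

namespace IsRestrictedPair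

variable {θ : 𝔤 →ₗ[ℝ] 𝔤} {tk tg : Submodule ℝ 𝔤}

theorem killingForm_map_map (D : IsRestrictedPair θ tk tg) (X Y : 𝔤) :
    killingForm ℝ 𝔤 (θ X) (θ Y) = killingForm ℝ 𝔤 X Y := by
  let e : 𝔤 ≃ₗ⁅ℝ⁆ 𝔤 :=
    { θ with
      map_lie' := fun {X Y} => D.map_lie X Y
      invFun := θ
      left_inv := D.map_map
      right_inv := D.map_map }
  exact LieAlgebra.killingForm_of_equiv_apply e X Y

theorem killingForm_map_left (D : IsRestrictedPair θ tk tg) (X Y : 𝔤) :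
    killingForm ℝ 𝔤 (θ X) Y = killingForm ℝ 𝔤 X (θ Y) := by
  rw [← D.killingForm_map_map X, D.map_map]

theorem map_half_add (D : IsRestrictedPair θ tk tg) (X : 𝔤) :
    θ ((2⁻¹ : ℝ) • (X + θ X)) = (2⁻¹ : ℝ) • (X + θ X) := by
  rw [map_smul, map_add, D.map_map, add_comm]

theorem lie_map_eq_zero (D : IsRestrictedPair θ tk tg) {X Y : 𝔤} (hY : Y ∈ tk)
    (h : ⁅Y, X⁆ = 0) : ⁅Y, θ X⁆ = 0 := by
  rw [← D.fixed Y hY, ← D.map_lie, h, map_zero]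

theorem half_add_mem (D : IsRestrictedPair θ tk tg) {X : 𝔤} (hX : ∀ Y ∈ tk, ⁅Y, X⁆ = 0) :
    (2⁻¹ : ℝ) • (X + θ X) ∈ tk := by
  refine D.mem_tk _ (D.map_half_add X) fun Y hY => ?_
  rw [lie_smul, lie_add, hX Y hY, D.lie_map_eq_zero hY (hX Y hY), add_zero, smul_zero]

/-- The maximal abelian subspace `tg` is the centralizer of `tk`. -/
theorem mem_tg_of_forall (D : IsRestrictedPair θ tk tg) {X : 𝔤} (hX : ∀ Y ∈ tk, ⁅Y, X⁆ = 0) :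
    X ∈ tg := by
  have hpart : ∀ Z : 𝔤, Z = (2⁻¹ : ℝ) • (Z + θ Z) + (2⁻¹ : ℝ) • (Z - θ Z) := by
    intro Z
    rw [← smul_add, add_add_sub_cancel, ← two_smul ℝ Z, smul_smul]
    norm_num
  have hneg : ∀ Z : 𝔤, θ ((2⁻¹ : ℝ) • (Z - θ Z)) = - ((2⁻¹ : ℝ) • (Z - θ Z)) := by
    intro Z
    rw [map_smul, map_sub, D.map_map, ← smul_neg, neg_sub]
  have hcent : ∀ Z : 𝔤, (∀ Y ∈ tk, ⁅Y, Z⁆ = 0) → ∀ Y ∈ tk, ⁅Y, (2⁻¹ : ℝ) • (Z - θ Z)⁆ = 0 := by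
    intro Z hZ Y hY
    rw [lie_smul, lie_sub, hZ Y hY, D.lie_map_eq_zero hY (hZ Y hY), sub_zero, smul_zero]
  have htg : ∀ Z ∈ tg, ∀ Y ∈ tk, ⁅Y, Z⁆ = 0 := fun Z hZ Y hY =>
    D.isMaximalAbelian.lie_eq_zero Y (D.le hY) Z hZ
  rw [hpart X]
  -- The `𝔨`-part of `X` commutes with `tk`, hence lies in it. It remains to show that the `𝔭`-part
  -- `P` commutes with `tg`.
  refine tg.add_mem (D.le (D.half_add_mem hX)) ?_
  have hPc := hcent X hX
  have hPn := hneg X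
  generalize (2⁻¹ : ℝ) • (X - θ X) = P at hPc hPn
  refine D.isMaximalAbelian.mem P fun Y hY => ?_
  rw [hpart Y, add_lie, hPc _ (D.half_add_mem (htg Y hY)), zero_add]
  have hQc := hcent Y (htg Y hY)
  have hQn := hneg Y
  generalize (2⁻¹ : ℝ) • (Y - θ Y) = Q at hQc hQn
  -- The bracket of two elements of `𝔭` lies in `𝔨`, and it commutes with `tk` by the Jacobi
  -- identity. Since `Q` commutes with `tk`, invariance then gives `⟨[Q, P], [Q, P]⟩ = -⟨P, [Q, [Q,
  -- P]]⟩ = 0`.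
  have hZ : ⁅Q, P⁆ ∈ tk := by
    refine D.mem_tk _ ?_ fun W hW => ?_
    · rw [D.map_lie, hPn, hQn, lie_neg, neg_lie, neg_neg]
    · rw [leibniz_lie, hQc W hW, hPc W hW, zero_lie, lie_zero, add_zero]
  by_contra h0
  have h1 := killingForm_lie_left Q P ⁅Q, P⁆
  rw [← lie_skew Q ⁅Q, P⁆, hQc _ hZ, neg_zero, map_zero, neg_zero] at h1
  exact (D.neg _ h0).ne h1

theorem map_mem (D : IsRestrictedPair θ tk tg) : ∀ X ∈ tg, θ X ∈ tg := fun X hX =>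
  D.mem_tg_of_forall fun Y hY =>
    D.lie_map_eq_zero hY (D.isMaximalAbelian.lie_eq_zero Y (D.le hY) X hX)

theorem half_add_mem_of_mem (D : IsRestrictedPair θ tk tg) {X : 𝔤} (hX : X ∈ tg) :
    (2⁻¹ : ℝ) • (X + θ X) ∈ tk :=
  D.half_add_mem fun Y hY => D.isMaximalAbelian.lie_eq_zero Y (D.le hY) X hX

/-- The complexification of `θ` carries a root vector of `α` to one of `α ∘ θ`. -/
theorem comp_mem_rootsOf (D : IsRestrictedPair θ tk tg) {α : Module.Dual ℝ tg}
    (hα : α ∈ rootsOf tg) : α ∘ₗ θ.restrict D.map_mem ∈ rootsOf tg := by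
  obtain ⟨h0, X, hX0, hX⟩ := hα
  have hθθ : ∀ W : tg, θ.restrict D.map_mem (θ.restrict D.map_mem W) = W := fun W =>
    Subtype.ext (D.map_map W)
  refine ⟨fun h => h0 ?_, ?_⟩
  · ext W
    have := LinearMap.congr_fun h (θ.restrict D.map_mem W)
    rwa [LinearMap.comp_apply, hθθ] at this
  obtain ⟨x, y, rfl⟩ := exists_eq_tmul_add_tmul X
  refine ⟨θ.baseChange ℂ ((1 : ℂ) ⊗ₜ[ℝ] x + Complex.I ⊗ₜ[ℝ] y), fun h => hX0 ?_, fun W => ?_⟩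
  · have h1 := congrArg (θ.baseChange ℂ) h
    simpa [D.map_map] using h1
  · have h1 := congrArg (θ.baseChange ℂ) (hX (θ.restrict D.map_mem W))
    rw [lie_tmul_add_tmul, map_smul] at h1
    refine Eq.trans ?_ h1
    simp only [map_add, LinearMap.baseChange_tmul, D.map_lie]
    refine (lie_tmul_add_tmul _ _ _).trans ?_
    simp [D.map_map]

/-- Roots do not vanish on `tk`. -/
theorem exists_ne_zero (D : IsRestrictedPair θ tk tg) {α : Module.Dual ℝ tg}
    (hα : α ∈ rootsOf tg) : ∃ W, ∃ hW : W ∈ tk, α ⟨W, D.le hW⟩ ≠ 0 := by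
  by_contra! h
  obtain ⟨h0, X, hX0, hX⟩ := hα
  obtain ⟨x, y, rfl⟩ := exists_eq_tmul_add_tmul X
  -- If `α` vanishes on `tk`, its root vector commutes with `tk` and so lies in the complexification
  -- of `tg`, on which `tg` acts by zero.
  have h1 : ∀ W ∈ tk, ⁅W, x⁆ = 0 ∧ ⁅W, y⁆ = 0 := by
    intro W hW
    have h2 := hX ⟨W, D.le hW⟩
    rw [h W hW, Complex.ofReal_zero, mul_zero, zero_smul] at h2
    exact tmul_add_tmul_eq_zero ((lie_tmul_add_tmul _ _ _).symm.trans h2)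
  have hx : x ∈ tg := D.mem_tg_of_forall fun W hW => (h1 W hW).1
  have hy : y ∈ tg := D.mem_tg_of_forall fun W hW => (h1 W hW).2
  apply h0
  ext W
  have h2 := (lie_tmul_add_tmul _ _ _).symm.trans (hX W)
  rw [D.isMaximalAbelian.lie_eq_zero _ W.2 _ hx, D.isMaximalAbelian.lie_eq_zero _ W.2 _ hy,
    TensorProduct.tmul_zero, TensorProduct.tmul_zero, add_zero] at h2
  have h3 := (smul_eq_zero.1 h2.symm).resolve_right hX0
  simpa using h3

variable {H : Module.Dual ℝ tg → tg}

theorem representative_unique (D : IsRestrictedPair θ tk tg)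
    (hH : ∀ α (W : tg), α W = killingForm ℝ 𝔤 (W : 𝔤) (H α)) {α : Module.Dual ℝ tg} {X : tg}
    (hX : ∀ W : tg, α W = killingForm ℝ 𝔤 (W : 𝔤) X) : H α = X := by
  by_contra hne
  refine (D.neg (H α - X : tg) fun h => hne (sub_eq_zero.1 (Subtype.ext h))).ne ?_
  rw [Submodule.coe_sub, map_sub, ← Submodule.coe_sub, ← hH, ← hX, sub_self]

theorem representative_comp (D : IsRestrictedPair θ tk tg)
    (hH : ∀ α (W : tg), α W = killingForm ℝ 𝔤 (W : 𝔤) (H α)) (α : Module.Dual ℝ tg) :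
    (H (α ∘ₗ θ.restrict D.map_mem) : 𝔤) = θ (H α) := by
  refine congrArg Subtype.val (D.representative_unique hH (X := θ.restrict D.map_mem (H α)) ?_)
  intro W
  rw [LinearMap.restrict_apply, ← D.killingForm_map_left]
  exact hH α (θ.restrict D.map_mem W)

theorem killingForm_half_add (D : IsRestrictedPair θ tk tg) (X : 𝔤) :
    killingForm ℝ 𝔤 ((2⁻¹ : ℝ) • (X + θ X)) ((2⁻¹ : ℝ) • (X + θ X)) =
      (killingForm ℝ 𝔤 X X + killingForm ℝ 𝔤 X (θ X)) / 2 := by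
  simp only [map_smul, map_add, LinearMap.smul_apply, LinearMap.add_apply, smul_eq_mul,
    D.killingForm_map_map, D.killingForm_map_left]
  ring

theorem killingForm_half_sub (D : IsRestrictedPair θ tk tg) (X : 𝔤) :
    killingForm ℝ 𝔤 ((2⁻¹ : ℝ) • (X - θ X)) ((2⁻¹ : ℝ) • (X - θ X)) =
      (killingForm ℝ 𝔤 X X - killingForm ℝ 𝔤 X (θ X)) / 2 := by
  simp only [map_smul, map_sub, LinearMap.smul_apply, LinearMap.sub_apply, smul_eq_mul,
    D.killingForm_map_map, D.killingForm_map_left]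
  ring

theorem killingForm_of_mem_tk (D : IsRestrictedPair θ tk tg) {W : 𝔤} (hW : W ∈ tk) (X : 𝔤) :
    killingForm ℝ 𝔤 W ((2⁻¹ : ℝ) • (X + θ X)) = killingForm ℝ 𝔤 W X := by
  rw [map_smul, map_add, ← D.killingForm_map_left, D.fixed W hW, smul_eq_mul]
  ring

/-- The sum is `2 |H_α^𝔨|²`, and `H_α^𝔨 ≠ 0` because `α` does not vanish on `tk`. -/
theorem add_neg (D : IsRestrictedPair θ tk tg)
    (hH : ∀ α (W : tg), α W = killingForm ℝ 𝔤 (W : 𝔤) (H α)) {α : Module.Dual ℝ tg}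
    (hα : α ∈ rootsOf tg) :
    killingForm ℝ 𝔤 (H α : 𝔤) (H α) + killingForm ℝ 𝔤 (H α : 𝔤) (θ (H α)) < 0 := by
  have h1 := D.killingForm_half_add (H α)
  have h2 : (2⁻¹ : ℝ) • ((H α : 𝔤) + θ (H α)) ≠ 0 := by
    intro h
    obtain ⟨W, hW, hne⟩ := D.exists_ne_zero hα
    rw [hH, ← D.killingForm_of_mem_tk hW, h, map_zero] at hne
    exact hne rfl
  linarith [D.neg _ h2]

/-- The possible positions of a root relative to its image under the involution. -/
theorem dichotomy (D : IsRestrictedPair θ tk tg)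
    (hH : ∀ α (W : tg), α W = killingForm ℝ 𝔤 (W : 𝔤) (H α)) {α : Module.Dual ℝ tg}
    (hα : α ∈ rootsOf tg) (hne : α ∘ₗ θ.restrict D.map_mem ≠ α) :
    killingForm ℝ 𝔤 (H α : 𝔤) (θ (H α)) = 0 ∨
      (2 * killingForm ℝ 𝔤 (H α : 𝔤) (θ (H α)) = - killingForm ℝ 𝔤 (H α : 𝔤) (H α) ∧
        α + α ∘ₗ θ.restrict D.map_mem ∈ rootsOf tg) := by
  have h1 := D.add_neg hH hα
  have h2 : killingForm ℝ 𝔤 (H α : 𝔤) (H α) - killingForm ℝ 𝔤 (H α : 𝔤) (θ (H α)) < 0 := by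
    have h3 := D.killingForm_half_sub (H α)
    have h4 : (2⁻¹ : ℝ) • ((H α : 𝔤) - θ (H α)) ≠ 0 := by
      intro h
      apply hne
      ext W
      have h5 : (H α : 𝔤) = θ (H α) := by
        rw [smul_eq_zero] at h
        exact sub_eq_zero.1 (h.resolve_left (by norm_num))
      rw [hH, hH, D.representative_comp hH, ← h5]
    linarith [D.neg _ h4]
  obtain ⟨n, hn, hγ⟩ := D.isMaximalAbelian.exists_int D.neg hH hα (D.comp_mem_rootsOf hα)
  have ha : α (H α) = killingForm ℝ 𝔤 (H α : 𝔤) (H α) := hH _ _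
  have hb : (α ∘ₗ θ.restrict D.map_mem) (H α) = killingForm ℝ 𝔤 (H α : 𝔤) (θ (H α)) := by
    rw [hH, D.representative_comp hH]
  rw [ha, hb] at hn
  set a := killingForm ℝ 𝔤 (H α : 𝔤) (H α)
  set b := killingForm ℝ 𝔤 (H α : 𝔤) (θ (H α))
  have ha0 : a < 0 := by linarith
  rw [eq_div_iff ha0.ne] at hn
  -- The bounds `a + b < 0` and `a - b < 0` express that the `𝔨`- and `𝔭`-parts of `H α` are
  -- nonzero. With `n a = 2 b` and `a < 0` they give `|n| < 2`.
  have hn1 : -2 < n := by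
    have : (-2 : ℝ) < n := by
      by_contra! h
      nlinarith
    exact_mod_cast this
  have hn2 : n < 2 := by
    have : (n : ℝ) < 2 := by
      by_contra! h
      nlinarith
    exact_mod_cast this
  have hcases : n = -1 ∨ n = 0 ∨ n = 1 := by omega
  rcases hcases with rfl | rfl | rfl
  · right
    have h3 : α ∘ₗ θ.restrict D.map_mem - ((-1 : ℤ) : ℝ) • α = α + α ∘ₗ θ.restrict D.map_mem := by
      ext W
      simp [add_comm]
    rw [h3] at hγ
    push_cast at hn
    exact ⟨by linarith, hγ⟩
  · left
    push_cast at hn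
    linarith
  -- Here `α ∘ θ - α` would be a root, but it vanishes on `tk`, where `θ` is the identity.
  · exfalso
    obtain ⟨W, hW, hne'⟩ := D.exists_ne_zero hγ
    apply hne'
    push_cast
    have h5 : θ.restrict D.map_mem ⟨W, D.le hW⟩ = ⟨W, D.le hW⟩ := Subtype.ext (D.fixed W hW)
    rw [one_smul, LinearMap.sub_apply, LinearMap.comp_apply, h5, sub_self]

/-- Integrality and reflections for restricted roots. -/
theorem exists_int (D : IsRestrictedPair θ tk tg)
    (hH : ∀ α (W : tg), α W = killingForm ℝ 𝔤 (W : 𝔤) (H α)) {α β : Module.Dual ℝ tg}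
    (hα : α ∈ rootsOf tg) (hβ : β ∈ rootsOf tg) :
    ∃ n : ℤ, (n : ℝ) * killingForm ℝ 𝔤 ((2⁻¹ : ℝ) • ((H α : 𝔤) + θ (H α)))
        ((2⁻¹ : ℝ) • ((H α : 𝔤) + θ (H α))) =
        2 * killingForm ℝ 𝔤 ((2⁻¹ : ℝ) • ((H α : 𝔤) + θ (H α))) (H β) ∧
      ∃ γ ∈ rootsOf tg, ∀ W, ∀ hW : W ∈ tk,
        γ ⟨W, D.le hW⟩ = β ⟨W, D.le hW⟩ - n * α ⟨W, D.le hW⟩ := by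
  have h1 := D.add_neg hH hα
  have hτ := D.comp_mem_rootsOf hα
  have hHτ : H (α ∘ₗ θ.restrict D.map_mem) = θ.restrict D.map_mem (H α) :=
    Subtype.ext (D.representative_comp hH α)
  have hfix : ∀ W, ∀ hW : W ∈ tk, θ.restrict D.map_mem ⟨W, D.le hW⟩ = ⟨W, D.le hW⟩ :=
    fun W hW => Subtype.ext (D.fixed W hW)
  have hk : killingForm ℝ 𝔤 ((2⁻¹ : ℝ) • ((H α : 𝔤) + θ (H α))) (H β) =
      (β (H α) + β (θ.restrict D.map_mem (H α))) / 2 := by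
    rw [hH β, hH β]
    simp only [map_smul, map_add, LinearMap.smul_apply, LinearMap.add_apply, smul_eq_mul,
      LinearMap.restrict_apply]
    ring
  rw [D.killingForm_half_add, hk]
  have ha : α (H α) = killingForm ℝ 𝔤 (H α : 𝔤) (H α) := hH _ _
  -- If `α ∘ θ = α`, then `H_α` is its own `𝔨`-part, and the reflection in `α` itself restricts as
  -- required.
  by_cases hne : α ∘ₗ θ.restrict D.map_mem = α
  · obtain ⟨n, hn, hγ⟩ := D.isMaximalAbelian.exists_int D.neg hH hα hβ
    rw [hne] at hHτ
    have h2 : (θ (H α) : 𝔤) = H α := congrArg Subtype.val hHτ.symm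
    rw [← hHτ]
    rw [h2] at h1 ⊢
    rw [ha, eq_div_iff (by linarith)] at hn
    exact ⟨n, by linarith, _, hγ, fun W hW => rfl⟩
  · rcases D.dichotomy hH hα hne with h0 | ⟨h0, hδ⟩
    -- Orthogonal case: `β` is reflected in `α` and then in `α ∘ θ`. Both restrict to the same form,
    -- so the coefficients add, and `|H_α^𝔨|² = |H_α|²/2` matches `n + m`.
    · rw [h0] at h1 ⊢
      obtain ⟨n, hn, hγ⟩ := D.isMaximalAbelian.exists_int D.neg hH hα hβ
      obtain ⟨m, hm, hγ'⟩ := D.isMaximalAbelian.exists_int D.neg hH hτ hγ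
      have h2 : α (θ.restrict D.map_mem (H α)) = 0 := by
        rw [hH, LinearMap.restrict_apply, LieModule.traceForm_comm]
        exact h0
      have h3 : (α ∘ₗ θ.restrict D.map_mem) (θ.restrict D.map_mem (H α)) = α (H α) :=
        congrArg α (Subtype.ext (D.map_map _))
      rw [hHτ, h3, LinearMap.sub_apply, LinearMap.smul_apply, h2, smul_zero, sub_zero, ha,
        eq_div_iff (by linarith)] at hm
      rw [ha, eq_div_iff (by linarith)] at hn
      refine ⟨n + m, by push_cast; linarith, _, hγ', fun W hW => ?_⟩
      simp only [LinearMap.sub_apply, LinearMap.smul_apply, LinearMap.comp_apply, hfix W hW,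
        smul_eq_mul]
      push_cast
      ring
    -- Second case: the root `α + α ∘ θ` restricts to twice the restriction of `α` and is
    -- represented by `2 H_α^𝔨`. Hence its reflection has coefficient `2 n` with respect to `α`.
    · obtain ⟨n, hn, hγ⟩ := D.isMaximalAbelian.exists_int D.neg hH hδ hβ
      have h2 : H (α + α ∘ₗ θ.restrict D.map_mem) = H α + θ.restrict D.map_mem (H α) := by
        refine D.representative_unique hH fun W => ?_
        rw [← hHτ, Submodule.coe_add, map_add, ← hH, ← hH, LinearMap.add_apply]
      have h3 : (α + α ∘ₗ θ.restrict D.map_mem) (H α + θ.restrict D.map_mem (H α)) =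
          killingForm ℝ 𝔤 (H α : 𝔤) (H α) := by
        have h4 : α (θ.restrict D.map_mem (H α)) = killingForm ℝ 𝔤 (H α : 𝔤) (θ (H α)) := by
          rw [hH, LinearMap.restrict_apply, LieModule.traceForm_comm]
        have h3 : α (θ.restrict D.map_mem (θ.restrict D.map_mem (H α))) = α (H α) :=
          congrArg α (Subtype.ext (D.map_map _))
        simp only [LinearMap.add_apply, LinearMap.comp_apply, map_add, h3, h4, ha]
        linarith
      rw [h2, h3, map_add, eq_div_iff (by linarith)] at hn
      refine ⟨2 * n, ?_, _, hγ, fun W hW => ?_⟩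
      · push_cast
        rw [show killingForm ℝ 𝔤 (H α : 𝔤) (θ (H α)) =
          - killingForm ℝ 𝔤 (H α : 𝔤) (H α) / 2 by linarith]
        linarith
      · simp only [LinearMap.sub_apply, LinearMap.add_apply, LinearMap.smul_apply,
          LinearMap.comp_apply, hfix W hW, smul_eq_mul]
        push_cast
        ring

/-- The restriction of a linear form on `tg` to `tk`. -/
def restrict (D : IsRestrictedPair θ tk tg) (α : Module.Dual ℝ tg) : Module.Dual ℝ tk :=
  α.comp (Submodule.inclusion D.le)

/-- An element of `tk` annihilated by the span is annihilated by all roots, hence zero. -/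
theorem span_restrict (D : IsRestrictedPair θ tk tg) :
    Submodule.span ℝ (D.restrict '' rootsOf tg) = ⊤ := by
  have h : (Submodule.span ℝ (D.restrict '' rootsOf tg)).dualCoannihilator = ⊥ := by
    rw [eq_bot_iff]
    intro W hW
    rw [Submodule.mem_dualCoannihilator] at hW
    have h1 : Submodule.inclusion D.le W = 0 :=
      D.isMaximalAbelian.eq_zero_of_forall_root D.neg fun α hα =>
        hW _ (Submodule.subset_span ⟨α, hα, rfl⟩)
    exact Submodule.inclusion_injective D.le (h1.trans (map_zero _).symm)
  rw [← Subspace.dualCoannihilator_dualAnnihilator_eq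
    (W := Submodule.span ℝ (D.restrict '' rootsOf tg)), h, Submodule.dualAnnihilator_bot]

/-- The restricted roots form a root system. -/
theorem exists_rootPairing (D : IsRestrictedPair θ tk tg)
    (hH : ∀ α (W : tg), α W = killingForm ℝ 𝔤 (W : 𝔤) (H α)) :
    ∃ P : RootPairing (D.restrict '' rootsOf tg) ℝ (Module.Dual ℝ tk) tk,
      (∀ φ X, P.toLinearMap φ X = φ X) ∧ (∀ φ, P.root φ = φ) ∧
      P.IsRootSystem ∧ P.IsCrystallographic ∧
      ∀ (φ : D.restrict '' rootsOf tg) (α : Module.Dual ℝ tg), α ∈ rootsOf tg →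
        D.restrict α = φ → (P.coroot φ : 𝔤) =
          (2 / killingForm ℝ 𝔤 ((2⁻¹ : ℝ) • ((H α : 𝔤) + θ (H α)))
            ((2⁻¹ : ℝ) • ((H α : 𝔤) + θ (H α)))) • ((2⁻¹ : ℝ) • ((H α : 𝔤) + θ (H α))) := by
  obtain ⟨h, hh⟩ := exists_killing_representative D.neg tk
  have hrep : ∀ α, (h (D.restrict α) : 𝔤) = (2⁻¹ : ℝ) • ((H α : 𝔤) + θ (H α)) := by
    intro α
    have hm := D.half_add_mem_of_mem (H α).2
    by_contra hne
    refine (D.neg _ (sub_ne_zero.2 hne)).ne ?_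
    have h1 : ∀ W : tk, killingForm ℝ 𝔤 (W : 𝔤)
        (h (D.restrict α) - (2⁻¹ : ℝ) • ((H α : 𝔤) + θ (H α))) = 0 := by
      intro W
      rw [map_sub, ← hh, D.killingForm_of_mem_tk W.2, sub_eq_zero]
      exact hH α (Submodule.inclusion D.le W)
    exact h1 ⟨_, tk.sub_mem (h _).2 hm⟩
  have hne : ∀ φ : D.restrict '' rootsOf tg, killingForm ℝ 𝔤 (h φ : 𝔤) (h φ) < 0 := by
    rintro ⟨_, α, hα, rfl⟩
    refine D.neg _ fun h0 => ?_
    obtain ⟨W, hW, hne⟩ := D.exists_ne_zero hα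
    have h1 := hh (D.restrict α) ⟨W, hW⟩
    rw [h0, map_zero] at h1
    exact hne h1
  have key : ∀ φ ψ : D.restrict '' rootsOf tg, ∃ n : ℤ,
      (n : ℝ) = (ψ : Module.Dual ℝ tk) ((2 / killingForm ℝ 𝔤 (h φ : 𝔤) (h φ)) • h φ) ∧
      (ψ : Module.Dual ℝ tk) - (n : ℝ) • (φ : Module.Dual ℝ tk) ∈ D.restrict '' rootsOf tg := by
    rintro ⟨_, α, hα, rfl⟩ ⟨_, β, hβ, rfl⟩
    have hlt := hne ⟨_, α, hα, rfl⟩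
    obtain ⟨n, hn, γ, hγ, hγ'⟩ := D.exists_int hH hα hβ
    rw [← hrep] at hn
    refine ⟨n, ?_, γ, hγ, ?_⟩
    · have h1 : D.restrict β (h (D.restrict α)) =
          killingForm ℝ 𝔤 (h (D.restrict α) : 𝔤) (H β) := hH β (Submodule.inclusion D.le _)
      rw [map_smul, smul_eq_mul, h1, div_mul_eq_mul_div, ← hn]
      exact (mul_div_cancel_right₀ _ hlt.ne).symm
    · ext W
      exact hγ' W W.2
  let root : (D.restrict '' rootsOf tg) ↪ Module.Dual ℝ tk := Function.Embedding.subtype _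
  let coroot : (D.restrict '' rootsOf tg) ↪ tk :=
    { toFun := fun φ => (2 / killingForm ℝ 𝔤 (h φ : 𝔤) (h φ)) • h φ
      inj' := by
        intro φ ψ hφψ
        -- The map `x ↦ 2 x / |x|²` is an involution on vectors with `|x|² ≠ 0`, so a coroot
        -- determines its root.
        have hval : ∀ φ : D.restrict '' rootsOf tg, (h φ : tk) =
            (2 / killingForm ℝ 𝔤
              ((2 / killingForm ℝ 𝔤 (h φ : 𝔤) (h φ)) • h φ : tk)
              ((2 / killingForm ℝ 𝔤 (h φ : 𝔤) (h φ)) • h φ : tk)) •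
              ((2 / killingForm ℝ 𝔤 (h φ : 𝔤) (h φ)) • h φ) := by
          intro φ
          have h1 := (hne φ).ne
          rw [smul_smul, Submodule.coe_smul, map_smul, map_smul, LinearMap.smul_apply]
          refine (one_smul ℝ _).symm.trans (congrArg (fun c : ℝ => c • (h φ : tk)) ?_)
          simp only [smul_eq_mul]
          field_simp
        have h2 := hval φ
        simp only at hφψ
        rw [hφψ, ← hval ψ] at h2
        exact Subtype.ext (h.injective h2) }
  have hp : ∀ φ, (LinearMap.id : Module.Dual ℝ tk →ₗ[ℝ] _) (root φ) (coroot φ) = 2 := by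
    intro φ
    change (φ : Module.Dual ℝ tk) ((2 / killingForm ℝ 𝔤 (h φ : 𝔤) (h φ)) • h φ) = 2
    rw [map_smul, hh, smul_eq_mul, div_mul_cancel₀ _ (hne φ).ne]
  have hs : ∀ φ, MapsTo (Module.preReflection (root φ)
      ((LinearMap.id : Module.Dual ℝ tk →ₗ[ℝ] _).flip (coroot φ))) (range root) (range root) := by
    rintro φ _ ⟨ψ, rfl⟩
    obtain ⟨n, hn, hmem⟩ := key φ ψ
    refine ⟨⟨_, hmem⟩, ?_⟩
    rw [Module.preReflection_apply]
    change _ = (ψ : Module.Dual ℝ tk) -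
      ((ψ : Module.Dual ℝ tk) ((2 / killingForm ℝ 𝔤 (h φ : 𝔤) (h φ)) • h φ)) •
        (φ : Module.Dual ℝ tk)
    rw [← hn]
    rfl
  have hsp : Submodule.span ℝ (range root) = ⊤ := by
    have h1 : range root = D.restrict '' rootsOf tg := Subtype.range_coe
    rw [h1, D.span_restrict]
  have hint : ∀ φ ψ, ∃ z : ℤ, (z : ℝ) =
      (LinearMap.id : Module.Dual ℝ tk →ₗ[ℝ] _) (root φ) (coroot ψ) := by
    intro φ ψ
    obtain ⟨n, hn, -⟩ := key ψ φ
    exact ⟨n, hn⟩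
  have hfin : Finite (D.restrict '' rootsOf tg) :=
    ((D.isMaximalAbelian.finite_rootsOf D.neg).image _).to_subtype
  refine ⟨RootPairing.mk'' LinearMap.id root coroot hp hs hsp, fun _ _ => rfl, fun _ => rfl,
    RootPairing.isRootSystem_mk'' hint, ⟨hint⟩, ?_⟩
  rintro φ α hα hφ
  change (((2 / killingForm ℝ 𝔤 (h φ : 𝔤) (h φ)) • h φ : tk) : 𝔤) = _
  rw [Submodule.coe_smul, ← hφ, hrep]

end IsRestrictedPair

end Restricted

/-! ### The root system of a symmetric pair. -/

section Assembly

variable {E : Type u} [NormedAddCommGroup E] [NormedSpace ℝ E] [FiniteDimensional ℝ E]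
  {G : Type v} [TopologicalSpace G] [ChartedSpace E G] [Group G] [LieGroup 𝓘(ℝ, E) ∞ G]
  [T2Space G] [CompactSpace G] {S : CompactTypePair E G}

theorem MaximalTori.isRestrictedPair (T : MaximalTori E G S) :
    IsRestrictedPair S.dσ T.tk T.tg where
  neg := S.killing_neg
  map_map := S.dσ_dσ
  map_lie := S.dσ_lie
  le := T.tk_le_tg
  fixed := fun _ => T.dσ_of_mem_tk
  isMaximalAbelian :=
    ⟨fun _ hX _ hY => T.lie_eq_zero_of_mem_tg hX hY, fun _ h => T.mem_tg h⟩
  mem_tk := fun _ hX h => T.mem_tk hX h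

theorem rootSystem_of_restrictedRoots (S : CompactTypePair E G) (T : MaximalTori E G S) :
      ∃ (hσ : ∀ X ∈ T.tg, S.dσ X ∈ T.tg) (H : Module.Dual ℝ T.tg → T.tg),
        (∀ (α : Module.Dual ℝ T.tg) (W : T.tg),
          α W = killingForm ℝ (GroupLieAlgebra 𝓘(ℝ, E) G) W (H α)) ∧
        (∀ α ∈ SymPair.roots T.tg, α ∘ₗ S.dσ.restrict hσ ≠ α →
          (killingForm ℝ (GroupLieAlgebra 𝓘(ℝ, E) G) (H α) (H (α ∘ₗ S.dσ.restrict hσ)) = 0 ∧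
            killingForm ℝ (GroupLieAlgebra 𝓘(ℝ, E) G) (S.pPart (H α)) (S.pPart (H α)) =
              killingForm ℝ (GroupLieAlgebra 𝓘(ℝ, E) G) (S.kPart (H α)) (S.kPart (H α))) ∨
          (2 * (killingForm ℝ (GroupLieAlgebra 𝓘(ℝ, E) G) (H α) (H (α ∘ₗ S.dσ.restrict hσ)) /
              killingForm ℝ (GroupLieAlgebra 𝓘(ℝ, E) G) (H α) (H α)) = -1 ∧
            killingForm ℝ (GroupLieAlgebra 𝓘(ℝ, E) G) (S.pPart (H α)) (S.pPart (H α)) =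
              3 * killingForm ℝ (GroupLieAlgebra 𝓘(ℝ, E) G) (S.kPart (H α)) (S.kPart (H α)) ∧
            α + α ∘ₗ S.dσ.restrict hσ ∈ SymPair.roots T.tg)) ∧
        T.restrictedRoots.Finite ∧
        ∃ P : RootPairing T.restrictedRoots ℝ (Module.Dual ℝ T.tk) T.tk,
          (∀ φ X, P.toLinearMap φ X = φ X) ∧
          (∀ φ, P.root φ = φ) ∧
          P.IsRootSystem ∧ P.IsCrystallographic ∧
          ∀ (φ : T.restrictedRoots) (α : Module.Dual ℝ T.tg), α ∈ SymPair.roots T.tg →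
            T.restrict α = φ →
            (P.coroot φ : GroupLieAlgebra 𝓘(ℝ, E) G) =
              (2 / killingForm ℝ (GroupLieAlgebra 𝓘(ℝ, E) G) (S.kPart (H α)) (S.kPart (H α))) •
                S.kPart (H α) := by
  have D := T.isRestrictedPair
  have : Module.Finite ℝ (GroupLieAlgebra 𝓘(ℝ, E) G) := ‹FiniteDimensional ℝ E›
  obtain ⟨H, hH⟩ := exists_killing_representative D.neg T.tg
  refine ⟨D.map_mem, H, hH, ?_, (D.isMaximalAbelian.finite_rootsOf D.neg).image _,
    D.exists_rootPairing hH⟩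
  intro α hα hne
  have hk : killingForm ℝ (GroupLieAlgebra 𝓘(ℝ, E) G) (S.kPart (H α)) (S.kPart (H α)) = _ :=
    D.killingForm_half_add (H α)
  have hp : killingForm ℝ (GroupLieAlgebra 𝓘(ℝ, E) G) (S.pPart (H α)) (S.pPart (H α)) = _ :=
    D.killingForm_half_sub (H α)
  have hlt := D.add_neg hH hα
  rw [D.representative_comp hH, hk, hp]
  rcases D.dichotomy hH hα hne with h | ⟨h, hδ⟩
  · exact Or.inl ⟨h, by rw [h]; ring⟩
  · refine Or.inr ⟨?_, by linarith, hδ⟩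
    rw [← mul_div_assoc, h, neg_div, div_self]
    linarith

end Assembly

/-! ### Lie group structures on linear groups with exponential coordinates. -/

section LinearGroups

/-- An embedding `ι` of a topological group `G` into a normed algebra `A`, with a smooth
parametrization `η` of a neighbourhood of the identity that is defined on all of `V` and whose local
inverse `Λ` extends to a smooth map on an open subset of `A`. -/
class ExpModel (A V : outParam Type*) (G : Type*) [NormedRing A] [NormedAlgebra ℝ A]
    [NormedAddCommGroup V] [NormedSpace ℝ V] [Group G] [TopologicalSpace G] where
  /-- the embedding -/
  ι : G →* A
  isInducing_ι : IsInducing ι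
  /-- the parametrization -/
  η : V → G
  contDiff_η : ContDiff ℝ ∞ (ι ∘ η)
  η_zero : η 0 = 1
  /-- the coordinates -/
  Λ : A → V
  /-- the domain of the coordinates -/
  U : Set A
  isOpen_U : IsOpen U
  contDiffOn_Λ : ContDiffOn ℝ ∞ Λ U
  /-- the range of the coordinates -/
  W : Set V
  isOpen_W : IsOpen W
  zero_mem_W : 0 ∈ W
  ι_η_mem : ∀ v ∈ W, ι (η v) ∈ U
  Λ_ι_η : ∀ v ∈ W, Λ (ι (η v)) = v
  Λ_mem : ∀ g, ι g ∈ U → Λ (ι g) ∈ W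
  η_Λ : ∀ g, ι g ∈ U → η (Λ (ι g)) = g

namespace ExpModel

variable {A V G : Type*} [NormedRing A] [NormedAlgebra ℝ A]
    [NormedAddCommGroup V] [NormedSpace ℝ V] [Group G] [TopologicalSpace G] [M : ExpModel A V G]

theorem continuous_ι : Continuous (ι : G → A) := isInducing_ι.continuous

theorem continuous_η : Continuous (η : V → G) :=
  isInducing_ι.continuous_iff.2 M.contDiff_η.continuous

theorem one_mem_U : (1 : A) ∈ M.U := by
  have h := M.ι_η_mem 0 M.zero_mem_W
  rwa [η_zero, map_one] at h

theorem Λ_one : M.Λ 1 = 0 := by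
  have h := M.Λ_ι_η 0 M.zero_mem_W
  rwa [η_zero, map_one] at h

variable (G) in
/-- The chart around the identity. -/
def baseChart : OpenPartialHomeomorph G V where
  toFun := fun g => M.Λ (M.ι g)
  invFun := M.η
  source := M.ι ⁻¹' M.U
  target := M.W
  map_source' := fun g hg => M.Λ_mem g hg
  map_target' := fun v hv => M.ι_η_mem v hv
  left_inv' := fun g hg => M.η_Λ g hg
  right_inv' := fun v hv => M.Λ_ι_η v hv
  open_source := M.isOpen_U.preimage continuous_ι
  open_target := M.isOpen_W
  continuousOn_toFun := M.contDiffOn_Λ.continuousOn.comp continuous_ι.continuousOn fun _ h => h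
  continuousOn_invFun := continuous_η.continuousOn

variable [IsTopologicalGroup G]

/-- The translate of the chart around the identity. -/
def chart (g : G) : OpenPartialHomeomorph G V :=
  (Homeomorph.mulLeft g⁻¹).toOpenPartialHomeomorph.trans (baseChart G)

theorem chart_apply (g x : G) : chart g x = M.Λ (M.ι (g⁻¹ * x)) := rfl

theorem chart_symm_apply (g : G) (v : V) : (chart g).symm v = g * M.η v := by
  change (g⁻¹)⁻¹ * M.η v = _
  rw [inv_inv]

theorem mem_chart_source (g x : G) : x ∈ (chart g).source ↔ M.ι (g⁻¹ * x) ∈ M.U := by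
  simp [chart, baseChart]

/-- The charts obtained by left translation from the chart around the identity. -/
@[reducible] def chartedSpace : ChartedSpace V G where
  atlas := range chart
  chartAt := chart
  mem_chart_source := fun g => by
    rw [mem_chart_source, inv_mul_cancel, map_one]
    exact one_mem_U
  chart_mem_atlas := fun g => mem_range_self g

attribute [local instance] chartedSpace

/-- A change of charts is parametrization, left multiplication by a fixed element of the algebra,
and the smooth local inverse `Λ`. -/
theorem isManifold : IsManifold 𝓘(ℝ, V) ∞ G := by
  refine isManifold_of_contDiffOn 𝓘(ℝ, V) ∞ G ?_
  rintro _ _ ⟨g, rfl⟩ ⟨h, rfl⟩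
  have h1 : ContDiffOn ℝ ∞ (fun v : V => M.Λ (M.ι (h⁻¹ * g) * M.ι (M.η v)))
      {v | M.ι (h⁻¹ * g) * M.ι (M.η v) ∈ M.U} :=
    M.contDiffOn_Λ.comp (contDiff_const.mul M.contDiff_η).contDiffOn fun v hv => hv
  refine (h1.congr ?_).mono ?_
  · intro v _
    change chart h ((chart g).symm v) = _
    rw [chart_symm_apply, chart_apply, ← mul_assoc, map_mul]
  · rintro v ⟨hv, -⟩
    have h2 : (chart g).symm v ∈ (chart h).source := by
      have h3 : v ∈ ((chart g).symm.trans (chart h)).source := hv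
      rw [OpenPartialHomeomorph.trans_source] at h3
      exact h3.2
    rw [mem_chart_source, chart_symm_apply, ← mul_assoc, map_mul] at h2
    exact h2

theorem contMDiff_ι : ContMDiff 𝓘(ℝ, V) 𝓘(ℝ, A) ∞ (ι : G → A) := by
  have := isManifold (G := G)
  intro g
  rw [contMDiffAt_iff]
  refine ⟨continuous_ι.continuousAt, ?_⟩
  have h1 : ContDiff ℝ ∞ (fun v : V => M.ι g * M.ι (M.η v)) := contDiff_const.mul M.contDiff_η
  refine h1.contDiffWithinAt.congr_of_eventuallyEq (Eventually.of_forall fun v => ?_) ?_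
  · change M.ι ((chart g).symm v) = _
    rw [chart_symm_apply, map_mul]
  · change M.ι ((chart g).symm _) = _
    rw [chart_symm_apply, map_mul]
    rfl

/-- Maps into `G` are smooth if they are smooth as maps into the algebra. -/
theorem contMDiff_of_comp {F : Type*} [NormedAddCommGroup F] [NormedSpace ℝ F] {H : Type*}
    [TopologicalSpace H] {I : ModelWithCorners ℝ F H} {N : Type*} [TopologicalSpace N]
    [ChartedSpace H N] {f : N → G} (hf : ContMDiff I 𝓘(ℝ, A) ∞ fun x => M.ι (f x)) :
    ContMDiff I 𝓘(ℝ, V) ∞ f := by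
  have hc : Continuous f := isInducing_ι.continuous_iff.2 hf.continuous
  intro x
  rw [contMDiffAt_iff_target]
  refine ⟨hc.continuousAt, ?_⟩
  have h1 : ContMDiffAt I 𝓘(ℝ, A) ∞ (fun y => M.ι ((f x)⁻¹) * M.ι (f y)) x := by
    have h2 : ContDiff ℝ ∞ fun a : A => M.ι ((f x)⁻¹) * a := contDiff_const.mul contDiff_id
    exact (h2.contMDiff.comp hf) x
  have h3 : M.ι ((f x)⁻¹) * M.ι (f x) = 1 := by rw [← map_mul, inv_mul_cancel, map_one]
  have h4 : ContMDiffAt 𝓘(ℝ, A) 𝓘(ℝ, V) ∞ M.Λ (M.ι ((f x)⁻¹) * M.ι (f x)) := by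
    rw [h3]
    exact (M.contDiffOn_Λ.contDiffAt (M.isOpen_U.mem_nhds one_mem_U)).contMDiffAt
  refine (h4.comp x h1).congr_of_eventuallyEq (Eventually.of_forall fun y => ?_)
  change M.Λ (M.ι ((f x)⁻¹ * f y)) = _
  rw [map_mul]
  rfl

variable [CompleteSpace A]

theorem lieGroup : LieGroup 𝓘(ℝ, V) ∞ G :=
  { isManifold (G := G) with
    contMDiff_mul := by
      have := isManifold (G := G)
      refine contMDiff_of_comp ?_
      simp only [map_mul]
      have h2 : ContDiff ℝ ∞ fun a : A × A => a.1 * a.2 := contDiff_fst.mul contDiff_snd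
      exact h2.contMDiff.comp
        ((contMDiff_ι.comp contMDiff_fst).prodMk_space (contMDiff_ι.comp contMDiff_snd))
    contMDiff_inv := by
      have := isManifold (G := G)
      refine contMDiff_of_comp ?_
      intro g
      let φ : G → Aˣ := fun g => Units.map M.ι (toUnits g)
      have h1 : ∀ g : G, M.ι g⁻¹ = Ring.inverse (M.ι g) := by
        intro g
        have h2 : M.ι g = (φ g : A) := rfl
        rw [h2, Ring.inverse_unit]
        rfl
      simp only [h1]
      have h2 : ContDiffAt ℝ ∞ Ring.inverse (M.ι g) := contDiffAt_ringInverse ℝ (φ g)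
      exact h2.contMDiffAt.comp g (contMDiff_ι g) }

attribute [local instance] lieGroup

variable (G) in
/-- The differential of the embedding at the identity. -/
noncomputable def incl : V →L[ℝ] A := fderiv ℝ (M.ι ∘ M.η) 0

theorem hasFDerivAt_η : HasFDerivAt (M.ι ∘ M.η) (incl G) 0 :=
  (M.contDiff_η.differentiable (by simp) 0).hasFDerivAt

theorem lg_eq (g : G) : lg (E := V) g = M.Λ (M.ι g) := by
  change M.Λ (M.ι (1⁻¹ * g)) - M.Λ (M.ι (1⁻¹ * 1)) = _
  rw [inv_one, one_mul, one_mul, map_one, Λ_one, sub_zero]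

theorem hasVelocity_η (X : V) : HasVelocity (fun t : ℝ => M.η (t • X)) X := by
  have hc : Continuous fun t : ℝ => t • X := by fun_prop
  refine ⟨by simp only [zero_smul, η_zero], (continuous_η.comp hc).continuousAt, ?_⟩
  have h1 : HasDerivAt (fun t : ℝ => t • X) X 0 := by
    simpa using (hasDerivAt_id (0 : ℝ)).smul_const X
  refine h1.congr_of_eventuallyEq ?_
  have h2 : ∀ᶠ t : ℝ in 𝓝 0, t • X ∈ M.W := by
    refine hc.continuousAt.eventually ?_
    simp only [zero_smul]
    exact M.isOpen_W.mem_nhds M.zero_mem_W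
  filter_upwards [h2] with t ht
  rw [lg_eq, M.Λ_ι_η _ ht]

theorem hasDerivAt_ι {γ : ℝ → G} {X : V} (h : HasVelocity γ X) :
    HasDerivAt (fun t => M.ι (γ t)) (incl G X) 0 := by
  have h1 : HasFDerivAt (M.ι ∘ M.η) (incl G) (lg (E := V) (γ 0)) := by
    rw [h.1, lg_one]
    exact hasFDerivAt_η
  refine (h1.comp_hasDerivAt (0 : ℝ) h.2.2).congr_of_eventuallyEq ?_
  have h2 : ∀ᶠ g in 𝓝 (1 : G), M.ι g ∈ M.U := by
    refine continuous_ι.continuousAt.eventually ?_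
    rw [map_one]
    exact M.isOpen_U.mem_nhds one_mem_U
  filter_upwards [h.tendsto.eventually h2] with t ht
  simp only [Function.comp_apply, lg_eq, M.η_Λ _ ht]

/-- The derivative at `0` of `(g * η (t • Y) * g⁻¹) * g = g * η (t • Y)`, read in the algebra. -/
theorem incl_Ad (g : G) (Y : V) : incl G (Ad V g Y) * M.ι g = M.ι g * incl G Y := by
  have h1 := hasDerivAt_ι ((hasVelocity_η (G := G) Y).conj g)
  have h2 := (hasDerivAt_ι (hasVelocity_η (G := G) Y)).const_mul (M.ι g)
  have h3 := h1.mul_const (M.ι g)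
  simp only [← map_mul, inv_mul_cancel_right] at h2 h3
  exact h3.unique h2

/-- The Lie bracket is the commutator. -/
theorem incl_bracketE (X Y : V) :
    incl G (bracketE V G X Y) = incl G X * incl G Y - incl G Y * incl G X := by
  have hv := hasVelocity_η (G := G) X
  have h1 := ((incl G).hasFDerivAt.comp_hasDerivAt (0 : ℝ)
    (hv.hasDerivAt_Ad_apply Y)).mul (hasDerivAt_ι hv)
  have h2 := (hasDerivAt_ι hv).mul_const (incl G Y)
  -- Differentiating `incl_Ad` along a curve with velocity `X`, the product rule gives `[X, Y] + Y X
  -- = X Y`.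
  have h3 := h1.unique (h2.congr_of_eventuallyEq (Eventually.of_forall fun t => incl_Ad _ Y))
  simp only [Function.comp_apply, zero_smul, η_zero, map_one, mul_one, Ad_one] at h3
  exact eq_sub_of_add_eq h3

end ExpModel

end LinearGroups

/-! ### A criterion for negative trace. -/

section Trace

/-- The square of a nonzero skew endomorphism has negative trace. -/
theorem trace_comp_self_neg {V : Type*} [AddCommGroup V] [Module ℝ V] [FiniteDimensional ℝ V]
    (B : V →ₗ[ℝ] V →ₗ[ℝ] ℝ) (hsymm : ∀ x y, B x y = B y x) (hpos : ∀ x, x ≠ 0 → 0 < B x x)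
    {T : V →ₗ[ℝ] V} (hT : ∀ x y, B (T x) y = - B x (T y)) (hT0 : T ≠ 0) :
    LinearMap.trace ℝ V (T ∘ₗ T) < 0 := by
  let core : InnerProductSpace.Core ℝ V :=
    { inner := fun x y => B x y
      conj_inner_symm := fun x y => by simpa using hsymm y x
      re_inner_nonneg := fun x => by
        by_cases hx : x = 0
        · simp [hx]
        · simpa using (hpos x hx).le
      add_left := fun x y z => by simp
      smul_left := fun x y c => by simp
      definite := fun x hx => by
        by_contra h
        exact (hpos x h).ne' hx }
  let _ : NormedAddCommGroup V := core.toNormedAddCommGroup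
  let _ : InnerProductSpace ℝ V := InnerProductSpace.ofCore core.toCore
  have hinner : ∀ x y : V, inner ℝ x y = B x y := fun x y => rfl
  let b := stdOrthonormalBasis ℝ V
  rw [LinearMap.trace_eq_sum_inner _ b]
  -- By skewness the trace of `T ∘ T` is minus the sum of the squared lengths of the `T (b i)`.
  have h1 : ∀ i, inner ℝ (b i) ((T ∘ₗ T) (b i)) = - B (T (b i)) (T (b i)) := by
    intro i
    rw [hinner, LinearMap.comp_apply, hT, neg_neg]
  simp only [h1]
  have hle : ∀ x, 0 ≤ B x x := fun x => by
    by_cases hx : x = 0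
    · simp [hx]
    · exact (hpos x hx).le
  rw [Finset.sum_neg_distrib, neg_lt_zero]
  refine Finset.sum_pos' (fun i _ => hle _) ?_
  by_contra! h
  refine hT0 (b.toBasis.ext fun i => ?_)
  by_contra h2
  rw [OrthonormalBasis.coe_toBasis, LinearMap.zero_apply] at h2
  exact (h i (Finset.mem_univ i)).not_gt (hpos _ h2)

end Trace

/-! ### The identity component of `SU(3)` as a Lie group. -/

section Matrices

attribute [local instance] Matrix.linftyOpNormedRing Matrix.linftyOpNormedAlgebra

/-- Complex matrices of size three. -/
abbrev Mat3 : Type := Matrix (Fin 3) (Fin 3) ℂ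

/-- The Lie algebra of traceless skew-Hermitian matrices. -/
def su3 : Submodule ℝ (Mat3) where
  carrier := {X | star X = -X ∧ X.trace = 0}
  zero_mem' := by simp
  add_mem' := fun {X Y} hX hY => ⟨by rw [star_add, hX.1, hY.1, neg_add], by
    rw [Matrix.trace_add, hX.2, hY.2, add_zero]⟩
  smul_mem' := fun c X hX => ⟨by rw [star_smul, hX.1, smul_neg, star_trivial], by
    rw [Matrix.trace_smul, hX.2, smul_zero]⟩

/-- The matrix `-iX` is Hermitian, so `X` is unitarily diagonalizable and the claim reduces to
diagonal matrices. -/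
theorem det_exp_of_star_eq_neg {X : Mat3} (hX : star X = -X) :
    (NormedSpace.exp X).det = Complex.exp X.trace := by
  have hH : (-Complex.I • X).IsHermitian := by
    rw [Matrix.IsHermitian, ← Matrix.star_eq_conjTranspose, star_smul, hX]
    simp
  have h1 := hH.spectral_theorem
  set D := Matrix.diagonal (RCLike.ofReal ∘ hH.eigenvalues : Fin 3 → ℂ) with hD
  rw [Unitary.conjStarAlgAut_apply] at h1
  set P := (hH.eigenvectorUnitary : Mat3)
  have hP : P * star P = 1 := Unitary.coe_mul_star_self hH.eigenvectorUnitary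
  have hP' : P⁻¹ = star P := Matrix.inv_eq_right_inv hP
  have hu : IsUnit P := IsUnit.of_mul_eq_one _ hP 
  have hdet : P.det * (star P).det = 1 := by rw [← Matrix.det_mul, hP, Matrix.det_one]
  have h2 : X = P * (Complex.I • D) * P⁻¹ := by
    rw [Matrix.mul_smul, Matrix.smul_mul, hP', ← h1, smul_smul]
    simp
  have htr : X.trace = (Complex.I • D).trace := by
    rw [h2, hP', Matrix.trace_mul_comm, ← mul_assoc, ← hP', Matrix.nonsing_inv_mul _ ((Matrix.isUnit_iff_isUnit_det _).1 hu), one_mul]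
  have h3 : Complex.I • D = Matrix.diagonal (fun i => Complex.I * (hH.eigenvalues i : ℂ)) := by
    rw [hD, ← Matrix.diagonal_smul]
    rfl
  rw [htr, h2, Matrix.exp_conj _ _ hu, Matrix.det_mul, Matrix.det_mul, hP', mul_right_comm, hdet, one_mul, h3,
    Matrix.exp_diagonal, Matrix.det_diagonal, Matrix.trace_diagonal, Complex.exp_sum]
  refine Finset.prod_congr rfl fun i _ => ?_
  rw [Pi.coe_exp, Complex.exp_eq_exp_ℂ]

theorem exp_mul_exp_neg (X : Mat3) : NormedSpace.exp X * NormedSpace.exp (-X) = 1 := by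
  rw [← Matrix.exp_add_of_commute _ _ (Commute.refl X).neg_right, add_neg_cancel,
    NormedSpace.exp_zero]

theorem exists_log (A : Type*) [NormedRing A] [NormedAlgebra ℝ A] [CompleteSpace A] :
    ∃ e : OpenPartialHomeomorph A A, (∀ x, e x = NormedSpace.exp x) ∧ 0 ∈ e.source ∧
      ∃ N, IsOpen N ∧ (1 : A) ∈ N ∧ ContDiffOn ℝ ∞ e.symm N := by
  -- Analyticity is used because, unlike order `∞` at a single point, it passes to a whole
  -- neighbourhood; this yields the open set `N`.
  have h1 : ContDiffAt ℝ ω (NormedSpace.exp : A → A) 0 :=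
    (NormedSpace.exp_analytic (𝕂 := ℝ) (0 : A)).contDiffAt
  have h2 : HasFDerivAt (NormedSpace.exp : A → A)
      ((ContinuousLinearEquiv.refl ℝ A : A ≃L[ℝ] A) : A →L[ℝ] A) 0 :=
    hasFDerivAt_exp_zero (𝕂 := ℝ) (𝔸 := A)
  have h3 := h1.to_localInverse h2 (by simp)
  rw [NormedSpace.exp_zero] at h3
  obtain ⟨N, hN, hNo, h1N⟩ := eventually_nhds_iff.1 (h3.eventually (by simp))
  refine ⟨h1.toOpenPartialHomeomorph _ h2 (by simp), fun x => rfl,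
    h1.mem_toOpenPartialHomeomorph_source h2 _, N, hNo, h1N, fun x hx => ?_⟩
  exact ((hN x hx).of_le le_top).contDiffWithinAt

/-- The special unitary group as a subgroup of the unitary group. -/
def SU3 : Subgroup (Matrix.unitaryGroup (Fin 3) ℂ) where
  carrier := {u | (u : Mat3).det = 1}
  one_mem' := by simp
  mul_mem' := fun {a b} ha hb => by
    change ((a : Mat3) * (b : Mat3)).det = 1
    rw [Matrix.det_mul, ha, hb, one_mul]
  inv_mem' := fun {a} ha => by
    change (star (a : Mat3)).det = 1
    rw [Matrix.star_eq_conjTranspose, Matrix.det_conjTranspose, ha, star_one]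

/-- The identity component of the special unitary group. -/
abbrev SU3c : Type := Subgroup.connectedComponentOfOne SU3

/-- The matrix of an element. -/
def toMat : SU3c →* Mat3 where
  toFun := fun g => ((g : SU3) : Matrix.unitaryGroup (Fin 3) ℂ)
  map_one' := rfl
  map_mul' := fun _ _ => rfl

theorem isEmbedding_toMat : IsEmbedding toMat :=
  IsEmbedding.subtypeVal.comp (IsEmbedding.subtypeVal.comp IsEmbedding.subtypeVal)

theorem toMat_mul_star (g : SU3c) : toMat g * star (toMat g) = 1 :=
  Unitary.coe_mul_star_self (g : SU3).1

theorem det_toMat (g : SU3c) : (toMat g).det = 1 := (g : SU3).2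

instance compactSpace_unitary : CompactSpace (Matrix.unitaryGroup (Fin 3) ℂ) := by
  refine (isCompact_iff_compactSpace (s := (Matrix.unitaryGroup (Fin 3) ℂ : Set Mat3))).1 ?_
  have h1 : IsCompact (Set.univ.pi fun _ : Fin 3 => Set.univ.pi fun _ : Fin 3 =>
      Metric.closedBall (0 : ℂ) 1) :=
    isCompact_univ_pi fun _ => isCompact_univ_pi fun _ => isCompact_closedBall _ _
  refine h1.of_isClosed_subset ?_ ?_
  · have h2 : ((Matrix.unitaryGroup (Fin 3) ℂ : Submonoid Mat3) : Set Mat3) =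
        {u | u * star u = 1} := by
      ext u
      exact Matrix.mem_unitaryGroup_iff
    rw [h2]
    exact isClosed_eq (by fun_prop) continuous_const
  · intro u hu i _ j _
    rw [mem_closedBall_zero_iff]
    exact entry_norm_bound_of_unitary hu i j

instance compactSpace_SU3 : CompactSpace SU3 := by
  refine (isCompact_iff_compactSpace (s := (SU3 : Set (Matrix.unitaryGroup (Fin 3) ℂ)))).1 ?_
  refine IsClosed.isCompact ?_
  have h : Continuous fun u : Matrix.unitaryGroup (Fin 3) ℂ => (u : Mat3).det := by fun_prop
  exact isClosed_eq h continuous_const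

instance compactSpace_SU3c : CompactSpace SU3c :=
  isCompact_iff_compactSpace.1 (isClosed_connectedComponent.isCompact)

instance connectedSpace_SU3c : ConnectedSpace SU3c :=
  isConnected_iff_connectedSpace.1 isConnected_connectedComponent

theorem exp_mem_unitary (X : su3) : NormedSpace.exp (X : Mat3) ∈ Matrix.unitaryGroup (Fin 3) ℂ := by
  rw [Matrix.mem_unitaryGroup_iff, NormedSpace.star_exp, X.2.1]
  exact exp_mul_exp_neg _

/-- The exponential of a traceless skew-Hermitian matrix. -/
noncomputable def expSU3 (X : su3) : SU3 :=
  ⟨⟨NormedSpace.exp (X : Mat3), exp_mem_unitary X⟩, by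
    change (NormedSpace.exp (X : Mat3)).det = 1
    rw [det_exp_of_star_eq_neg X.2.1, X.2.2, Complex.exp_zero]⟩

theorem continuous_expSU3 : Continuous expSU3 := by
  refine Continuous.subtype_mk (Continuous.subtype_mk ?_ _) _
  exact NormedSpace.exp_continuous.comp continuous_subtype_val

theorem expSU3_mem (X : su3) : expSU3 X ∈ Subgroup.connectedComponentOfOne SU3 := by
  have h1 : IsPreconnected (range expSU3) := isPreconnected_range continuous_expSU3
  refine h1.subset_connectedComponent ⟨0, ?_⟩ (mem_range_self X)
  exact Subtype.ext (Subtype.ext NormedSpace.exp_zero)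

/-- The space of traceless skew-Hermitian matrices as an abstract normed space. -/
def LieSU3 : Type := su3

noncomputable instance : NormedAddCommGroup LieSU3 := inferInstanceAs (NormedAddCommGroup su3)

noncomputable instance : NormedSpace ℝ LieSU3 := inferInstanceAs (NormedSpace ℝ su3)

instance : FiniteDimensional ℝ LieSU3 := inferInstanceAs (FiniteDimensional ℝ su3)

/-- The matrix of an element of the Lie algebra. -/
noncomputable def mat : LieSU3 →ₗ[ℝ] Mat3 := su3.subtype

/-- The exponential coordinates on the identity component of the special unitary group. -/
noncomputable instance expModelSU3 : ExpModel Mat3 LieSU3 SU3c := by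
  have h0 := exists_log Mat3
  let e := h0.choose
  have he : ∀ x, e x = NormedSpace.exp x := h0.choose_spec.1
  have he0 : 0 ∈ e.source := h0.choose_spec.2.1
  let N := h0.choose_spec.2.2.choose
  have hN : IsOpen N := h0.choose_spec.2.2.choose_spec.1
  have hN1 : 1 ∈ N := h0.choose_spec.2.2.choose_spec.2.1
  have hsm : ContDiffOn ℝ ∞ e.symm N := h0.choose_spec.2.2.choose_spec.2.2
  have hP0 := su3.subtype.exists_leftInverse_of_injective (Submodule.ker_subtype _)
  let P : Mat3 →L[ℝ] su3 := LinearMap.toContinuousLinearMap hP0.choose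
  have hP : ∀ X : su3, P (X : Mat3) = X := fun X => LinearMap.congr_fun hP0.choose_spec X
  -- The second condition makes logarithms of unitary matrices skew-Hermitian, and the third makes
  -- those of determinant one traceless.
  let S : Set Mat3 := e.source ∩ {X | -star X ∈ e.source} ∩ {X | ‖X.trace‖ < 1}
  have hS : IsOpen S := by
    refine (e.open_source.inter (e.open_source.preimage ?_)).inter (isOpen_lt ?_ continuous_const)
    · exact continuous_id.matrix_conjTranspose.neg
    · exact (continuous_id.matrix_trace).norm
  have hexp : ∀ X ∈ e.source, e.symm (NormedSpace.exp X) = X := fun X hX => by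
    rw [← he, e.left_inv hX]
  -- For `X = log g` also `exp (-X*) = g`, so `-X* = X` by injectivity of `exp` on the domain of
  -- `e`. Then `exp (tr X) = 1` puts `tr X` into `2πiℤ`, and `|tr X| < 1` leaves only `0`.
  have hmem : ∀ g : SU3c, toMat g ∈ e.target → e.symm (toMat g) ∈ S → e.symm (toMat g) ∈ su3 := by
    intro g hg hX
    have h1 : NormedSpace.exp (e.symm (toMat g)) = toMat g := by rw [← he, e.right_inv hg]
    generalize e.symm (toMat g) = X at hX h1
    obtain ⟨⟨hX1, hX2⟩, hX3⟩ := hX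
    have h2 : NormedSpace.exp (-star X) = toMat g := by
      have h3 : NormedSpace.exp (star X) = star (toMat g) := by rw [← NormedSpace.star_exp, h1]
      have h4 := exp_mul_exp_neg (star X)
      rw [h3] at h4
      have h5 := congrArg (fun Z => toMat g * Z) h4
      simpa only [← mul_assoc, toMat_mul_star, one_mul, mul_one] using h5
    have h3 : -star X = X := by
      rw [← hexp _ hX2, h2, ← h1, hexp _ hX1]
    have h4 : star X = -X := by rw [← h3, neg_neg, h3]
    refine ⟨h4, ?_⟩
    have h5 := det_exp_of_star_eq_neg h4
    rw [h1, det_toMat, eq_comm, Complex.exp_eq_one_iff] at h5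
    obtain ⟨n, hn⟩ := h5
    rw [hn]
    have h6 : ‖X.trace‖ < 1 := hX3
    rw [hn] at h6
    by_contra h7
    have hn0 : n ≠ 0 := by
      rintro rfl
      simp at h7
    have h8 : (1 : ℝ) ≤ |(n : ℝ)| := by exact_mod_cast Int.one_le_abs hn0
    have h9 := Real.pi_gt_three
    simp [abs_of_pos Real.pi_pos] at h6
    nlinarith
  exact show ExpModel Mat3 su3 SU3c from
  { ι := toMat
    isInducing_ι := isEmbedding_toMat.isInducing
    η := fun X => ⟨expSU3 X, expSU3_mem X⟩
    contDiff_η := by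
      have h1 : ContDiff ℝ ∞ (NormedSpace.exp : Mat3 → Mat3) :=
        contDiff_iff_contDiffAt.2 fun x =>
          (NormedSpace.exp_analytic (𝕂 := ℝ) x).contDiffAt
      exact h1.comp su3.subtypeL.contDiff
    η_zero := Subtype.ext (Subtype.ext (Subtype.ext NormedSpace.exp_zero))
    Λ := fun B => P (e.symm B)
    U := e.target ∩ e.symm ⁻¹' S ∩ N
    isOpen_U := (e.isOpen_inter_preimage_symm hS).inter hN
    contDiffOn_Λ := P.contDiff.comp_contDiffOn (hsm.mono inter_subset_right)
    W := {X | (X : Mat3) ∈ S ∧ NormedSpace.exp (X : Mat3) ∈ N}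
    isOpen_W := (hS.preimage continuous_subtype_val).inter
      (hN.preimage (NormedSpace.exp_continuous.comp continuous_subtype_val))
    zero_mem_W := by
      refine ⟨⟨⟨he0, ?_⟩, ?_⟩, ?_⟩
      · simpa using he0
      · simp
      · simpa [NormedSpace.exp_zero] using hN1
    ι_η_mem := by
      rintro v ⟨hv, hv'⟩
      refine ⟨⟨?_, ?_⟩, hv'⟩
      · change NormedSpace.exp (v : Mat3) ∈ e.target
        rw [← he]
        exact e.map_source hv.1.1
      · change e.symm (NormedSpace.exp (v : Mat3)) ∈ S
        rwa [hexp _ hv.1.1]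
    Λ_ι_η := by
      rintro v ⟨hv, hv'⟩
      change P (e.symm (NormedSpace.exp (v : Mat3))) = v
      rw [hexp _ hv.1.1, hP]
    Λ_mem := by
      rintro g ⟨⟨hg1, hg2⟩, hg3⟩
      have h1 := hP ⟨_, hmem g hg1 hg2⟩
      simp only at h1
      rw [h1]
      refine ⟨hg2, ?_⟩
      rwa [← he, e.right_inv hg1]
    η_Λ := by
      rintro g ⟨⟨hg1, hg2⟩, hg3⟩
      refine isEmbedding_toMat.injective ?_
      have h1 := hP ⟨_, hmem g hg1 hg2⟩
      simp only at h1
      rw [h1]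
      change NormedSpace.exp (e.symm (toMat g)) = toMat g
      rw [← he, e.right_inv hg1] }

noncomputable instance : ChartedSpace LieSU3 SU3c := ExpModel.chartedSpace

instance : LieGroup 𝓘(ℝ, LieSU3) ∞ SU3c := ExpModel.lieGroup

theorem ι_η_SU3 (X : LieSU3) :
    ExpModel.ι (ExpModel.η X : SU3c) = NormedSpace.exp (mat X) := rfl

theorem mat_injective : Function.Injective mat := Subtype.val_injective

theorem star_mat (X : LieSU3) : star (mat X) = - mat X := (show su3 from X).2.1

theorem trace_mat (X : LieSU3) : (mat X).trace = 0 := (show su3 from X).2.2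

/-- Traceless skew-Hermitian matrices are elements of the Lie algebra. -/
def ofMat (X : Mat3) (h : star X = -X) (h' : X.trace = 0) : LieSU3 :=
  show su3 from ⟨X, h, h'⟩

theorem mat_ofMat (X : Mat3) (h : star X = -X) (h' : X.trace = 0) : mat (ofMat X h h') = X := rfl

theorem incl_SU3 (X : LieSU3) : ExpModel.incl SU3c X = mat X := by
  have h1 : HasFDerivAt (NormedSpace.exp : Mat3 → Mat3) (1 : Mat3 →L[ℝ] Mat3)
      (LinearMap.toContinuousLinearMap mat 0) := by
    rw [map_zero]
    exact hasFDerivAt_exp_zero (𝕂 := ℝ)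
  have h2 := h1.comp (0 : LieSU3) (LinearMap.toContinuousLinearMap mat).hasFDerivAt
  have h3 : ((ExpModel.ι : SU3c → Mat3) ∘ ExpModel.η : LieSU3 → Mat3) =
      NormedSpace.exp ∘ (LinearMap.toContinuousLinearMap mat) := by
    rw [LinearMap.coe_toContinuousLinearMap']
    funext X
    exact ι_η_SU3 X
  have h4 := ExpModel.hasFDerivAt_η (G := SU3c)
  have h5 := h4.unique (h3 ▸ h2)
  exact congrArg (fun L : LieSU3 →L[ℝ] Mat3 => L X) h5

end Matrices

/-! ### Negative definiteness of the Killing form of `SU(3)`. -/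

section SU3

attribute [local instance] Matrix.linftyOpNormedRing Matrix.linftyOpNormedAlgebra

theorem mat_bracketE (X Y : LieSU3) :
    mat (bracketE LieSU3 SU3c X Y) = mat X * mat Y - mat Y * mat X := by
  have h := ExpModel.incl_bracketE (G := SU3c) X Y
  rwa [incl_SU3, incl_SU3, incl_SU3] at h

/-- The form `-Re tr (X Y)`. -/
noncomputable def traceFormSU3 : LieSU3 →ₗ[ℝ] LieSU3 →ₗ[ℝ] ℝ :=
  LinearMap.mk₂ ℝ (fun X Y => -(mat X * mat Y).trace.re)
    (fun X X' Y => by simp [add_mul]; ring)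
    (fun c X Y => by simp)
    (fun X Y Y' => by simp [mul_add]; ring)
    (fun c X Y => by simp)

theorem traceFormSU3_apply (X Y : LieSU3) :
    traceFormSU3 X Y = -(mat X * mat Y).trace.re := rfl

theorem traceFormSU3_pos (X : LieSU3) (hX : X ≠ 0) : 0 < traceFormSU3 X X := by
  have h1 : traceFormSU3 X X = ∑ i, ∑ j, Complex.normSq (mat X i j) := by
    have h2 : -(mat X * mat X).trace = (mat X * star (mat X)).trace := by
      rw [star_mat, mul_neg, Matrix.trace_neg]
    rw [traceFormSU3_apply, ← Complex.neg_re, h2, Matrix.trace, Complex.re_sum]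
    refine Finset.sum_congr rfl fun i _ => ?_
    rw [Matrix.diag_apply, Matrix.mul_apply, Complex.re_sum]
    refine Finset.sum_congr rfl fun j _ => ?_
    rw [Matrix.star_apply, Complex.star_def, Complex.mul_conj, Complex.ofReal_re]
  rw [h1]
  by_contra! h3
  have h4 : ∀ i ∈ Finset.univ, 0 ≤ ∑ j, Complex.normSq (mat X i j) :=
    fun i _ => Finset.sum_nonneg fun j _ => Complex.normSq_nonneg _
  have h5 := (Finset.sum_eq_zero_iff_of_nonneg h4).1 (le_antisymm h3 (Finset.sum_nonneg h4))
  refine hX (mat_injective (Matrix.ext fun i j => ?_))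
  have h6 := (Finset.sum_eq_zero_iff_of_nonneg fun j _ => Complex.normSq_nonneg _).1
    (h5 i (Finset.mem_univ i)) j (Finset.mem_univ j)
  rw [map_zero]
  exact Complex.normSq_eq_zero.1 h6

theorem traceFormSU3_bracketE (Z X Y : LieSU3) :
    traceFormSU3 (bracketE LieSU3 SU3c Z X) Y = - traceFormSU3 X (bracketE LieSU3 SU3c Z Y) := by
  rw [traceFormSU3_apply, traceFormSU3_apply, mat_bracketE, mat_bracketE, sub_mul, mul_sub,
    Matrix.trace_sub, Matrix.trace_sub, mul_assoc (mat Z), Matrix.trace_mul_comm (mat Z),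
    ← mul_assoc (mat X) (mat Z), ← mul_assoc (mat X) (mat Y)]
  simp

/-- The traceless diagonal matrix with the entries `i s`, `i t` and `-i (s + t)`. -/
noncomputable def diagSU3 (s t : ℝ) : LieSU3 :=
  ofMat (Matrix.diagonal ![Complex.I * s, Complex.I * t, -(Complex.I * (s + t))])
    (by
      rw [Matrix.star_eq_conjTranspose, Matrix.diagonal_conjTranspose, Matrix.diagonal_neg]
      congr 1
      ext i
      fin_cases i <;> simp)
    (by
      rw [Matrix.trace_diagonal]
      simp [Fin.sum_univ_three]
      ring)

/-- The skew-symmetric combination of two matrix units. -/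
noncomputable def skewSU3 {j k : Fin 3} (h : j ≠ k) : LieSU3 :=
  ofMat (Matrix.single j k 1 - Matrix.single k j 1)
    (by
      rw [Matrix.star_eq_conjTranspose, Matrix.conjTranspose_sub, Matrix.conjTranspose_single,
        Matrix.conjTranspose_single, star_one, neg_sub])
    (by
      rw [Matrix.trace_sub, Matrix.trace_single_eq_of_ne _ _ _ h,
        Matrix.trace_single_eq_of_ne _ _ _ h.symm, sub_zero])

/-- The symmetric combination of two matrix units, times `-i`. -/
noncomputable def symmSU3 {j k : Fin 3} (h : j ≠ k) : LieSU3 :=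
  ofMat (Matrix.single j k (-Complex.I) + Matrix.single k j (-Complex.I))
    (by
      rw [Matrix.star_eq_conjTranspose, Matrix.conjTranspose_add, Matrix.conjTranspose_single,
        Matrix.conjTranspose_single, neg_add, ← Matrix.single_neg, ← Matrix.single_neg, add_comm]
      simp)
    (by
      rw [Matrix.trace_add, Matrix.trace_single_eq_of_ne _ _ _ h,
        Matrix.trace_single_eq_of_ne _ _ _ h.symm, add_zero])

/-- Commuting with the diagonal matrix with distinct entries `i, 0, -i` forces `X` to be diagonal.
Commuting with the `skewSU3` matrices makes its diagonal entries equal, and the trace condition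
makes them zero. -/
theorem eq_zero_of_forall_bracketE (X : LieSU3) (h : ∀ Y, bracketE LieSU3 SU3c X Y = 0) :
    X = 0 := by
  have h1 : ∀ Y : LieSU3, ∀ i j, (mat X * mat Y) i j = (mat Y * mat X) i j := by
    intro Y i j
    have h2 := mat_bracketE X Y
    rw [h Y, map_zero] at h2
    rw [sub_eq_zero.1 h2.symm]
  have hd : ∀ i j, i ≠ j → mat X i j = 0 := by
    intro i j hij
    have h2 := h1 (diagSU3 1 0) i j
    rw [diagSU3, mat_ofMat, Matrix.mul_diagonal, Matrix.diagonal_mul] at h2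
    fin_cases i <;> fin_cases j <;> simp at hij h2 ⊢ <;>
      first
      | exact h2
      | exact mul_left_cancel₀ Complex.I_ne_zero (by linear_combination -h2 / 2)
      | exact mul_left_cancel₀ Complex.I_ne_zero (by linear_combination h2 / 2)
  have h3 : ∀ j k (hjk : j ≠ k), mat X j j = mat X k k := by
    intro j k hjk
    have h2 := h1 (skewSU3 hjk) j k
    rw [skewSU3, mat_ofMat] at h2
    simpa [mul_sub, sub_mul, hjk, hjk.symm] using h2
  have h4 := trace_mat X
  simp only [Matrix.trace, Matrix.diag_apply, Fin.sum_univ_three] at h4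
  rw [h3 1 0 (by decide), h3 2 0 (by decide)] at h4
  have h5 : mat X 0 0 = 0 := by linear_combination h4 / 3
  refine mat_injective (Matrix.ext fun i j => ?_)
  rw [map_zero, Matrix.zero_apply]
  by_cases hij : i = j
  · subst hij
    by_cases hi : i = 0
    · rw [hi, h5]
    · rw [h3 i 0 hi, h5]
  · exact hd i j hij

/-- `ad X` is skew for the positive definite form `-Re tr (X Y)`, and it is nonzero since the centre
is trivial. -/
theorem killingForm_SU3_neg (X : GroupLieAlgebra 𝓘(ℝ, LieSU3) SU3c) (hX : X ≠ 0) :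
    killingForm ℝ (GroupLieAlgebra 𝓘(ℝ, LieSU3) SU3c) X X < 0 := by
  rw [killingForm_apply_apply]
  have hT : (LieAlgebra.ad ℝ (GroupLieAlgebra 𝓘(ℝ, LieSU3) SU3c) X) ≠ 0 := by
    intro h
    refine hX (eq_zero_of_forall_bracketE X fun Y => ?_)
    exact LinearMap.congr_fun h Y
  exact trace_comp_self_neg (V := LieSU3) traceFormSU3
    (fun x y => by rw [traceFormSU3_apply, traceFormSU3_apply, Matrix.trace_mul_comm])
    traceFormSU3_pos (T := LieAlgebra.ad ℝ (GroupLieAlgebra 𝓘(ℝ, LieSU3) SU3c) X)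
    (fun x y => traceFormSU3_bracketE X x y) hT

end SU3

/-! ### The symmetric pair on `SU(3)` and its diagonal maximal tori. -/

section Involution

attribute [local instance] Matrix.linftyOpNormedRing Matrix.linftyOpNormedAlgebra

/-- Complex conjugation of matrices, followed by the reversal of rows and columns. -/
noncomputable def flipMat : Mat3 →+* Mat3 :=
  ((Matrix.reindexAlgEquiv ℂ ℂ Fin.revPerm).toRingEquiv.toRingHom).comp
    (RingHom.mapMatrix (starRingEnd ℂ))

theorem flipMat_apply (X : Mat3) (i j : Fin 3) :
    flipMat X i j = starRingEnd ℂ (X i.rev j.rev) := rfl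

theorem flipMat_flipMat (X : Mat3) : flipMat (flipMat X) = X := by
  ext i j
  simp [flipMat_apply]

theorem star_flipMat (X : Mat3) : star (flipMat X) = flipMat (star X) := by
  ext i j
  simp [flipMat_apply, Matrix.star_apply]

theorem det_flipMat (X : Mat3) : (flipMat X).det = starRingEnd ℂ X.det :=
  (Matrix.det_reindex_self Fin.revPerm _).trans (RingHom.map_det (starRingEnd ℂ) X).symm

theorem continuous_flipMat : Continuous flipMat := by
  refine continuous_matrix fun i j => ?_
  simp only [flipMat_apply]
  fun_prop

/-- The automorphism of the special unitary group induced by `flipMat`. -/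
noncomputable def flipSU3 : SU3 →* SU3 where
  toFun := fun g => ⟨⟨flipMat ((g : Matrix.unitaryGroup (Fin 3) ℂ) : Mat3), by
      rw [Matrix.mem_unitaryGroup_iff, star_flipMat, ← map_mul,
        Matrix.mem_unitaryGroup_iff.1 (g : Matrix.unitaryGroup (Fin 3) ℂ).2, map_one]⟩,
    by
      change (flipMat _).det = 1
      have h : ((g : Matrix.unitaryGroup (Fin 3) ℂ) : Mat3).det = 1 := g.2
      rw [det_flipMat, h, map_one]⟩
  map_one' := Subtype.ext (Subtype.ext (map_one flipMat))
  map_mul' := fun _ _ => Subtype.ext (Subtype.ext (map_mul flipMat _ _))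

theorem continuous_flipSU3 : Continuous flipSU3 :=
  Continuous.subtype_mk (Continuous.subtype_mk
    (continuous_flipMat.comp (continuous_subtype_val.comp continuous_subtype_val)) _) _

/-- The induced automorphism of the identity component. -/
noncomputable def involutionSU3 : SU3c →* SU3c :=
  (flipSU3.comp (Subgroup.subtype _)).codRestrict _ fun g => by
    have h := continuous_flipSU3.mapsTo_connectedComponent (1 : SU3) g.2
    rw [map_one] at h
    exact h

theorem toMat_involutionSU3 (g : SU3c) : toMat (involutionSU3 g) = flipMat (toMat g) := rfl

theorem toMat_injective : Function.Injective toMat := isEmbedding_toMat.injective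

theorem involutionSU3_involutionSU3 (g : SU3c) : involutionSU3 (involutionSU3 g) = g :=
  toMat_injective (by rw [toMat_involutionSU3, toMat_involutionSU3, flipMat_flipMat])

theorem contMDiff_involutionSU3 :
    ContMDiff 𝓘(ℝ, LieSU3) 𝓘(ℝ, LieSU3) ∞ involutionSU3 := by
  refine ExpModel.contMDiff_of_comp ?_
  let L : Mat3 →L[ℝ] Mat3 := LinearMap.toContinuousLinearMap
    { toFun := flipMat
      map_add' := map_add flipMat
      map_smul' := fun c X => by
        ext i j
        simp [flipMat_apply] }
  exact L.contDiff.contMDiff.comp ExpModel.contMDiff_ι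

/-- The fixed point group of the involution. -/
noncomputable def fixedSU3 : Subgroup SU3c := involutionSU3.eqLocus (MonoidHom.id SU3c)

theorem isClosed_fixedSU3 : IsClosed (fixedSU3 : Set SU3c) :=
  isClosed_eq contMDiff_involutionSU3.continuous continuous_id

/-- The identity component of the fixed point group. -/
noncomputable def symmetricSU3 : Subgroup SU3c :=
  (Subgroup.connectedComponentOfOne fixedSU3).map fixedSU3.subtype

theorem coe_symmetricSU3 :
    (symmetricSU3 : Set SU3c) = connectedComponentIn {g | involutionSU3 g = g} 1 :=
  (connectedComponentIn_eq_image (F := (fixedSU3 : Set SU3c)) fixedSU3.one_mem).symm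

/-- The symmetric pair of the special unitary and the special orthogonal group. -/
noncomputable def pairSU3 : CompactTypePair LieSU3 SU3c where
  σ := involutionSU3
  contMDiff_σ := contMDiff_involutionSU3
  σ_σ := involutionSU3_involutionSU3
  K := symmetricSU3
  isClosed_K := isClosed_fixedSU3.isClosedEmbedding_subtypeVal.isClosedMap _
    isClosed_connectedComponent
  isConnected_K := by
    rw [coe_symmetricSU3]
    exact isConnected_connectedComponentIn_iff.2 fixedSU3.one_mem
  σ_eq_of_mem := by
    rintro _ ⟨g, -, rfl⟩
    exact g.2
  component_subset := coe_symmetricSU3.symm.subset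
  killing_neg := killingForm_SU3_neg

/-- The diagonal element with the entries `exp (i s)`, `exp (i t)` and `exp (-i (s + t))`. -/
noncomputable def torusSU3 (s t : ℝ) : SU3c := ExpModel.η (diagSU3 s t)

theorem toMat_torusSU3 (s t : ℝ) : toMat (torusSU3 s t) =
    Matrix.diagonal ![Complex.exp (Complex.I * s), Complex.exp (Complex.I * t),
      Complex.exp (-(Complex.I * (s + t)))] := by
  refine (ι_η_SU3 _).trans ?_
  rw [diagSU3, mat_ofMat, Matrix.exp_diagonal]
  congr 1
  ext i
  rw [Pi.coe_exp, ← Complex.exp_eq_exp_ℂ]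
  fin_cases i <;> rfl

theorem smul_diagSU3 (r s t : ℝ) : r • diagSU3 s t = diagSU3 (r * s) (r * t) := by
  apply mat_injective
  rw [map_smul, diagSU3, diagSU3, mat_ofMat, mat_ofMat, ← Matrix.diagonal_smul]
  congr 1
  ext i
  fin_cases i <;> simp <;> ring

theorem continuous_diagSU3 : Continuous fun p : ℝ × ℝ => diagSU3 p.1 p.2 := by
  have h : ∀ p : ℝ × ℝ, diagSU3 p.1 p.2 = p.1 • diagSU3 1 0 + p.2 • diagSU3 0 1 := by
    intro p
    apply mat_injective
    rw [map_add, smul_diagSU3, smul_diagSU3, diagSU3, diagSU3, diagSU3, mat_ofMat, mat_ofMat,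
      mat_ofMat, Matrix.diagonal_add]
    congr 1
    ext i
    fin_cases i
    · simp
    · simp
    · simp
      ring
  simp only [h]
  fun_prop

theorem continuous_torusSU3 : Continuous fun p : ℝ × ℝ => torusSU3 p.1 p.2 :=
  ExpModel.continuous_η.comp continuous_diagSU3

/-- A diagonal element whose entries are distinct. -/
noncomputable def regularSU3 : SU3c := torusSU3 (Real.pi / 2) 0

theorem toMat_regularSU3 :
    toMat regularSU3 = Matrix.diagonal ![Complex.I, 1, -Complex.I] := by
  rw [regularSU3, toMat_torusSU3]
  congr 1
  have h : Complex.exp (Complex.I * ((Real.pi / 2 : ℝ) : ℂ)) = Complex.I := by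
    rw [mul_comm]
    push_cast
    exact Complex.exp_pi_div_two_mul_I
  ext i
  fin_cases i
  · exact h
  · simp
  · change Complex.exp (-(Complex.I * (((Real.pi / 2 : ℝ) : ℂ) + ((0 : ℝ) : ℂ)))) = -Complex.I
    rw [Complex.ofReal_zero, add_zero, Complex.exp_neg, h, Complex.inv_I]

theorem torusSU3_mul_comm (s t s' t' : ℝ) :
    torusSU3 s t * torusSU3 s' t' = torusSU3 s' t' * torusSU3 s t := by
  apply toMat_injective
  rw [map_mul, map_mul, toMat_torusSU3, toMat_torusSU3, Matrix.diagonal_mul_diagonal,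
    Matrix.diagonal_mul_diagonal]
  congr 1
  ext i
  exact mul_comm _ _

/-- Elements commuting with the regular element are diagonal. -/
theorem exists_of_commute {g : SU3c} (h : regularSU3 * g = g * regularSU3) :
    ∃ s t : ℝ, g = torusSU3 s t ∧ (involutionSU3 g = g → t = 0) := by
  have hI : Complex.I ≠ 1 := fun h => by simpa using congrArg Complex.re h
  have hI' : -Complex.I ≠ 1 := fun h => by simpa using congrArg Complex.re h
  have hd : ∀ i j, i ≠ j → toMat g i j = 0 := by
    intro i j hij
    have h2 := congrFun (congrFun (congrArg toMat h) i) j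
    rw [map_mul, map_mul, toMat_regularSU3, Matrix.mul_diagonal, Matrix.diagonal_mul] at h2
    fin_cases i <;> fin_cases j <;> simp at hij h2 ⊢
    · exact mul_left_cancel₀ (sub_ne_zero.2 hI) (by linear_combination h2)
    · exact mul_left_cancel₀ Complex.I_ne_zero (by linear_combination h2 / 2)
    · exact mul_left_cancel₀ (sub_ne_zero.2 hI) (by linear_combination -h2)
    · exact mul_left_cancel₀ (sub_ne_zero.2 hI') (by linear_combination -h2)
    · exact mul_left_cancel₀ Complex.I_ne_zero (by linear_combination -h2 / 2)
    · exact mul_left_cancel₀ (sub_ne_zero.2 hI') (by linear_combination h2)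
  have hdiag : toMat g = Matrix.diagonal ![toMat g 0 0, toMat g 1 1, toMat g 2 2] := by
    ext i j
    by_cases hij : i = j
    · subst hij
      fin_cases i <;> simp
    · rw [hd i j hij, Matrix.diagonal_apply_ne _ hij]
  have hn : ∀ i, toMat g i i * starRingEnd ℂ (toMat g i i) = 1 := by
    intro i
    have h1 := congrFun (congrFun (toMat_mul_star g) i) i
    rw [Matrix.mul_apply, Finset.sum_eq_single i (fun j _ hj => by rw [hd i j hj.symm, zero_mul])
      (by simp), Matrix.one_apply_eq, Matrix.star_apply] at h1
    exact h1
  have hexp : ∀ i, toMat g i i = Complex.exp (Complex.I * ((toMat g i i).arg : ℂ)) := by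
    intro i
    have h1 := hn i
    rw [Complex.mul_conj, Complex.normSq_eq_norm_sq] at h1
    have h2 : ‖toMat g i i‖ ^ 2 = 1 := by exact_mod_cast h1
    have h3 : ‖toMat g i i‖ = 1 :=
      (pow_eq_one_iff_of_nonneg (norm_nonneg _) two_ne_zero).1 h2
    have h4 := Complex.norm_mul_exp_arg_mul_I (toMat g i i)
    rw [h3, Complex.ofReal_one, one_mul, mul_comm] at h4
    exact h4.symm
  have hdet := det_toMat g
  rw [hdiag, Matrix.det_diagonal] at hdet
  simp only [Fin.prod_univ_three, Matrix.cons_val] at hdet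
  refine ⟨(toMat g 0 0).arg, (toMat g 1 1).arg, toMat_injective ?_, fun hσ => ?_⟩
  · refine hdiag.trans ?_
    rw [toMat_torusSU3, ← hexp, ← hexp]
    congr 1
    ext i
    fin_cases i
    · rfl
    · rfl
    · change toMat g 2 2 = Complex.exp _
      rw [mul_add, Complex.exp_neg, Complex.exp_add, ← hexp, ← hexp]
      exact eq_inv_of_mul_eq_one_right hdet
  -- Invariance makes the outer entries conjugate, so their product is `1`; the determinant then
  -- makes the middle entry `1`, whose argument is `0`.
  · have h1 : starRingEnd ℂ (toMat g 2 2) = toMat g 0 0 := by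
      have h2 := congrFun (congrFun (congrArg toMat hσ) 0) 0
      exact h2
    have h2 := hn 2
    rw [h1] at h2
    have h3 : toMat g 1 1 = 1 := by linear_combination hdet - toMat g 1 1 * h2
    rw [h3, Complex.arg_one]

theorem involutionSU3_torusSU3 (s : ℝ) : involutionSU3 (torusSU3 s 0) = torusSU3 s 0 := by
  apply toMat_injective
  rw [toMat_involutionSU3, toMat_torusSU3]
  ext i j
  rw [flipMat_apply]
  fin_cases i <;> fin_cases j <;> simp [← Complex.exp_conj, Fin.rev]

/-- The diagonal matrices. -/
noncomputable def diagonalSU3 : Subgroup SU3c := Subgroup.centralizer {regularSU3}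

theorem mem_diagonalSU3_iff {g : SU3c} : g ∈ diagonalSU3 ↔ ∃ s t, g = torusSU3 s t := by
  rw [diagonalSU3, Subgroup.mem_centralizer_singleton_iff]
  constructor
  · intro h
    obtain ⟨s, t, hst, -⟩ := exists_of_commute h.symm
    exact ⟨s, t, hst⟩
  · rintro ⟨s, t, rfl⟩
    exact torusSU3_mul_comm _ _ _ _

theorem mem_diagonalSU3_inf_iff {g : SU3c} :
    g ∈ diagonalSU3 ⊓ fixedSU3 ↔ ∃ s, g = torusSU3 s 0 := by
  constructor
  · rintro ⟨h, hσ⟩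
    have h' : g ∈ diagonalSU3 := h
    rw [diagonalSU3, Subgroup.mem_centralizer_singleton_iff] at h'
    obtain ⟨s, t, hst, ht⟩ := exists_of_commute h'.symm
    rw [ht hσ] at hst
    exact ⟨s, hst⟩
  · rintro ⟨s, rfl⟩
    exact ⟨mem_diagonalSU3_iff.2 ⟨s, 0, rfl⟩, involutionSU3_torusSU3 s⟩

theorem regularSU3_mem : regularSU3 ∈ diagonalSU3 ⊓ fixedSU3 :=
  mem_diagonalSU3_inf_iff.2 ⟨_, rfl⟩

theorem isClosed_diagonalSU3 : IsClosed (diagonalSU3 : Set SU3c) := by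
  have h : (diagonalSU3 : Set SU3c) = {g | g * regularSU3 = regularSU3 * g} := by
    ext g
    rw [SetLike.mem_coe, diagonalSU3, Subgroup.mem_centralizer_singleton_iff]
    rfl
  rw [h]
  exact isClosed_eq (continuous_id.mul continuous_const) (continuous_const.mul continuous_id)

theorem isTorus_diagonalSU3 : IsTorus diagonalSU3 where
  isCompact := isClosed_diagonalSU3.isCompact
  isConnected := by
    have h : (diagonalSU3 : Set SU3c) = range fun p : ℝ × ℝ => torusSU3 p.1 p.2 := by
      ext g
      rw [SetLike.mem_coe, mem_diagonalSU3_iff]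
      exact ⟨fun ⟨s, t, h⟩ => ⟨(s, t), h.symm⟩, fun ⟨p, h⟩ => ⟨p.1, p.2, h.symm⟩⟩
    rw [h]
    exact isConnected_range continuous_torusSU3
  mul_comm := by
    intro a ha b hb
    obtain ⟨s, t, rfl⟩ := mem_diagonalSU3_iff.1 ha
    obtain ⟨s', t', rfl⟩ := mem_diagonalSU3_iff.1 hb
    exact torusSU3_mul_comm _ _ _ _

theorem isTorus_diagonalSU3_inf : IsTorus (diagonalSU3 ⊓ fixedSU3) where
  isCompact := (isClosed_diagonalSU3.inter isClosed_fixedSU3).isCompact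
  isConnected := by
    have h : ((diagonalSU3 ⊓ fixedSU3 : Subgroup SU3c) : Set SU3c) =
        range fun s : ℝ => torusSU3 s 0 := by
      ext g
      rw [SetLike.mem_coe, mem_diagonalSU3_inf_iff]
      exact ⟨fun ⟨s, h⟩ => ⟨s, h.symm⟩, fun ⟨s, h⟩ => ⟨s, h.symm⟩⟩
    rw [h]
    exact isConnected_range (continuous_torusSU3.comp (by fun_prop : Continuous fun s : ℝ => (s, (0 : ℝ))))
  mul_comm := fun a ha b hb => isTorus_diagonalSU3.mul_comm a ha.1 b hb.1

/-- A torus is abelian, so it centralizes each of its elements. As `regularSU3` is also fixed by the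
involution, this gives the maximality of both tori. -/
theorem mem_diagonalSU3_of_isTorus {T : Subgroup SU3c} (hT : IsTorus T) (h : regularSU3 ∈ T) :
    T ≤ diagonalSU3 := by
  intro g hg
  rw [diagonalSU3, Subgroup.mem_centralizer_singleton_iff]
  exact hT.mul_comm _ hg _ h

theorem symmetricSU3_le : symmetricSU3 ≤ fixedSU3 := by
  rintro _ ⟨g, -, rfl⟩
  exact g.2

/-- Maximal tori of diagonal matrices. -/
noncomputable def toriSU3 : MaximalTori LieSU3 SU3c pairSU3 where
  TK := diagonalSU3 ⊓ fixedSU3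
  TG := diagonalSU3
  isMaximalTorus_TK := by
    refine ⟨⟨isTorus_diagonalSU3_inf, ?_⟩, fun T hT hle => ?_⟩
    · change ((diagonalSU3 ⊓ fixedSU3 : Subgroup SU3c) : Set SU3c) ⊆ symmetricSU3
      rw [coe_symmetricSU3]
      exact isTorus_diagonalSU3_inf.isConnected.isPreconnected.subset_connectedComponentIn
        (one_mem (diagonalSU3 ⊓ fixedSU3)) fun g hg => hg.2
    · exact le_inf (mem_diagonalSU3_of_isTorus hT.1 (hle regularSU3_mem))
        (hT.2.trans symmetricSU3_le)
  isMaximalTorus_TG :=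
    ⟨⟨isTorus_diagonalSU3, le_top⟩, fun _ hT hle =>
      mem_diagonalSU3_of_isTorus hT.1 (hle regularSU3_mem.1)⟩
  le := inf_le_left

theorem diagSU3_mem_tg (s t : ℝ) : diagSU3 s t ∈ toriSU3.tg := by
  refine (mem_lieAlg_iff (E := LieSU3)).2 ⟨_, fun r => ?_, ExpModel.hasVelocity_η (diagSU3 s t)⟩
  rw [smul_diagSU3]
  exact mem_diagonalSU3_iff.2 ⟨_, _, rfl⟩

theorem hasDerivAt_toMat_apply {γ : ℝ → SU3c} {X : LieSU3} (h : HasVelocity γ X) (i j : Fin 3) :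
    HasDerivAt (fun r => toMat (γ r) i j) (mat X i j) 0 := by
  have h1 := ExpModel.hasDerivAt_ι h
  rw [incl_SU3] at h1
  let L : Mat3 →L[ℝ] ℂ := LinearMap.toContinuousLinearMap
    { toFun := fun Y => Y i j
      map_add' := fun _ _ => rfl
      map_smul' := fun _ _ => rfl }
  exact L.hasFDerivAt.comp_hasDerivAt (0 : ℝ) h1

theorem mat_apply_of_mem_tg {X : LieSU3} (hX : X ∈ toriSU3.tg) {i j : Fin 3} (hij : i ≠ j) :
    mat X i j = 0 := by
  obtain ⟨γ, hγ, h⟩ := (mem_lieAlg_iff (E := LieSU3)).1 hX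
  refine (hasDerivAt_toMat_apply h i j).unique ?_
  have h1 : (fun r => toMat (γ r) i j) = fun _ => 0 := by
    funext r
    obtain ⟨s, t, hst⟩ := mem_diagonalSU3_iff.1 (hγ r)
    rw [hst, toMat_torusSU3, Matrix.diagonal_apply_ne _ hij]
  rw [h1]
  exact hasDerivAt_const _ _

theorem mat_apply_of_mem_tk {X : LieSU3} (hX : X ∈ toriSU3.tk) : mat X 1 1 = 0 := by
  obtain ⟨γ, hγ, h⟩ := (mem_lieAlg_iff (E := LieSU3)).1 hX
  refine (hasDerivAt_toMat_apply h 1 1).unique ?_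
  have h1 : (fun r => toMat (γ r) 1 1) = fun _ => 1 := by
    funext r
    obtain ⟨s, hst⟩ := mem_diagonalSU3_inf_iff.1 (hγ r)
    rw [hst, toMat_torusSU3]
    simp
  rw [h1]
  exact hasDerivAt_const _ _

end Involution

/-! ### Roots of `SU(3)` and a restricted root whose double is one. -/

section RootsSU3

/-- A pair of vectors that `t` rotates is the real and imaginary part of a root vector. -/
theorem mem_rootsOf_of_rotation {𝔤 : Type*} [LieRing 𝔤] [LieAlgebra ℝ 𝔤] {t : Submodule ℝ 𝔤}
    {α : Module.Dual ℝ t} (hα : α ≠ 0) {x y : 𝔤} (hx : x ≠ 0)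
    (h : ∀ W : t, ⁅(W : 𝔤), x⁆ = -(α W • y)) (h' : ∀ W : t, ⁅(W : 𝔤), y⁆ = α W • x) :
    α ∈ rootsOf t := by
  refine ⟨hα, (1 : ℂ) ⊗ₜ[ℝ] x + Complex.I ⊗ₜ[ℝ] y, fun h0 => hx (tmul_add_tmul_eq_zero h0).1,
    fun W => ?_⟩
  refine (lie_tmul_add_tmul _ _ _).trans ?_
  rw [h, h', smul_add, TensorProduct.smul_tmul', TensorProduct.smul_tmul', TensorProduct.tmul_neg,
    ← TensorProduct.smul_tmul, ← TensorProduct.smul_tmul, add_comm, ← TensorProduct.neg_tmul]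
  have h1 : α W • Complex.I = (Complex.I * (α W : ℂ)) • (1 : ℂ) := by
    simp [mul_comm]
  have h2 : -(α W • (1 : ℂ)) = (Complex.I * (α W : ℂ)) • Complex.I := by
    rw [smul_eq_mul, mul_right_comm, Complex.I_mul_I]
    simp
  rw [h1, h2]

/-- Elements of the Lie algebra of the torus as elements of the Lie algebra of the group. -/
noncomputable def torusToLie : toriSU3.tg →ₗ[ℝ] LieSU3 := toriSU3.tg.subtype

/-- The difference of the diagonal entries with indices `j` and `k`, divided by `i`. -/
noncomputable def diffSU3 (j k : Fin 3) : Module.Dual ℝ toriSU3.tg where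
  toFun := fun W => (mat (torusToLie W) j j - mat (torusToLie W) k k).im
  map_add' := fun W W' => by
    simp
    ring
  map_smul' := fun c W => by
    simp
    ring

theorem diffSU3_apply (j k : Fin 3) (W : toriSU3.tg) :
    diffSU3 j k W = (mat (torusToLie W) j j - mat (torusToLie W) k k).im := rfl

theorem re_mat_apply_self (X : LieSU3) (i : Fin 3) : (mat X i i).re = 0 := by
  have h := congrArg Complex.re (congrFun (congrFun (star_mat X) i) i)
  simp only [Matrix.star_apply, Complex.star_def, Complex.conj_re, Matrix.neg_apply,
    Complex.neg_re] at h
  linarith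

theorem mat_sub_eq (j k : Fin 3) (W : toriSU3.tg) :
    mat (torusToLie W) j j - mat (torusToLie W) k k = Complex.I * (diffSU3 j k W : ℂ) := by
  apply Complex.ext
  · rw [Complex.sub_re, re_mat_apply_self, re_mat_apply_self]
    simp
  · simp [diffSU3_apply]

theorem mat_torusToLie (W : toriSU3.tg) :
    mat (torusToLie W) = Matrix.diagonal fun i => mat (torusToLie W) i i := by
  ext i j
  by_cases hij : i = j
  · subst hij
    simp
  · have h : mat (torusToLie W) i j = 0 := mat_apply_of_mem_tg W.2 hij
    rw [h, Matrix.diagonal_apply_ne _ hij]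

theorem diagonal_commutator_skew {d : Fin 3 → ℂ} {j k : Fin 3} {c : ℝ} (hjk : j ≠ k)
    (h : d j - d k = Complex.I * c) :
    Matrix.diagonal d * (Matrix.single j k 1 - Matrix.single k j 1) -
        (Matrix.single j k 1 - Matrix.single k j 1) * Matrix.diagonal d =
      -(c • (Matrix.single j k (-Complex.I) + Matrix.single k j (-Complex.I))) := by
  ext a b
  simp only [Matrix.sub_apply, Matrix.neg_apply, Matrix.smul_apply, Matrix.add_apply,
    Matrix.diagonal_mul, Matrix.mul_diagonal, Matrix.single_apply, Complex.real_smul]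
  by_cases h2 : j = a ∧ k = b
  · obtain ⟨rfl, rfl⟩ := h2
    simp only [hjk, hjk.symm, and_self, if_true, if_false]
    linear_combination h
  · by_cases h3 : k = a ∧ j = b
    · obtain ⟨rfl, rfl⟩ := h3
      simp only [hjk, hjk.symm, and_self, if_true, if_false]
      linear_combination h
    · simp only [h2, h3, if_false]
      ring

theorem diagonal_commutator_symm {d : Fin 3 → ℂ} {j k : Fin 3} {c : ℝ} (hjk : j ≠ k)
    (h : d j - d k = Complex.I * c) :
    Matrix.diagonal d * (Matrix.single j k (-Complex.I) + Matrix.single k j (-Complex.I)) -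
        (Matrix.single j k (-Complex.I) + Matrix.single k j (-Complex.I)) * Matrix.diagonal d =
      c • (Matrix.single j k 1 - Matrix.single k j 1) := by
  ext a b
  simp only [Matrix.sub_apply, Matrix.smul_apply, Matrix.add_apply,
    Matrix.diagonal_mul, Matrix.mul_diagonal, Matrix.single_apply, Complex.real_smul]
  by_cases h2 : j = a ∧ k = b
  · obtain ⟨rfl, rfl⟩ := h2
    simp only [hjk, hjk.symm, and_self, if_true, if_false]
    linear_combination (-Complex.I) * h - c * Complex.I_mul_I
  · by_cases h3 : k = a ∧ j = b
    · obtain ⟨rfl, rfl⟩ := h3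
      simp only [hjk, hjk.symm, and_self, if_true, if_false]
      linear_combination Complex.I * h + c * Complex.I_mul_I
    · simp only [h2, h3, if_false]
      ring

theorem mat_skewSU3 {j k : Fin 3} (hjk : j ≠ k) :
    mat (skewSU3 hjk) = Matrix.single j k 1 - Matrix.single k j 1 := rfl

theorem mat_symmSU3 {j k : Fin 3} (hjk : j ≠ k) :
    mat (symmSU3 hjk) =
      Matrix.single j k (-Complex.I) + Matrix.single k j (-Complex.I) := rfl

theorem bracketE_eq_of_mat {X Y Z : LieSU3} {A B C : Matrix (Fin 3) (Fin 3) ℂ}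
    (hA : mat X = A) (hB : mat Y = B) (hC : mat Z = C) (h : A * B - B * A = C) :
    bracketE LieSU3 SU3c X Y = Z := by
  subst hA hB hC
  exact mat_injective ((mat_bracketE X Y).trans h)

theorem bracketE_skewSU3 {j k : Fin 3} (hjk : j ≠ k) (W : toriSU3.tg) :
    bracketE LieSU3 SU3c (torusToLie W) (skewSU3 hjk) = -(diffSU3 j k W • symmSU3 hjk) :=
  bracketE_eq_of_mat (mat_torusToLie W) (mat_skewSU3 hjk)
    (by rw [map_neg, map_smul, mat_symmSU3 hjk])
    (diagonal_commutator_skew hjk (mat_sub_eq j k W))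

theorem bracketE_symmSU3 {j k : Fin 3} (hjk : j ≠ k) (W : toriSU3.tg) :
    bracketE LieSU3 SU3c (torusToLie W) (symmSU3 hjk) = diffSU3 j k W • skewSU3 hjk :=
  bracketE_eq_of_mat (mat_torusToLie W) (mat_symmSU3 hjk)
    (by rw [map_smul, mat_skewSU3 hjk])
    (diagonal_commutator_symm hjk (mat_sub_eq j k W))

theorem skewSU3_ne_zero {j k : Fin 3} (hjk : j ≠ k) : skewSU3 hjk ≠ 0 := by
  intro h
  have h1 : mat (skewSU3 hjk) j k = 0 := by rw [h, map_zero, Matrix.zero_apply]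
  rw [skewSU3, mat_ofMat] at h1
  simp [hjk.symm] at h1

theorem diffSU3_mem_roots {j k : Fin 3} (hjk : j ≠ k) (h0 : diffSU3 j k ≠ 0) :
    diffSU3 j k ∈ roots toriSU3.tg :=
  mem_rootsOf_of_rotation h0 (skewSU3_ne_zero hjk) (bracketE_skewSU3 hjk) (bracketE_symmSU3 hjk)

theorem diffSU3_zero_ne_zero {k : Fin 3} (hk : k ≠ 0) : diffSU3 0 k ≠ 0 := by
  intro h
  have h1 : diffSU3 0 k ⟨diagSU3 1 0, diagSU3_mem_tg 1 0⟩ = 0 := by rw [h]; rfl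
  have h2 : (mat (diagSU3 1 0) 0 0 - mat (diagSU3 1 0) k k).im = 0 := h1
  rw [diagSU3, mat_ofMat] at h2
  fin_cases k
  · exact hk rfl
  · simp at h2
  · norm_num at h2

/-- On the smaller torus the middle entry vanishes, so by tracelessness the outer entries are
opposite. -/
theorem restrict_diffSU3 :
    toriSU3.restrict (diffSU3 0 2) = (2 : ℝ) • toriSU3.restrict (diffSU3 0 1) := by
  ext W
  have h1 : mat W.1 1 1 = 0 := mat_apply_of_mem_tk W.2
  have h2 := trace_mat W.1
  rw [Matrix.trace, Fin.sum_univ_three] at h2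
  simp only [Matrix.diag_apply] at h2
  rw [h1, add_zero] at h2
  change (mat W.1 0 0 - mat W.1 2 2).im = 2 * (mat W.1 0 0 - mat W.1 1 1).im
  rw [h1, eq_neg_of_add_eq_zero_right h2]
  simp
  ring

theorem exists_nonreduced : ∃ φ ∈ toriSU3.restrictedRoots,
    (2 : ℝ) • φ ∈ toriSU3.restrictedRoots :=
  ⟨_, ⟨_, diffSU3_mem_roots (j := 0) (k := 1) (by decide) (diffSU3_zero_ne_zero (by decide)), rfl⟩,
    _, diffSU3_mem_roots (j := 0) (k := 2) (by decide) (diffSU3_zero_ne_zero (by decide)),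
    restrict_diffSU3⟩

end RootsSU3

end SymPair

theorem mainTheorem3 :
    (∀ (E : Type u) [NormedAddCommGroup E] [NormedSpace ℝ E] [FiniteDimensional ℝ E]
      (G : Type v) [TopologicalSpace G] [ChartedSpace E G] [Group G] [LieGroup 𝓘(ℝ, E) ∞ G]
      [T2Space G] [CompactSpace G] [ConnectedSpace G]
      (S : SymPair.CompactTypePair E G) (T : SymPair.MaximalTori E G S),
      ∃ (hσ : ∀ X ∈ T.tg, S.dσ X ∈ T.tg) (H : Module.Dual ℝ T.tg → T.tg),
        -- `H α` is the vector that represents `α` with respect to the Killing form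
        (∀ (α : Module.Dual ℝ T.tg) (W : T.tg),
          α W = killingForm ℝ (GroupLieAlgebra 𝓘(ℝ, E) G) W (H α)) ∧
        -- the dichotomy
        (∀ α ∈ SymPair.roots T.tg, α ∘ₗ S.dσ.restrict hσ ≠ α →
          (killingForm ℝ (GroupLieAlgebra 𝓘(ℝ, E) G) (H α) (H (α ∘ₗ S.dσ.restrict hσ)) = 0 ∧
            killingForm ℝ (GroupLieAlgebra 𝓘(ℝ, E) G) (S.pPart (H α)) (S.pPart (H α)) =
              killingForm ℝ (GroupLieAlgebra 𝓘(ℝ, E) G) (S.kPart (H α)) (S.kPart (H α))) ∨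
          (2 * (killingForm ℝ (GroupLieAlgebra 𝓘(ℝ, E) G) (H α) (H (α ∘ₗ S.dσ.restrict hσ)) /
              killingForm ℝ (GroupLieAlgebra 𝓘(ℝ, E) G) (H α) (H α)) = -1 ∧
            killingForm ℝ (GroupLieAlgebra 𝓘(ℝ, E) G) (S.pPart (H α)) (S.pPart (H α)) =
              3 * killingForm ℝ (GroupLieAlgebra 𝓘(ℝ, E) G) (S.kPart (H α)) (S.kPart (H α)) ∧
            α + α ∘ₗ S.dσ.restrict hσ ∈ SymPair.roots T.tg)) ∧
        -- the restricted roots form a root system, with the reflections that are orthogonal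
        -- with respect to the Killing form
        T.restrictedRoots.Finite ∧
        ∃ P : RootPairing T.restrictedRoots ℝ (Module.Dual ℝ T.tk) T.tk,
          (∀ φ X, P.toLinearMap φ X = φ X) ∧
          (∀ φ, P.root φ = φ) ∧
          P.IsRootSystem ∧ P.IsCrystallographic ∧
          ∀ (φ : T.restrictedRoots) (α : Module.Dual ℝ T.tg), α ∈ SymPair.roots T.tg →
            T.restrict α = φ →
            (P.coroot φ : GroupLieAlgebra 𝓘(ℝ, E) G) =
              (2 / killingForm ℝ (GroupLieAlgebra 𝓘(ℝ, E) G) (S.kPart (H α)) (S.kPart (H α))) •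
                S.kPart (H α)) ∧
    -- the root system of restricted roots is not always reduced
    (∃ (E : Type) (_ : NormedAddCommGroup E) (_ : NormedSpace ℝ E) (_ : FiniteDimensional ℝ E)
      (G : Type) (_ : TopologicalSpace G) (_ : ChartedSpace E G) (_ : Group G)
      (_ : LieGroup 𝓘(ℝ, E) ∞ G) (_ : T2Space G) (_ : CompactSpace G) (_ : ConnectedSpace G)
      (S : SymPair.CompactTypePair E G) (T : SymPair.MaximalTori E G S),
      ∃ φ ∈ T.restrictedRoots, (2 : ℝ) • φ ∈ T.restrictedRoots) := by
  refine ⟨?_, ?_⟩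
  · intro E _ _ _ G _ _ _ _ _ _ _ S T
    exact SymPair.rootSystem_of_restrictedRoots S T
  · exact ⟨SymPair.LieSU3, inferInstance, inferInstance, inferInstance, SymPair.SU3c,
      inferInstance, inferInstance, inferInstance, inferInstance, inferInstance, inferInstance,
      inferInstance, SymPair.pairSU3, SymPair.toriSU3, SymPair.exists_nonreduced⟩
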